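/- Let $J \subset S^3$ be a (tame) knot with open tubular neighbourhood $\nu J$, so that the exterior $S^3 \setminus \nu J$ is compact with torus boundary, and let $\mu$ and $\lambda$ be the meridian of $J$ and the longitude of $J$ that is null-homologous in $S^3\setminus\nu J$. Let $N$ be the twisted $I$-bundle over the Klein bottle (with orientable total space), that is, $N = (S^1 \times S^1 \times [-1,1])/\bigl((z,w,t) \sim (-z,\bar w,-t)\bigr)$ with $S^1 \subset \mathbb{C}$, so that $\partial N$ is the torus $S^1 \times S^1 \times \{1\}$. On $\partial N$ let $\phi_0$ be the curve $w \mapsto [1,w,1]$ (the rational longitude of $N$, which is the fibre slope of the Seifert structure over the Möbius band) and let $\phi_1$ be the dual curve $z \mapsto [z,1,1]$ (the fibre slope of the Seifert structure over the disc with two cone points of order two). Let $h : \partial N \to \partial(S^3 \setminus \nu J)$ be a homeomorphism (for instance, an orientation-reversing one), let $X = (S^3 \setminus \nu J) \cup_h N$ be the space obtained by gluing along $h$, and let $$[h_*] = \begin{pmatrix} q & r \\ p & s \end{pmatrix}$$ be the matrix of $h_* : H_1(\partial N;\mathbb{Z}) \to H_1(\partial (S^3\setminus\nu J);\mathbb{Z})$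 in the bases $(\phi_0, \phi_1)$ and $(\lambda, \mu)$, i.e. $h_*(\phi_0) = q\lambda + p\mu$ and $h_*(\phi_1) = r\lambda + s\mu$. Then $|H_1(X;\mathbb{Z})| = 8$ if and only if $|p| = 2$. Moreover, if $|p| = 2$, then $$H_1(X;\mathbb{Z}) \cong \begin{cases} \mathbb{Z}/2\mathbb{Z} \oplus \mathbb{Z}/4\mathbb{Z} & \text{if } s \text{ is even},\\ \mathbb{Z}/8\mathbb{Z} & \text{if } s \text{ is odd}.\end{cases}$$ -/

import Mathlib

noncomputable section

namespace KleinGluing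

/-! ### First singular homology with integer coefficients -/

/-- The first singular homology group `H_1(Y; ℤ)`. -/
abbrev H1 (Y : Type) [TopologicalSpace Y] : ModuleCat.{0} ℤ :=
  ((AlgebraicTopology.singularHomologyFunctor (ModuleCat.{0} ℤ) 1).obj
    (ModuleCat.of ℤ ℤ)).obj (TopCat.of Y)

/-- The homomorphism `f_* : H_1(Y; ℤ) → H_1(Z; ℤ)` induced by a continuous map. -/
def H1.map {Y Z : Type} [TopologicalSpace Y] [TopologicalSpace Z] (f : C(Y, Z)) :
    H1 Y →ₗ[ℤ] H1 Z :=
  (((AlgebraicTopology.singularHomologyFunctor (ModuleCat.{0} ℤ) 1).obj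
    (ModuleCat.of ℤ ℤ)).map (TopCat.ofHom f)).hom

/-- `u` is a fundamental class (an orientation) of the circle: a generator of `H_1(S¹; ℤ)`.
The homology class of a closed curve `γ : S¹ → Y` is then `H1.map γ u`. -/
def IsFundamentalClass (u : H1 Circle) : Prop :=
  ∀ x : H1 Circle, ∃ n : ℤ, x = n • u

/-! ### Knots in the three-sphere, their exteriors, meridians and longitudes -/

/-- The three-sphere. -/
abbrev S3 : Type := Metric.sphere (0 : EuclideanSpace ℝ (Fin 4)) 1

/-- A parametrized open tubular neighbourhood `S¹ × ℂ → S³` of a knot `J : S¹ → S³`.  Knots that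
have one are embedded and tame; every smooth knot has one. -/
structure TubularNbhd (J : C(Circle, S3)) where
  toFun : Circle × ℂ → S3
  isOpenEmbedding : Topology.IsOpenEmbedding toFun
  core : ∀ z : Circle, toFun (z, 0) = J z

namespace TubularNbhd

variable {J : C(Circle, S3)} (τ : TubularNbhd J)

/-- The (compact) knot exterior `S³ ∖ νJ`, where `νJ` is the open solid torus that corresponds to
`S¹ ×` (open unit disc). -/
def exterior : Set S3 :=
  (τ.toFun '' {x : Circle × ℂ | ‖x.2‖ < 1})ᶜ

/-- The boundary torus of the exterior, which corresponds to `S¹ × S¹`. -/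
def bdry : Set τ.exterior :=
  {x | ∃ y : Circle × ℂ, ‖y.2‖ = 1 ∧ τ.toFun y = x}

/-- The inclusion of the boundary torus in the exterior. -/
def incl : C(τ.bdry, τ.exterior) :=
  ⟨Subtype.val, continuous_subtype_val⟩

/-- The parametrization of the boundary torus of the exterior by `S¹ × S¹`. -/
def param : C(Circle × Circle, τ.bdry) where
  toFun x := ⟨⟨τ.toFun (x.1, (x.2 : ℂ)), by
      rintro ⟨y, hy, hxy⟩
      have h := τ.isOpenEmbedding.injective hxy
      rw [h] at hy
      exact absurd (Circle.norm_coe x.2) (ne_of_lt hy)⟩,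
    (x.1, (x.2 : ℂ)), Circle.norm_coe x.2, rfl⟩
  continuous_toFun := by
    refine Continuous.subtype_mk (Continuous.subtype_mk ?_ _) _
    exact τ.isOpenEmbedding.continuous.comp (by fun_prop)

/-- The meridian of the knot: the boundary of a fibre disc of the tubular neighbourhood. -/
def meridian : C(Circle, τ.bdry) :=
  τ.param.comp ⟨fun w => (1, w), by fun_prop⟩

/-- The curves on the boundary torus parallel to the knot: the `n`-th one winds `n` times in the
meridian direction, relative to the given parametrization. -/
def parallel (n : ℤ) : C(Circle, τ.bdry) :=
  τ.param.comp ⟨fun z => (z, z ^ n), by fun_prop⟩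

/-- The `n`-th parallel is the (Seifert) longitude: it is null-homologous in the exterior. -/
def IsLongitude (n : ℤ) : Prop :=
  H1.map (τ.incl.comp (τ.parallel n)) = 0

end TubularNbhd

/-! ### The twisted `I`-bundle over the Klein bottle -/

/-- The free involution `(z, w, t) ↦ (-z, w̄, -t)` of `S¹ × S¹ × [-1, 1]`.  It preserves the
orientation, and on `S¹ × S¹ × {0}` its quotient is the Klein bottle. -/
def flip (x : Circle × Circle × Set.Icc (-1 : ℝ) 1) : Circle × Circle × Set.Icc (-1 : ℝ) 1 :=
  (-x.1, x.2.1⁻¹,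
    ⟨-x.2.2.1, neg_le_neg x.2.2.2.2, neg_le.mp x.2.2.2.1⟩)

/-- The twisted `I`-bundle over the Klein bottle (with orientable total space): the quotient of
`S¹ × S¹ × [-1, 1]` by the involution `flip`, which is an interval bundle, with coordinate `t`,
over the Klein bottle `S¹ × S¹ / (z, w) ∼ (-z, w̄)`. -/
def N : Type := Quot (fun x y : Circle × Circle × Set.Icc (-1 : ℝ) 1 => y = flip x)

instance : TopologicalSpace N :=
  inferInstanceAs (TopologicalSpace
    (Quot (fun x y : Circle × Circle × Set.Icc (-1 : ℝ) 1 => y = flip x)))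

/-- The quotient map onto `N`. -/
def N.mk : C(Circle × Circle × Set.Icc (-1 : ℝ) 1, N) :=
  ⟨Quot.mk _, continuous_quot_mk⟩

/-- The boundary torus of `N`: the points with `t = ±1`. -/
def N.bdry : Set N :=
  {x | ∃ y : Circle × Circle × Set.Icc (-1 : ℝ) 1, |(y.2.2 : ℝ)| = 1 ∧ N.mk y = x}

/-- The parametrization of the boundary torus of `N` by `S¹ × S¹`, as the points with `t = 1`. -/
def N.param : C(Circle × Circle, N.bdry) where
  toFun x := ⟨N.mk (x.1, x.2, ⟨1, by norm_num⟩), (x.1, x.2, ⟨1, by norm_num⟩), by simp, rfl⟩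
  continuous_toFun :=
    Continuous.subtype_mk (N.mk.continuous.comp (by fun_prop)) _

/-- The curve `φ₀` on `∂N`: the rational longitude of `N`, the fibre of the Seifert structure
`(z, w, t) ↦ (z, t)` of `N` over the Möbius band. -/
def N.phi0 : C(Circle, N.bdry) :=
  N.param.comp ⟨fun w => (1, w), by fun_prop⟩

/-- The curve `φ₁` on `∂N`, dual to `φ₀`: the regular fibre of the Seifert structure
`(z, w, t) ↦ (w, t)` of `N` over the disc with two cone points of order two. -/
def N.phi1 : C(Circle, N.bdry) :=
  N.param.comp ⟨fun z => (z, 1), by fun_prop⟩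

/-! ### Gluing -/

/-- The space `A ∪_h B`: the disjoint union of `A` and `B` with `t ∈ T ⊆ B` identified with
`h t ∈ S ⊆ A`. -/
def Glue {A B : Type} [TopologicalSpace A] [TopologicalSpace B] {S : Set A} {T : Set B}
    (h : T ≃ₜ S) : Type :=
  Quot (fun x y : A ⊕ B => ∃ t : T, x = Sum.inl (h t : A) ∧ y = Sum.inr (t : B))

instance {A B : Type} [TopologicalSpace A] [TopologicalSpace B] {S : Set A} {T : Set B}
    (h : T ≃ₜ S) : TopologicalSpace (Glue h) :=
  inferInstanceAs (TopologicalSpace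
    (Quot (fun x y : A ⊕ B => ∃ t : T, x = Sum.inl (h t : A) ∧ y = Sum.inr (t : B))))

/-- The map induced on first homology by a homeomorphism of the boundary tori. -/
def bdryMap {A B : Type} [TopologicalSpace A] [TopologicalSpace B] {S : Set A} {T : Set B}
    (h : T ≃ₜ S) : H1 T →ₗ[ℤ] H1 S :=
  H1.map ⟨h, h.continuous⟩

end KleinGluing

end

/-! First homology is computed through its dual. A cocycle with values in an abelian group `A` is a
function on paths that kills constant paths and is additive around squares. Cocycles modulo
coboundaries amount to `Hom(H_1, A)`: a cocycle evaluates on homology (`evalHom`), coboundaries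
evaluate to zero, and there is a universal cocycle with values in `H_1` itself
(`exists_universal_cocycle`). To present `H_1` it therefore suffices to know, for every `A`, which
values cocycles can take on suitable loops, and when those values force a cocycle to be a
coboundary.

Two Mayer–Vietoris statements make cocycles local. By dyadic subdivision, cocycles on two open sets
that agree on the overlap glue (`exists_glue`), and a cocycle that is a coboundary on two open sets
with path-connected overlap is a coboundary (`IsCocycleOn.isTrivialOn_union`). Collars carry both
statements over to the closed pieces of a gluing.

For the knot exterior, the sphere enters twice. Vanishing first cohomology shows that a cocycle
vanishing on the longitude and the meridian is a coboundary, since it extends over the solid torus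
(`TubularNbhd.isTrivialOn_exterior`). Vanishing second cohomology, in the form `splitsOver_S3`,
gives an integral cocycle with value one on the meridian (`TubularNbhd.exists_cocycle_meridian`).
Thus the meridian freely generates what cocycles see of the exterior.

For `N`, let `A`-valued cocycles take the value `y` on the core `pathA` of an exceptional fibre and
`β` on the Klein bottle fibre `pathB`. Then `2β = 0`, every such pair occurs, and the pair
determines the class. The boundary curves `φ₀` and `φ₁` get the values `β` and `2y`.

On the glued space let the meridian have value `M` and `pathA` value `a`. The longitude contributes
nothing, so matching on the boundary torus says `β = pM` and `2a = sM`, with the remaining condition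
`2pM = 0`. Hence `H_1` is generated by `m` and `a` with relations `2pm = 0` and `sm = 2a`
(`exists_isPresented`). The subgroup generated by `m` has order `2|p|` and index two, so the order
is `4|p|`. For `|p| = 2` the parity of `s` decides between the two groups. -/

section
open CategoryTheory Simplicial unitInterval
noncomputable section
namespace KleinGluing

/-! ### Path cocycles -/

section Cocycles

variable {X Y : Type} [TopologicalSpace X] [TopologicalSpace Y]
variable {A B : Type} [AddCommGroup A] [AddCommGroup B]

/-- A function on paths is a one-cocycle on `S` if it vanishes on constant paths in `S` and its sum
over the boundary of every singular square in `S` vanishes. -/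
structure IsCocycleOn (S : Set X) (c : C(I, X) → A) : Prop where
  const : ∀ x ∈ S, c (.const I x) = 0
  square : ∀ H : C(I × I, X), (∀ z, H z ∈ S) →
    c (H.comp ⟨fun s => (s, 0), by fun_prop⟩) + c (H.comp ⟨fun t => (1, t), by fun_prop⟩) =
      c (H.comp ⟨fun t => (0, t), by fun_prop⟩) + c (H.comp ⟨fun s => (s, 1), by fun_prop⟩)

/-- A function on paths is a coboundary on `S` if it is the difference of the values of a function
at the endpoints, for the paths in `S`. -/
def IsTrivialOn (S : Set X) (c : C(I, X) → A) : Prop :=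
  ∃ g : X → A, ∀ γ : C(I, X), (∀ t, γ t ∈ S) → c γ = g (γ 1) - g (γ 0)

/-- The coboundary of a function on points. -/
def cobdry (g : X → A) (γ : C(I, X)) : A := g (γ 1) - g (γ 0)

lemma isCocycleOn_cobdry (g : X → A) (S : Set X) : IsCocycleOn S (cobdry g) where
  const x _ := by simp [cobdry]
  square H _ := by simp [cobdry]

lemma IsCocycleOn.mono {S T : Set X} {c : C(I, X) → A} (h : IsCocycleOn T c) (hST : S ⊆ T) :
    IsCocycleOn S c :=
  ⟨fun x hx => h.const x (hST hx), fun H hH => h.square H fun z => hST (hH z)⟩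

lemma IsTrivialOn.mono {S T : Set X} {c : C(I, X) → A} (h : IsTrivialOn T c) (hST : S ⊆ T) :
    IsTrivialOn S c :=
  let ⟨g, hg⟩ := h
  ⟨g, fun γ hγ => hg γ fun t => hST (hγ t)⟩

lemma IsCocycleOn.add {S : Set X} {c d : C(I, X) → A} (hc : IsCocycleOn S c)
    (hd : IsCocycleOn S d) : IsCocycleOn S (c + d) where
  const x hx := by simp [hc.const x hx, hd.const x hx]
  square H hH := by
    have h1 := hc.square H hH
    have h2 := hd.square H hH
    simp only [Pi.add_apply]
    rw [add_add_add_comm, h1, h2, add_add_add_comm]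

lemma IsCocycleOn.map {S : Set X} {c : C(I, X) → A} (hc : IsCocycleOn S c) (φ : A →+ B) :
    IsCocycleOn S (fun γ => φ (c γ)) where
  const x hx := by simp [hc.const x hx]
  square H hH := by rw [← map_add, hc.square H hH, map_add]

lemma IsCocycleOn.neg {S : Set X} {c : C(I, X) → A} (hc : IsCocycleOn S c) :
    IsCocycleOn S (-c) :=
  hc.map (negAddMonoidHom : A →+ A)

lemma IsCocycleOn.sub {S : Set X} {c d : C(I, X) → A} (hc : IsCocycleOn S c)
    (hd : IsCocycleOn S d) : IsCocycleOn S (c - d) := by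
  rw [sub_eq_add_neg]
  exact hc.add hd.neg

lemma isCocycleOn_zero (S : Set X) : IsCocycleOn S (0 : C(I, X) → A) :=
  ⟨fun _ _ => rfl, fun _ _ => rfl⟩

lemma IsCocycleOn.congr {S : Set X} {c d : C(I, X) → A} (hc : IsCocycleOn S c)
    (h : ∀ γ : C(I, X), (∀ t, γ t ∈ S) → d γ = c γ) : IsCocycleOn S d where
  const x hx := by rw [h _ fun _ => hx, hc.const x hx]
  square H hH := by
    rw [h _ fun _ => hH _, h _ fun _ => hH _, h _ fun _ => hH _, h _ fun _ => hH _,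
      hc.square H hH]

lemma IsCocycleOn.comp {S : Set X} {T : Set Y} {c : C(I, Y) → A} (hc : IsCocycleOn T c)
    (f : C(X, Y)) (hf : ∀ x ∈ S, f x ∈ T) : IsCocycleOn S (fun γ => c (f.comp γ)) where
  const x hx := hc.const _ (hf x hx)
  square H hH := hc.square (f.comp H) fun z => hf _ (hH z)

lemma IsTrivialOn.comp {S : Set X} {T : Set Y} {c : C(I, Y) → A} (hc : IsTrivialOn T c)
    (f : C(X, Y)) (hf : ∀ x ∈ S, f x ∈ T) : IsTrivialOn S (fun γ => c (f.comp γ)) :=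
  let ⟨g, hg⟩ := hc
  ⟨g ∘ f, fun γ hγ => hg (f.comp γ) fun t => hf _ (hγ t)⟩

lemma IsTrivialOn.add {S : Set X} {c d : C(I, X) → A} (hc : IsTrivialOn S c)
    (hd : IsTrivialOn S d) : IsTrivialOn S (c + d) := by
  obtain ⟨g, hg⟩ := hc
  obtain ⟨g', hg'⟩ := hd
  refine ⟨g + g', fun γ hγ => ?_⟩
  simp only [Pi.add_apply, hg γ hγ, hg' γ hγ]
  abel

lemma isTrivialOn_cobdry (g : X → A) (S : Set X) : IsTrivialOn S (cobdry g) :=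
  ⟨g, fun _ _ => rfl⟩

end Cocycles

/-! ### The singular chain complex in degrees at most two -/

section Bridge

variable {Y Z : Type} [TopologicalSpace Y] [TopologicalSpace Z]
variable {A : Type} [AddCommGroup A]

variable (Y) in
/-- The singular simplicial set. -/
abbrev sing : SSet.{0} := TopCat.toSSet.obj (TopCat.of Y)

variable (Y) in
/-- The integral singular chain complex. -/
abbrev chains : ChainComplex (ModuleCat.{0} ℤ) ℕ := (sing Y).chainComplex (ModuleCat.of ℤ ℤ)

/-- The chain map induced by a continuous map. -/
abbrev chainsMap (f : C(Y, Z)) : chains Y ⟶ chains Z :=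
  SSet.chainComplexMap (TopCat.toSSet.map (TopCat.ofHom f)) (ModuleCat.of ℤ ℤ)

/-- A continuous map from the standard simplex as a singular simplex. -/
def mkSimplex {n : ℕ} (x : C(stdSimplex ℝ (Fin (n + 1)), Y)) : (sing Y) _⦋n⦌ :=
  (TopCat.toSSetObjEquiv (TopCat.of Y) (.op ⦋n⦌)).symm x

lemma mkSimplex_surjective {n : ℕ} :
    Function.Surjective (mkSimplex : C(stdSimplex ℝ (Fin (n + 1)), Y) → (sing Y) _⦋n⦌) :=
  (TopCat.toSSetObjEquiv (TopCat.of Y) (.op ⦋n⦌)).symm.surjective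

/-- A path as a singular one-simplex. -/
def pathSimplex (γ : C(I, Y)) : (sing Y) _⦋1⦌ :=
  mkSimplex (γ.comp (stdSimplexHomeomorphUnitInterval : C(stdSimplex ℝ (Fin 2), I)))

/-- A point as a singular zero-simplex. -/
def ptSimplex (y : Y) : (sing Y) _⦋0⦌ := mkSimplex (.const _ y)

lemma pathSimplex_surjective : Function.Surjective (pathSimplex : C(I, Y) → (sing Y) _⦋1⦌) := by
  intro x
  obtain ⟨x, rfl⟩ := mkSimplex_surjective x
  refine ⟨x.comp (stdSimplexHomeomorphUnitInterval.symm : C(I, stdSimplex ℝ (Fin 2))), ?_⟩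
  unfold pathSimplex
  congr 1
  ext s
  simp

lemma ptSimplex_bijective : Function.Bijective (ptSimplex : Y → (sing Y) _⦋0⦌) := by
  refine ⟨fun x y h => ?_, fun x => ?_⟩
  · have := (TopCat.toSSetObjEquiv (TopCat.of Y) (.op ⦋0⦌)).symm.injective h
    exact DFunLike.congr_fun this (default : stdSimplex ℝ (Fin 1))
  · obtain ⟨x, rfl⟩ := mkSimplex_surjective x
    refine ⟨x (default : stdSimplex ℝ (Fin 1)), ?_⟩
    unfold ptSimplex
    congr 1
    ext s
    rw [Subsingleton.elim s default]
    rfl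

lemma δ_mkSimplex (i : Fin 3) (x : C(stdSimplex ℝ (Fin 3), Y)) (γ : C(I, Y))
    (h : ∀ s, γ (stdSimplexHomeomorphUnitInterval s) = x (stdSimplex.map (Fin.succAbove i) s)) :
    (sing Y).δ i (mkSimplex x) = pathSimplex γ := by
  apply (TopCat.toSSetObjEquiv (TopCat.of Y) (.op ⦋1⦌)).injective
  ext s
  simp only [pathSimplex, mkSimplex, Equiv.apply_symm_apply, ContinuousMap.comp_apply]
  exact (h s).symm

lemma δ_zero_pathSimplex (γ : C(I, Y)) : (sing Y).δ 0 (pathSimplex γ) = ptSimplex (γ 1) := by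
  apply (TopCat.toSSetObjEquiv (TopCat.of Y) (.op ⦋0⦌)).injective
  ext s
  simp only [pathSimplex, ptSimplex, mkSimplex, Equiv.apply_symm_apply, ContinuousMap.const_apply]
  refine congrArg γ ?_
  ext
  change FunOnFinite.linearMap ℝ ℝ (Fin.succAbove (0 : Fin 2)) s 1 = 1
  rw [FunOnFinite.linearMap_apply_apply]
  simp [Finset.filter_true_of_mem]

lemma δ_one_pathSimplex (γ : C(I, Y)) : (sing Y).δ 1 (pathSimplex γ) = ptSimplex (γ 0) := by
  apply (TopCat.toSSetObjEquiv (TopCat.of Y) (.op ⦋0⦌)).injective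
  ext s
  simp only [pathSimplex, ptSimplex, mkSimplex, Equiv.apply_symm_apply, ContinuousMap.const_apply]
  refine congrArg γ ?_
  ext
  change FunOnFinite.linearMap ℝ ℝ (Fin.succAbove (1 : Fin 2)) s 1 = 0
  rw [FunOnFinite.linearMap_apply_apply]
  simp

/-- The class of a path in the one-chains modulo boundaries. -/
def pathClass (γ : C(I, Y)) : (chains Y).opcycles 1 :=
  ((sing Y).ιChainComplex (R := ModuleCat.of ℤ ℤ) (pathSimplex γ) ≫
    (chains Y).pOpcycles 1).hom (1 : ℤ)

/-- The class of a point in the zero-chains. -/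
def ptClass (y : Y) : (chains Y).X 0 :=
  ((sing Y).ιChainComplex (R := ModuleCat.of ℤ ℤ) (ptSimplex y)).hom (1 : ℤ)

/-- The class of a path is a cocycle with values in the one-chains modulo boundaries. -/
lemma pathClass_triangle (x : C(stdSimplex ℝ (Fin 3), Y)) (γ₀ γ₁ γ₂ : C(I, Y))
    (h0 : ∀ s, γ₀ (stdSimplexHomeomorphUnitInterval s) = x (stdSimplex.map (Fin.succAbove 0) s))
    (h1 : ∀ s, γ₁ (stdSimplexHomeomorphUnitInterval s) = x (stdSimplex.map (Fin.succAbove 1) s))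
    (h2 : ∀ s, γ₂ (stdSimplexHomeomorphUnitInterval s) = x (stdSimplex.map (Fin.succAbove 2) s)) :
    pathClass γ₁ = pathClass γ₂ + pathClass γ₀ := by
  -- The alternating sum of the three faces is the boundary of `x`, which dies in the chains modulo
  -- boundaries.
  have := (sing Y).ιChainComplex_d (R := ModuleCat.of ℤ ℤ) (mkSimplex x)
  have h := congrArg (fun f => (f ≫ (chains Y).pOpcycles 1).hom (1 : ℤ)) this
  simp only [Category.assoc, HomologicalComplex.d_pOpcycles, Limits.comp_zero] at h
  rw [Fin.sum_univ_three, δ_mkSimplex 0 x γ₀ h0, δ_mkSimplex 1 x γ₁ h1, δ_mkSimplex 2 x γ₂ h2] at h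
  simp only [Preadditive.add_comp] at h
  simp [pathClass] at h ⊢
  rw [← sub_eq_zero, ← neg_eq_zero]
  refine Eq.trans ?_ h.symm
  abel

lemma fromOpcycles_pathClass (γ : C(I, Y)) :
    ((chains Y).fromOpcycles 1 0).hom (pathClass γ) = ptClass (γ 1) - ptClass (γ 0) := by
  have := (sing Y).ιChainComplex_d (R := ModuleCat.of ℤ ℤ) (pathSimplex γ)
  have h := congrArg (fun f => f.hom (1 : ℤ)) this
  rw [Fin.sum_univ_two, δ_zero_pathSimplex, δ_one_pathSimplex] at h
  have h2 : ((chains Y).fromOpcycles 1 0).hom (pathClass γ) =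
      ((sing Y).ιChainComplex (R := ModuleCat.of ℤ ℤ) (pathSimplex γ) ≫
        (chains Y).d 1 0).hom (1 : ℤ) := by
    rw [← (chains Y).p_fromOpcycles 1 0]
    rfl
  rw [h2, h]
  simp [ptClass, sub_eq_add_neg]

lemma opcyclesMap_pathClass (f : C(Y, Z)) (γ : C(I, Y)) :
    (HomologicalComplex.opcyclesMap (chainsMap f) 1).hom (pathClass γ) =
      pathClass (f.comp γ) := by
  have h : (sing Y).ιChainComplex (R := ModuleCat.of ℤ ℤ) (pathSimplex γ) ≫
      (chains Y).pOpcycles 1 ≫ HomologicalComplex.opcyclesMap (chainsMap f) 1 =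
      (sing Z).ιChainComplex (R := ModuleCat.of ℤ ℤ) (pathSimplex (f.comp γ)) ≫
        (chains Z).pOpcycles 1 := by
    rw [HomologicalComplex.p_opcyclesMap, SSet.ι_chainComplexMap_f_assoc]
    rfl
  exact congrArg (fun f => f.hom (1 : ℤ)) h

/-- Paths are a basis of the one-chains, and the one-chains surject onto their quotient by
boundaries. -/
lemma opcycles_hom_ext {φ ψ : (chains Y).opcycles 1 →+ A}
    (h : ∀ γ : C(I, Y), φ (pathClass γ) = ψ (pathClass γ)) : φ = ψ := by
  let mk (χ : (chains Y).opcycles 1 →+ A) : (chains Y).opcycles 1 ⟶ ModuleCat.of ℤ A :=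
    ModuleCat.ofHom { χ with map_smul' := fun n x =>
      (congrArg χ (int_smul_eq_zsmul _ n x)).trans (map_zsmul χ n x) }
  have : mk φ = mk ψ := by
    rw [← cancel_epi ((chains Y).pOpcycles 1)]
    refine SSet.chainComplex_hom_ext fun x => ?_
    obtain ⟨γ, rfl⟩ := pathSimplex_surjective x
    ext
    exact h γ
  ext x
  exact congrArg (fun f => f.hom x) this

/-- The inclusion of a triangle in the plane as a map from the standard simplex to the square. -/
def simplexToSquare (i j : Fin 3) : C(stdSimplex ℝ (Fin 3), I × I) where
  toFun s := (⟨1 - s i, by simp, by simp⟩, ⟨s j, by simp, by simp⟩)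
  continuous_toFun := by
    have (k : Fin 3) : Continuous fun s : stdSimplex ℝ (Fin 3) => s k :=
      (continuous_apply k).comp continuous_subtype_val
    exact Continuous.prodMk ((continuous_const.sub (this i)).subtype_mk _) ((this j).subtype_mk _)

lemma stdSimplex_map_succAbove (i k : Fin 3) (s : stdSimplex ℝ (Fin 2)) :
    (stdSimplex.map (Fin.succAbove i) s) k = (if Fin.succAbove i 0 = k then s 0 else 0) +
      (if Fin.succAbove i 1 = k then s 1 else 0) := by
  refine (FunOnFinite.linearMap_apply_apply ..).trans ?_
  rw [Finset.sum_filter, Fin.sum_univ_two]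

/-- The diagonal cuts a square into two triangles: it is homologous to bottom followed by right and
also to left followed by top. For a constant path the constant triangle gives `c = c + c`. -/
lemma isCocycleOn_pathClass : IsCocycleOn (Set.univ : Set Y) (pathClass : C(I, Y) → _) where
  const x _ := by
    have := pathClass_triangle (.const _ x) (.const I x) (.const I x) (.const I x)
      (fun _ => rfl) (fun _ => rfl) (fun _ => rfl)
    simpa using this
  square H _ := by
    have e := stdSimplex_map_succAbove
    have e00 s := (e 0 0 s).trans (by rw [if_neg (by decide), if_neg (by decide), add_zero])
    have e02 s := (e 0 2 s).trans (by rw [if_neg (by decide), if_pos (by decide), zero_add])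
    have e10 s := (e 1 0 s).trans (by rw [if_pos (by decide), if_neg (by decide), add_zero])
    have e12 s := (e 1 2 s).trans (by rw [if_neg (by decide), if_pos (by decide), zero_add])
    have e20 s := (e 2 0 s).trans (by rw [if_pos (by decide), if_neg (by decide), add_zero])
    have e22 s := (e 2 2 s).trans (by rw [if_neg (by decide), if_neg (by decide), add_zero])
    have f (s : stdSimplex ℝ (Fin 2)) : s 1 = 1 - s 0 := by
      linarith [stdSimplex.add_eq_one s]
    have hs (s : stdSimplex ℝ (Fin 2)) :
      stdSimplexHomeomorphUnitInterval s = ⟨s 1, by simp, by simp⟩ := rfl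
    have h1 := pathClass_triangle (H.comp (simplexToSquare 0 2))
      (H.comp ⟨fun t => (1, t), by fun_prop⟩) (H.comp ⟨fun t => (t, t), by fun_prop⟩)
      (H.comp ⟨fun t => (t, 0), by fun_prop⟩) ?_ ?_ ?_
    · have h2 := pathClass_triangle (H.comp ((ContinuousMap.prodSwap).comp (simplexToSquare 0 2)))
        (H.comp ⟨fun t => (t, 1), by fun_prop⟩) (H.comp ⟨fun t => (t, t), by fun_prop⟩)
        (H.comp ⟨fun t => (0, t), by fun_prop⟩) ?_ ?_ ?_
      · rw [← h1, h2]
      all_goals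
        intro s
        refine congrArg H (Prod.ext (Subtype.ext ?_) (Subtype.ext ?_))
        all_goals simp only [simplexToSquare, ContinuousMap.comp_apply, ContinuousMap.coe_mk,
          ContinuousMap.prodSwap_apply, hs, e00, e02, e10, e12, e20, e22]
        all_goals simp [f]
    all_goals
      intro s
      refine congrArg H (Prod.ext (Subtype.ext ?_) (Subtype.ext ?_))
      all_goals simp only [simplexToSquare, ContinuousMap.coe_mk, hs, e00, e02, e10, e12, e20, e22]
      all_goals simp [f]

/-- The map from the square to the triangle that collapses the left side. -/
def squareToSimplex : C(I × I, stdSimplex ℝ (Fin 3)) where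
  toFun z := ⟨![1 - z.1, z.1 * (1 - z.2), z.1 * z.2], by
    constructor
    · intro i
      fin_cases i
      · exact sub_nonneg.2 z.1.2.2
      · exact mul_nonneg z.1.2.1 (sub_nonneg.2 z.2.2.2)
      · exact mul_nonneg z.1.2.1 z.2.2.1
    · simp [Fin.sum_univ_three]; ring⟩
  continuous_toFun := by
    refine Continuous.subtype_mk (continuous_pi fun i => ?_) _
    fin_cases i <;> simp <;> fun_prop

/-- A cocycle extends linearly to the one-chains modulo boundaries. -/
lemma exists_desc {c : C(I, Y) → A} (hc : IsCocycleOn Set.univ c) :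
    ∃ φ : (chains Y).opcycles 1 →+ A, ∀ γ, φ (pathClass γ) = c γ := by
  let lift (x : (sing Y) _⦋1⦌) : ModuleCat.of ℤ ℤ ⟶ ModuleCat.of ℤ A :=
    ModuleCat.ofHom (LinearMap.toSpanSingleton ℤ A (c (Function.surjInv pathSimplex_surjective x)))
  have inj : Function.Injective (pathSimplex : C(I, Y) → (sing Y) _⦋1⦌) := fun γ δ h => by
    have h' := (TopCat.toSSetObjEquiv (TopCat.of Y) (.op ⦋1⦌)).symm.injective h
    ext t
    have := DFunLike.congr_fun h' (stdSimplexHomeomorphUnitInterval.symm t)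
    simpa using this
  have hlift (γ : C(I, Y)) : lift (pathSimplex γ) =
      ModuleCat.ofHom (LinearMap.toSpanSingleton ℤ A (c γ)) := by
    simp only [lift]
    rw [inj (Function.surjInv_eq pathSimplex_surjective (pathSimplex γ))]
  let k : (chains Y).X 1 ⟶ ModuleCat.of ℤ A := Limits.Sigma.desc lift
  have hk (γ : C(I, Y)) : (sing Y).ιChainComplex (R := ModuleCat.of ℤ ℤ) (pathSimplex γ) ≫ k =
      ModuleCat.ofHom (LinearMap.toSpanSingleton ℤ A (c γ)) :=
    (Limits.Sigma.ι_desc lift (pathSimplex γ)).trans (hlift γ)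
  have hd : (chains Y).d 2 1 ≫ k = 0 := by
    refine SSet.chainComplex_hom_ext fun x => ?_
    obtain ⟨x, rfl⟩ := mkSimplex_surjective x
    rw [SSet.ιChainComplex_d_assoc, Fin.sum_univ_three]
    let D (i : Fin 3) : C(I, Y) :=
      ⟨fun t => x (stdSimplex.map (Fin.succAbove i) (stdSimplexHomeomorphUnitInterval.symm t)),
        x.continuous.comp ((stdSimplex.continuous_map _).comp (Homeomorph.continuous _))⟩
    have hD (i : Fin 3) : (sing Y).δ i (mkSimplex x) = pathSimplex (D i) :=
      δ_mkSimplex i x (D i) fun s => by simp [D]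
    rw [hD, hD, hD]
    -- The collapsed left side is a constant path and contributes nothing; the bottom, right and top
    -- sides are the faces 2, 0 and 1. The square relation is thus the triangle relation.
    have h := hc.square (x.comp squareToSimplex) fun _ => trivial
    have hq (z : I × I) (k : Fin 3) :
        squareToSimplex z k = ![1 - (z.1 : ℝ), z.1 * (1 - z.2), z.1 * z.2] k := rfl
    have r0 (t : I) : stdSimplexHomeomorphUnitInterval.symm t 0 = 1 - (t : ℝ) := rfl
    have r1 (t : I) : stdSimplexHomeomorphUnitInterval.symm t 1 = (t : ℝ) := rfl
    have h0 : (x.comp squareToSimplex).comp ⟨fun t => (1, t), by fun_prop⟩ = D 0 := by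
      ext t
      refine congrArg x (stdSimplex.ext (funext fun k => ?_))
      refine Eq.trans ?_ (stdSimplex_map_succAbove ..).symm
      rw [r0, r1]
      fin_cases k <;> simp [hq]
    have h1 : (x.comp squareToSimplex).comp ⟨fun t => (t, 1), by fun_prop⟩ = D 1 := by
      ext t
      refine congrArg x (stdSimplex.ext (funext fun k => ?_))
      refine Eq.trans ?_ (stdSimplex_map_succAbove ..).symm
      rw [r0, r1]
      fin_cases k <;> simp [hq, Fin.succAbove]
    have h2 : (x.comp squareToSimplex).comp ⟨fun t => (t, 0), by fun_prop⟩ = D 2 := by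
      ext t
      refine congrArg x (stdSimplex.ext (funext fun k => ?_))
      refine Eq.trans ?_ (stdSimplex_map_succAbove ..).symm
      rw [r0, r1]
      fin_cases k <;> simp [hq, Fin.succAbove]
    have h3 : (x.comp squareToSimplex).comp ⟨fun t => (0, t), by fun_prop⟩ =
        .const I (x (squareToSimplex (0, 0))) := by
      ext t
      refine congrArg x (stdSimplex.ext (funext fun k => ?_))
      fin_cases k <;> simp [hq]
    rw [h0, h1, h2, h3, hc.const _ trivial, zero_add] at h
    ext
    simp only [Preadditive.add_comp, Linear.smul_comp, hk]
    simp [← h]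
  refine ⟨((chains Y).descOpcycles k 2 (by simp) hd).hom.toAddMonoidHom, fun γ => ?_⟩
  have h2 := hk γ
  rw [← (chains Y).p_descOpcycles k 2 (by simp) hd, ← Category.assoc] at h2
  exact (congrArg (fun f => f.hom (1 : ℤ)) h2).trans (one_smul ℤ (c γ))

lemma exists_ptClass_lift (g : Y → A) :
    ∃ φ : (chains Y).X 0 →+ A, ∀ y, φ (ptClass y) = g y := by
  let lift (x : (sing Y) _⦋0⦌) : ModuleCat.of ℤ ℤ ⟶ ModuleCat.of ℤ A :=
    ModuleCat.ofHom (LinearMap.toSpanSingleton ℤ A (g (Function.surjInv ptSimplex_bijective.2 x)))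
  let k : (chains Y).X 0 ⟶ ModuleCat.of ℤ A := Limits.Sigma.desc lift
  have hk (y : Y) : (sing Y).ιChainComplex (R := ModuleCat.of ℤ ℤ) (ptSimplex y) ≫ k =
      ModuleCat.ofHom (LinearMap.toSpanSingleton ℤ A (g y)) := by
    refine (Limits.Sigma.ι_desc lift (ptSimplex y)).trans ?_
    simp only [lift]
    rw [ptSimplex_bijective.1 (Function.surjInv_eq ptSimplex_bijective.2 (ptSimplex y))]
  exact ⟨k.hom.toAddMonoidHom, fun y =>
    (congrArg (fun f => f.hom (1 : ℤ)) (hk y)).trans (one_smul ℤ (g y))⟩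

/-- The inclusion of the first homology in the one-chains modulo boundaries. -/
def H1.ι (Y : Type) [TopologicalSpace Y] : H1 Y →ₗ[ℤ] (chains Y).opcycles 1 :=
  ((chains Y).homologyι 1).hom

lemma H1.ι_injective : Function.Injective (H1.ι Y) :=
  (ModuleCat.mono_iff_injective ((chains Y).homologyι 1)).1 inferInstance

lemma H1.exists_ι_eq {v : (chains Y).opcycles 1} (hv : ((chains Y).fromOpcycles 1 0).hom v = 0) :
    ∃ x : H1 Y, H1.ι Y x = v := by
  -- The element `v` is encoded as a morphism from `ℤ`, so that the kernel property of homology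
  -- applies to it.
  let k : ModuleCat.of ℤ ℤ ⟶ (chains Y).opcycles 1 :=
    ModuleCat.ofHom (LinearMap.toSpanSingleton ℤ ((chains Y).opcycles 1) v)
  have hk1 : k.hom (1 : ℤ) = v := LinearMap.toSpanSingleton_apply_one ℤ _ v
  have hk : k ≫ (chains Y).fromOpcycles 1 0 = 0 := by
    ext
    exact (congrArg ((chains Y).fromOpcycles 1 0).hom hk1).trans hv
  obtain ⟨l, hl⟩ := Limits.KernelFork.IsLimit.lift'
    ((chains Y).homologyIsKernel 1 0 (by simp)) k hk
  refine ⟨l.hom (1 : ℤ), ?_⟩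
  exact (congrArg (fun f => f.hom (1 : ℤ)) hl).trans hk1

lemma H1.fromOpcycles_ι (x : H1 Y) : ((chains Y).fromOpcycles 1 0).hom (H1.ι Y x) = 0 :=
  congrArg (fun f => f.hom x) ((chains Y).homologyι_comp_fromOpcycles 1 0)

lemma H1.ι_map (f : C(Y, Z)) (x : H1 Y) : H1.ι Z (H1.map f x) =
    (HomologicalComplex.opcyclesMap (chainsMap f) 1).hom (H1.ι Y x) :=
  congrArg (fun f => f.hom x) (HomologicalComplex.homologyι_naturality (chainsMap f) 1)

/-- The homomorphism on first homology that a cocycle defines. -/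
def evalHom {c : C(I, Y) → A} (hc : IsCocycleOn Set.univ c) : H1 Y →+ A :=
  (exists_desc hc).choose.comp (H1.ι Y).toAddMonoidHom

/-- The extension of a cocycle is unique, so the choice in `evalHom` is harmless and any convenient
extension may be used. -/
lemma evalHom_eq {c : C(I, Y) → A} (hc : IsCocycleOn Set.univ c)
    (φ : (chains Y).opcycles 1 →+ A) (hφ : ∀ γ, φ (pathClass γ) = c γ) (x : H1 Y) :
    evalHom hc x = φ (H1.ι Y x) := by
  have : (exists_desc hc).choose = φ :=
    opcycles_hom_ext fun γ => ((exists_desc hc).choose_spec γ).trans (hφ γ).symm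
  exact DFunLike.congr_fun this (H1.ι Y x)

lemma evalHom_map {c : C(I, Z) → A} (hc : IsCocycleOn Set.univ c) (f : C(Y, Z)) (x : H1 Y) :
    evalHom hc (H1.map f x) =
      evalHom (hc.comp f (S := Set.univ) fun _ _ => trivial) x := by
  obtain ⟨φ, hφ⟩ := exists_desc hc
  rw [evalHom_eq hc φ hφ, evalHom_eq _ (φ.comp (HomologicalComplex.opcyclesMap (chainsMap f) 1).hom.toAddMonoidHom)
    fun γ => ?_, H1.ι_map]
  · rfl
  · rw [← hφ, ← opcyclesMap_pathClass]
    rfl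

lemma evalHom_add {c d : C(I, Y) → A} (hc : IsCocycleOn Set.univ c) (hd : IsCocycleOn Set.univ d)
    (x : H1 Y) : evalHom (hc.add hd) x = evalHom hc x + evalHom hd x := by
  obtain ⟨φ, hφ⟩ := exists_desc hc
  obtain ⟨ψ, hψ⟩ := exists_desc hd
  rw [evalHom_eq hc φ hφ, evalHom_eq hd ψ hψ, evalHom_eq _ (φ + ψ) fun γ => by simp [hφ, hψ]]
  rfl

lemma evalHom_hom {B : Type} [AddCommGroup B] {c : C(I, Y) → A} (hc : IsCocycleOn Set.univ c)
    (ψ : A →+ B) (x : H1 Y) : evalHom (hc.map ψ) x = ψ (evalHom hc x) := by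
  obtain ⟨φ, hφ⟩ := exists_desc hc
  rw [evalHom_eq hc φ hφ, evalHom_eq _ (ψ.comp φ) fun γ => by simp [hφ]]
  rfl

lemma evalHom_congr {c d : C(I, Y) → A} (hc : IsCocycleOn Set.univ c)
    (hd : IsCocycleOn Set.univ d) (h : c = d) (x : H1 Y) : evalHom hc x = evalHom hd x := by
  subst h
  rfl

/-- The extension of a coboundary factors through the boundary map to zero-chains, which kills
homology classes. -/
lemma evalHom_cobdry (g : Y → A) (x : H1 Y) :
    evalHom (isCocycleOn_cobdry g Set.univ) x = 0 := by
  obtain ⟨φ, hφ⟩ := exists_ptClass_lift g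
  rw [evalHom_eq _ (φ.comp ((chains Y).fromOpcycles 1 0).hom.toAddMonoidHom) fun γ => ?_]
  · simp [H1.fromOpcycles_ι]
  · simp [fromOpcycles_pathClass, hφ, cobdry]

lemma evalHom_eq_zero_of_isTrivialOn {c : C(I, Y) → A} (hc : IsCocycleOn Set.univ c)
    (h : IsTrivialOn Set.univ c) (x : H1 Y) : evalHom hc x = 0 := by
  obtain ⟨g, hg⟩ := h
  rw [evalHom_congr hc (isCocycleOn_cobdry g _) (funext fun γ => hg γ fun _ => trivial),
    evalHom_cobdry]

variable (Y) in
/-- The universal cocycle: every homomorphism from the first homology is given by a cocycle. -/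
lemma exists_universal_cocycle : ∃ (e : C(I, Y) → H1 Y) (he : IsCocycleOn Set.univ e),
    (∀ x, evalHom he x = x) ∧ ∃ p : Y → (chains Y).opcycles 1,
      ∀ γ, H1.ι Y (e γ) = pathClass γ + p (γ 0) - p (γ 1) := by
  -- Each path component receives a base point, and each point a path `p y` from it. Prefixing `p (γ
  -- 0)` and removing `p (γ 1)` closes every path up into a cycle.
  let base (y : Y) : Y := Quotient.out (Quotient.mk (pathSetoid Y) y)
  have hb (y : Y) : Joined (base y) y := Quotient.mk_out (s := pathSetoid Y) y
  have hbase (γ : C(I, Y)) : base (γ 0) = base (γ 1) := by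
    have : Joined (γ 0) (γ 1) := ⟨⟨γ, rfl, rfl⟩⟩
    exact congrArg Quotient.out (Quotient.sound (s := pathSetoid Y) this)
  let p (y : Y) : (chains Y).opcycles 1 := pathClass (hb y).somePath.toContinuousMap
  have hp (y : Y) : ((chains Y).fromOpcycles 1 0).hom (p y) = ptClass y - ptClass (base y) := by
    simp only [p, fromOpcycles_pathClass]
    simp
  have he (γ : C(I, Y)) : ∃ x : H1 Y, H1.ι Y x = pathClass γ + p (γ 0) - p (γ 1) := by
    apply H1.exists_ι_eq
    rw [map_sub, map_add, hp, hp, fromOpcycles_pathClass, hbase]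
    abel
  choose e he using he
  have hcoc : IsCocycleOn Set.univ e :=
    { const := fun x _ => H1.ι_injective (by
        rw [he, isCocycleOn_pathClass.const x trivial]; simp)
      square := fun H hH => H1.ι_injective (by
        have := isCocycleOn_pathClass.square H hH
        rw [map_add, map_add, he, he, he, he]
        simp only [ContinuousMap.comp_apply, ContinuousMap.coe_mk]
        rw [← sub_eq_zero] at this ⊢
        rw [← this]
        abel) }
  refine ⟨e, hcoc, fun x => ?_, p, he⟩
  apply H1.ι_injective
  obtain ⟨φ, hφ⟩ := exists_desc hcoc
  obtain ⟨P, hP⟩ := exists_ptClass_lift p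
  rw [evalHom_eq hcoc φ hφ]
  -- Closing up changes a chain only by a function of its boundary, so it is the identity on cycles.
  have key : (H1.ι Y).toAddMonoidHom.comp φ = AddMonoidHom.id _ -
      P.comp ((chains Y).fromOpcycles 1 0).hom.toAddMonoidHom := by
    refine opcycles_hom_ext fun γ => ?_
    simp only [AddMonoidHom.comp_apply, AddMonoidHom.sub_apply, AddMonoidHom.id_apply,
      LinearMap.toAddMonoidHom_coe, hφ, he, fromOpcycles_pathClass, map_sub, hP]
    abel
  have := DFunLike.congr_fun key (H1.ι Y x)
  simpa [H1.fromOpcycles_ι] using this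

/-- Every homomorphism from the first homology is given by a cocycle. -/
lemma exists_evalHom_eq (ψ : H1 Y →+ A) :
    ∃ (c : C(I, Y) → A) (hc : IsCocycleOn Set.univ c), ∀ x, evalHom hc x = ψ x := by
  obtain ⟨e, he, h, -⟩ := exists_universal_cocycle Y
  exact ⟨_, he.map ψ, fun x => by rw [evalHom_hom he, h]⟩

end Bridge
end KleinGluing
end
end

section
open unitInterval
noncomputable section
namespace KleinGluing

/-! ### Subdivision -/

section Subdivision

variable {X Y : Type} [TopologicalSpace X] [TopologicalSpace Y]
variable {A : Type} [AddCommGroup A]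

/-- The two halves of the unit interval. -/
def half (b : Bool) : C(I, I) where
  toFun t := ⟨((if b then 1 else 0) + t) / 2, by
    have := t.2.1; split_ifs <;> positivity, by
    have := t.2.2; split_ifs <;> linarith⟩
  continuous_toFun := by fun_prop

lemma half_coe (b : Bool) (t : I) : (half b t : ℝ) = ((if b then 1 else 0) + t) / 2 := rfl

@[simp] lemma half_false_zero : half false 0 = 0 := by ext; simp [half_coe]
@[simp] lemma half_true_one : half true 1 = 1 := by ext; simp [half_coe]
lemma half_false_one : half false 1 = half true 0 := by ext; simp [half_coe]

lemma dist_half (b : Bool) (s t : I) : dist (half b s) (half b t) = dist s t / 2 := by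
  simp only [Subtype.dist_eq, half_coe, Real.dist_eq]
  rw [← abs_of_pos (two_pos : (0 : ℝ) < 2), ← abs_div, abs_of_pos (two_pos : (0 : ℝ) < 2)]
  congr 1
  ring

/-- The square `(s, t) ↦ γ (s (1 + t) / 2)` has the first half of `γ` at the bottom, the second half
on the right, a constant path on the left and `γ` on top. -/
lemma IsCocycleOn.half {S : Set X} {c : C(I, X) → A} (hc : IsCocycleOn S c) {γ : C(I, X)}
    (hγ : ∀ t, γ t ∈ S) : c γ = c (γ.comp (half false)) + c (γ.comp (half true)) := by
  let H : C(I × I, X) := γ.comp ⟨fun z => ⟨z.1 * (1 + z.2) / 2, by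
    have := z.1.2.1; have := z.2.2.1; positivity, by
    have := z.1.2.2; have := z.2.2.2; have := z.1.2.1; have := z.2.2.1; nlinarith⟩, by fun_prop⟩
  have h := hc.square H fun _ => hγ _
  have h1 : H.comp ⟨fun s => (s, 0), by fun_prop⟩ = γ.comp (KleinGluing.half false) := by
    ext t; exact congrArg γ (Subtype.ext (by simp [half_coe]))
  have h2 : H.comp ⟨fun s => (1, s), by fun_prop⟩ = γ.comp (KleinGluing.half true) := by
    ext t; exact congrArg γ (Subtype.ext (by simp [half_coe]))
  have h3 : H.comp ⟨fun s => (0, s), by fun_prop⟩ = .const I (γ 0) := by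
    ext t; exact congrArg γ (Subtype.ext (by simp))
  have h4 : H.comp ⟨fun s => (s, 1), by fun_prop⟩ = γ := by
    ext t; exact congrArg γ (Subtype.ext (by simp; ring))
  rw [h1, h2, h3, h4, hc.const _ (hγ 0), zero_add] at h
  exact h.symm

/-- The quarters of the unit square. -/
def quarter (a b : Bool) : C(I × I, I × I) := (half a).prodMap (half b)

/-- The subdivided sum of a function on paths. -/
def subdiv (c : C(I, X) → A) : ℕ → C(I, X) → A
  | 0 => c
  | n + 1 => fun γ => subdiv c n (γ.comp (half false)) + subdiv c n (γ.comp (half true))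

/-- All pieces of the `n`-th dyadic subdivision of the path lie in one of the two sets. -/
def FinePath (U V : Set X) : ℕ → C(I, X) → Prop
  | 0 => fun γ => (∀ t, γ t ∈ U) ∨ (∀ t, γ t ∈ V)
  | n + 1 => fun γ => ∀ b, FinePath U V n (γ.comp (half b))

/-- All pieces of the `n`-th dyadic subdivision of the square lie in one of the two sets. -/
def FineSquare (U V : Set X) : ℕ → C(I × I, X) → Prop
  | 0 => fun H => (∀ z, H z ∈ U) ∨ (∀ z, H z ∈ V)
  | n + 1 => fun H => ∀ a b, FineSquare U V n (H.comp (quarter a b))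

/-- A Lebesgue number for the pulled-back cover bounds the size of the pieces needed, and each
subdivision halves their size. -/
lemma exists_fineSquare {U V : Set X} (hU : IsOpen U) (hV : IsOpen V) (H : C(I × I, X))
    (hH : ∀ z, H z ∈ U ∪ V) : ∃ n, FineSquare U V n H := by
  obtain ⟨δ, hδ, hball⟩ := lebesgue_number_lemma_of_metric (s := (Set.univ : Set (I × I)))
    (c := fun b : Bool => H ⁻¹' (if b then U else V)) isCompact_univ
    (fun b => by cases b <;> simp [hU.preimage H.continuous, hV.preimage H.continuous])
    (fun z _ => by
      rcases hH z with h | h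
      · exact Set.mem_iUnion.2 ⟨true, by simpa using h⟩
      · exact Set.mem_iUnion.2 ⟨false, by simpa using h⟩)
  have h1 (s t : I) : dist s t ≤ 1 := by
    rw [Subtype.dist_eq, Real.dist_eq, abs_le]
    constructor <;> linarith [s.2.1, s.2.2, t.2.1, t.2.2]
  have h2 (z w : I × I) : dist z w ≤ 1 := max_le (h1 _ _) (h1 _ _)
  -- The induction runs over all `L`-Lipschitz reparametrizations of the square, since passing to a
  -- quarter composes `φ` with a map that halves distances.
  have key (n : ℕ) : ∀ L : ℝ, 0 ≤ L → L < δ * 2 ^ n → ∀ φ : C(I × I, I × I),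
      (∀ z w, dist (φ z) (φ w) ≤ L * dist z w) → FineSquare U V n (H.comp φ) := by
    induction n with
    | zero =>
      intro L hL0 hL φ hφ
      obtain ⟨b, hb⟩ := hball (φ 0) trivial
      have (z : I × I) : φ z ∈ H ⁻¹' (if b then U else V) := hb (by
        rw [Metric.mem_ball]
        calc _ ≤ _ := hφ z 0
          _ ≤ L * 1 := by gcongr; exact h2 _ _
          _ < δ := by simpa using hL)
      cases b
      · exact Or.inr (by simpa using this)
      · exact Or.inl (by simpa using this)
    | succ n ih =>
      intro L hL0 hL φ hφ a b
      refine ih (L / 2) (by positivity) (by rw [pow_succ] at hL; linarith)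
        (φ.comp (quarter a b)) fun z w => (hφ _ _).trans_eq ?_
      have : dist (quarter a b z) (quarter a b w) = dist z w / 2 := by
        simp only [quarter, ContinuousMap.prodMap_apply, Prod.dist_eq, Prod.map_fst, Prod.map_snd,
          dist_half]
        exact max_div_div_right (by norm_num) _ _
      rw [this]
      ring
  obtain ⟨n, hn⟩ := pow_unbounded_of_one_lt (1 / δ) (one_lt_two : (1 : ℝ) < 2)
  refine ⟨n, key n 1 zero_le_one ?_ (.id _) fun z w => by simp⟩
  rwa [div_lt_iff₀' hδ] at hn

/-- The bottom side of a square. -/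
def bottom (H : C(I × I, X)) : C(I, X) := H.comp ⟨fun s => (s, 0), by fun_prop⟩
/-- The top side of a square. -/
def top (H : C(I × I, X)) : C(I, X) := H.comp ⟨fun s => (s, 1), by fun_prop⟩
/-- The left side of a square. -/
def left (H : C(I × I, X)) : C(I, X) := H.comp ⟨fun t => (0, t), by fun_prop⟩
/-- The right side of a square. -/
def right (H : C(I × I, X)) : C(I, X) := H.comp ⟨fun t => (1, t), by fun_prop⟩

lemma bottom_quarter (H : C(I × I, X)) (a : Bool) :
    bottom (H.comp (quarter a false)) = (bottom H).comp (half a) := by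
  ext t; simp [bottom, quarter]
lemma top_quarter (H : C(I × I, X)) (a : Bool) :
    top (H.comp (quarter a true)) = (top H).comp (half a) := by
  ext t; simp [top, quarter]
lemma left_quarter (H : C(I × I, X)) (b : Bool) :
    left (H.comp (quarter false b)) = (left H).comp (half b) := by
  ext t; simp [left, quarter]
lemma right_quarter (H : C(I × I, X)) (b : Bool) :
    right (H.comp (quarter true b)) = (right H).comp (half b) := by
  ext t; simp [right, quarter]
lemma top_quarter_false (H : C(I × I, X)) (a : Bool) :
    top (H.comp (quarter a false)) = bottom (H.comp (quarter a true)) := by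
  ext t; simp [top, bottom, quarter, half_false_one]
lemma right_quarter_false (H : C(I × I, X)) (b : Bool) :
    right (H.comp (quarter false b)) = left (H.comp (quarter true b)) := by
  ext t; simp [right, left, quarter, half_false_one]

lemma FineSquare.sides {U V : Set X} {n : ℕ} {H : C(I × I, X)} (h : FineSquare U V n H) :
    FinePath U V n (bottom H) ∧ FinePath U V n (top H) ∧ FinePath U V n (left H) ∧
      FinePath U V n (right H) := by
  induction n generalizing H with
  | zero =>
    exact ⟨h.imp (fun h _ => h _) fun h _ => h _, h.imp (fun h _ => h _) fun h _ => h _,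
      h.imp (fun h _ => h _) fun h _ => h _, h.imp (fun h _ => h _) fun h _ => h _⟩
  | succ n ih =>
    exact ⟨fun b => bottom_quarter H b ▸ (ih (h b false)).1,
      fun b => top_quarter H b ▸ (ih (h b true)).2.1,
      fun b => left_quarter H b ▸ (ih (h false b)).2.2.1,
      fun b => right_quarter H b ▸ (ih (h true b)).2.2.2⟩

/-- The function on paths agrees with a cocycle on either of the sets. -/
structure IsLocalCocycle (U V : Set X) (c : C(I, X) → A) : Prop where
  fst : IsCocycleOn U c
  snd : IsCocycleOn V c

/-- On a piece inside one of the sets the cocycle is additive under halving, so refining a fine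
subdivision does not change the sum. -/
lemma IsLocalCocycle.subdiv_succ {U V : Set X} {c : C(I, X) → A} (hc : IsLocalCocycle U V c)
    {n : ℕ} {γ : C(I, X)} (h : FinePath U V n γ) : subdiv c (n + 1) γ = subdiv c n γ := by
  induction n generalizing γ with
  | zero => exact (h.elim (fun h => hc.fst.half h) fun h => hc.snd.half h).symm
  | succ n ih =>
    change subdiv c (n + 1) _ + subdiv c (n + 1) _ = _
    rw [ih (h _), ih (h _)]
    rfl

lemma FinePath.succ {U V : Set X} {n : ℕ} {γ : C(I, X)} (h : FinePath U V n γ) :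
    FinePath U V (n + 1) γ := by
  induction n generalizing γ with
  | zero => exact fun b => h.imp (fun h _ => h _) fun h _ => h _
  | succ n ih => exact fun b => ih (h b)

lemma IsLocalCocycle.subdiv_add {U V : Set X} {c : C(I, X) → A} (hc : IsLocalCocycle U V c)
    {n : ℕ} {γ : C(I, X)} (h : FinePath U V n γ) (k : ℕ) :
    FinePath U V (n + k) γ ∧ subdiv c (n + k) γ = subdiv c n γ := by
  induction k with
  | zero => exact ⟨h, rfl⟩
  | succ k ih => exact ⟨ih.1.succ, (hc.subdiv_succ ih.1).trans ih.2⟩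

/-- The relations of the four quarters are added; the edges in the interior of the square cancel in
pairs. -/
lemma IsLocalCocycle.subdiv_square {U V : Set X} {c : C(I, X) → A} (hc : IsLocalCocycle U V c)
    {n : ℕ} {H : C(I × I, X)} (h : FineSquare U V n H) :
    subdiv c n (bottom H) + subdiv c n (right H) = subdiv c n (left H) + subdiv c n (top H) := by
  induction n generalizing H with
  | zero => exact h.elim (hc.fst.square H) (hc.snd.square H)
  | succ n ih =>
    have h00 := ih (h false false)
    have h01 := ih (h false true)
    have h10 := ih (h true false)
    have h11 := ih (h true true)
    rw [bottom_quarter, right_quarter_false, left_quarter, top_quarter_false] at h00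
    rw [right_quarter_false, left_quarter, top_quarter] at h01
    rw [bottom_quarter, right_quarter, top_quarter_false] at h10
    rw [right_quarter, top_quarter] at h11
    simp only [subdiv]
    rw [← sub_eq_zero] at h00 h01 h10 h11 ⊢
    have := congrArg₂ (· + ·) (congrArg₂ (· + ·) h00 h01) (congrArg₂ (· + ·) h10 h11)
    simp only [add_zero] at this
    rw [← this]
    abel

lemma exists_finePath {U V : Set X} (hU : IsOpen U) (hV : IsOpen V) (γ : C(I, X))
    (hγ : ∀ t, γ t ∈ U ∪ V) : ∃ n, FinePath U V n γ := by
  obtain ⟨n, hn⟩ := exists_fineSquare hU hV (γ.comp ⟨Prod.fst, by fun_prop⟩) fun z => hγ _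
  exact ⟨n, hn.sides.1⟩

/-- A local cocycle agrees with a cocycle on the paths in either of the open sets. -/
lemma IsLocalCocycle.exists_cocycle {U V : Set X} (hU : IsOpen U) (hV : IsOpen V)
    {c : C(I, X) → A} (hc : IsLocalCocycle U V c) :
    ∃ d : C(I, X) → A, IsCocycleOn (U ∪ V) d ∧ (∀ γ, (∀ t, γ t ∈ U) → d γ = c γ) ∧
      ∀ γ, (∀ t, γ t ∈ V) → d γ = c γ := by
  classical
  -- The default value is taken only by paths that leave `U ∪ V`, about which nothing is claimed.
  let d (γ : C(I, X)) : A := if h : ∃ n, FinePath U V n γ then subdiv c h.choose γ else 0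
  have hd {γ : C(I, X)} {n : ℕ} (h : FinePath U V n γ) : d γ = subdiv c n γ := by
    have h' : ∃ n, FinePath U V n γ := ⟨n, h⟩
    simp only [d, dif_pos h']
    -- Two fine levels are compared at their sum, which refines both.
    rw [← (hc.subdiv_add h'.choose_spec n).2, ← (hc.subdiv_add h h'.choose).2, add_comm]
  refine ⟨d, ⟨fun x hx => ?_, fun H hH => ?_⟩, fun γ h => hd (n := 0) (.inl h),
    fun γ h => hd (n := 0) (.inr h)⟩
  · rcases hx with hx | hx
    · exact (hd (n := 0) (.inl fun _ => hx)).trans (hc.fst.const x hx)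
    · exact (hd (n := 0) (.inr fun _ => hx)).trans (hc.snd.const x hx)
  · obtain ⟨n, hn⟩ := exists_fineSquare hU hV H hH
    have hs := hn.sides
    change d (bottom H) + d (right H) = d (left H) + d (top H)
    rw [hd hs.1, hd hs.2.1, hd hs.2.2.1, hd hs.2.2.2, hc.subdiv_square hn]

/-- Cocycles on two open sets that agree on the intersection are restrictions of a cocycle. -/
lemma exists_glue {U V : Set X} (hU : IsOpen U) (hV : IsOpen V) {c d : C(I, X) → A}
    (hc : IsCocycleOn U c) (hd : IsCocycleOn V d)
    (h : ∀ γ : C(I, X), (∀ t, γ t ∈ U ∩ V) → c γ = d γ) :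
    ∃ e : C(I, X) → A, IsCocycleOn (U ∪ V) e ∧ (∀ γ, (∀ t, γ t ∈ U) → e γ = c γ) ∧
      ∀ γ, (∀ t, γ t ∈ V) → e γ = d γ := by
  classical
  let f (γ : C(I, X)) : A := if ∀ t, γ t ∈ U then c γ else d γ
  have hfU (γ : C(I, X)) (hγ : ∀ t, γ t ∈ U) : f γ = c γ := if_pos hγ
  have hfV (γ : C(I, X)) (hγ : ∀ t, γ t ∈ V) : f γ = d γ := by
    simp only [f]
    split_ifs with hU
    · exact h γ fun t => ⟨hU t, hγ t⟩
    · rfl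
  obtain ⟨e, he, heU, heV⟩ := IsLocalCocycle.exists_cocycle hU hV ⟨hc.congr hfU, hd.congr hfV⟩
  exact ⟨e, he, fun γ hγ => (heU γ hγ).trans (hfU γ hγ), fun γ hγ => (heV γ hγ).trans (hfV γ hγ)⟩

/-- A cocycle that vanishes on the paths in two open sets vanishes on their union. -/
lemma IsCocycleOn.eq_zero {U V : Set X} (hU : IsOpen U) (hV : IsOpen V) {c : C(I, X) → A}
    (hc : IsCocycleOn (U ∪ V) c) (hcU : ∀ γ, (∀ t, γ t ∈ U) → c γ = 0)
    (hcV : ∀ γ, (∀ t, γ t ∈ V) → c γ = 0) (γ : C(I, X)) (hγ : ∀ t, γ t ∈ U ∪ V) : c γ = 0 := by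
  obtain ⟨n, hn⟩ := exists_finePath hU hV γ hγ
  induction n generalizing γ with
  | zero => exact hn.elim (hcU γ) (hcV γ)
  | succ n ih =>
    rw [hc.half hγ, ih (γ.comp (KleinGluing.half false)) (fun _ => hγ _) (hn _),
      ih (γ.comp (KleinGluing.half true)) (fun _ => hγ _) (hn _), add_zero]

/-- A cocycle is a coboundary if it is one on two open sets with path-connected intersection. -/
lemma IsCocycleOn.isTrivialOn_union {U V : Set X} (hU : IsOpen U) (hV : IsOpen V)
    (hUV : ∀ x ∈ U ∩ V, ∀ y ∈ U ∩ V, JoinedIn (U ∩ V) x y) {c : C(I, X) → A}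
    (hc : IsCocycleOn (U ∪ V) c) (hcU : IsTrivialOn U c) (hcV : IsTrivialOn V c) :
    IsTrivialOn (U ∪ V) c := by
  classical
  obtain ⟨f, hf⟩ := hcU
  obtain ⟨g, hg⟩ := hcV
  -- Two primitives of the same cocycle differ by a constant on the path-connected overlap; shifting
  -- one of them makes them agree there.
  obtain ⟨a, ha⟩ : ∃ a : A, ∀ x ∈ U ∩ V, f x = g x + a := by
    by_cases hne : (U ∩ V).Nonempty
    · obtain ⟨x₀, hx₀⟩ := hne
      refine ⟨f x₀ - g x₀, fun x hx => ?_⟩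
      have hj := hUV x₀ hx₀ x hx
      have h1 := hf hj.somePath.toContinuousMap fun t => (hj.somePath_mem t).1
      have h2 := hg hj.somePath.toContinuousMap fun t => (hj.somePath_mem t).2
      have h3 := h1.symm.trans h2
      simp only [Path.coe_toContinuousMap, Path.source, Path.target] at h3
      rw [← sub_eq_zero] at h3 ⊢
      rw [← h3]
      abel
    · exact ⟨0, fun x hx => (hne ⟨x, hx⟩).elim⟩
  let k (x : X) : A := if x ∈ U then f x else g x + a
  have hkU (x : X) (hx : x ∈ U) : k x = f x := if_pos hx
  have hkV (x : X) (hx : x ∈ V) : k x = g x + a := by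
    simp only [k]
    split_ifs with h
    · exact ha x ⟨h, hx⟩
    · rfl
  have h0 := (hc.sub (isCocycleOn_cobdry k (U ∪ V))).eq_zero hU hV (fun γ hγ => by
      simp [cobdry, hf γ hγ, hkU _ (hγ _)]) (fun γ hγ => by
      simp [cobdry, hg γ hγ, hkV _ (hγ _)])
  exact ⟨k, fun γ hγ => sub_eq_zero.1 (h0 γ hγ)⟩

/-! ### Vanishing -/

/-- The value on the segment from the centre is a primitive: contracting a path radially sweeps out
a square whose bottom is constant and whose vertical sides are such segments. -/
lemma IsCocycleOn.isTrivialOn_starConvex {E : Type} [AddCommGroup E] [Module ℝ E]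
    [TopologicalSpace E] [ContinuousAdd E] [ContinuousSMul ℝ E] [ContinuousNeg E]
    {S : Set E} {x₀ : E} (hS : StarConvex ℝ x₀ S) {c : C(I, E) → A} (hc : IsCocycleOn S c) :
    IsTrivialOn S c := by
  by_cases hne : S.Nonempty
  · let seg (x : E) : C(I, E) := ⟨fun t => (1 - (t : ℝ)) • x₀ + (t : ℝ) • x, by fun_prop⟩
    refine ⟨fun x => c (seg x), fun γ hγ => ?_⟩
    let H : C(I × I, E) := ⟨fun z => (1 - (z.2 : ℝ)) • x₀ + (z.2 : ℝ) • γ z.1, by fun_prop⟩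
    have h := hc.square H fun z => hS (hγ _) (sub_nonneg.2 z.2.2.2) z.2.2.1 (by ring)
    have h1 : H.comp ⟨fun s => (s, 0), by fun_prop⟩ = .const I x₀ := by
      ext t; simp [H]
    have h2 : H.comp ⟨fun s => (1, s), by fun_prop⟩ = seg (γ 1) := by
      ext t; simp [H, seg]
    have h3 : H.comp ⟨fun s => (0, s), by fun_prop⟩ = seg (γ 0) := by
      ext t; simp [H, seg]
    have h4 : H.comp ⟨fun s => (s, 1), by fun_prop⟩ = γ := by
      ext t; simp [H]
    have hx₀ : x₀ ∈ S := by simpa using hS (hγ 0) zero_le_one le_rfl (by ring)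
    rw [h1, h2, h3, h4, hc.const _ hx₀, zero_add] at h
    exact eq_sub_of_add_eq' h.symm
  · exact ⟨0, fun γ hγ => (hne ⟨_, hγ 0⟩).elim⟩

lemma IsCocycleOn.isTrivialOn_convex {E : Type} [AddCommGroup E] [Module ℝ E]
    [TopologicalSpace E] [ContinuousAdd E] [ContinuousSMul ℝ E] [ContinuousNeg E]
    {S : Set E} (hS : Convex ℝ S) {c : C(I, E) → A} (hc : IsCocycleOn S c) :
    IsTrivialOn S c := by
  by_cases hne : S.Nonempty
  · exact hc.isTrivialOn_starConvex (hS hne.some_mem)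
  · exact ⟨0, fun γ hγ => (hne ⟨_, hγ 0⟩).elim⟩

/-- Triviality descends along a map with a section. -/
lemma IsTrivialOn.of_section {S : Set X} {T : Set Y} {c : C(I, X) → A} (ψ : C(Y, X)) (φ : X → Y)
    (hφ : ContinuousOn φ S) (hST : Set.MapsTo φ S T) (h : ∀ x ∈ S, ψ (φ x) = x)
    (hc : IsTrivialOn T fun γ => c (ψ.comp γ)) : IsTrivialOn S c := by
  obtain ⟨g, hg⟩ := hc
  refine ⟨g ∘ φ, fun γ hγ => ?_⟩
  let γ' : C(I, Y) := ⟨fun t => φ (γ t), hφ.comp_continuous γ.continuous hγ⟩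
  have h1 : ψ.comp γ' = γ := ContinuousMap.ext fun t => h _ (hγ t)
  have h2 := hg γ' fun t => hST (hγ t)
  change c (ψ.comp γ') = _ at h2
  rw [h1] at h2
  exact h2

/-- The primitive at a point is found by going along the slice at height `y₀` and then up the fibre.
The primitives on the fibres are chosen independently, with no compatibility between them. -/
lemma IsCocycleOn.isTrivialOn_prod {S : Set X} {T : Set Y} {c : C(I, X × Y) → A}
    (hc : IsCocycleOn (S ×ˢ T) c) {y₀ : Y} (hT : ∀ y ∈ T, JoinedIn T y₀ y)
    (h1 : IsTrivialOn S fun γ => c ⟨fun t => (γ t, y₀), by fun_prop⟩)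
    (h2 : ∀ x ∈ S, IsTrivialOn T fun γ => c ⟨fun t => (x, γ t), by fun_prop⟩) :
    IsTrivialOn (S ×ˢ T) c := by
  classical
  obtain ⟨g, hg⟩ := h1
  have h2' : ∀ x : X, ∃ f : Y → A, x ∈ S → ∀ γ : C(I, Y), (∀ t, γ t ∈ T) →
      c ⟨fun t => (x, γ t), by fun_prop⟩ = f (γ 1) - f (γ 0) := fun x => by
    by_cases hx : x ∈ S
    · obtain ⟨f, hf⟩ := h2 x hx
      exact ⟨f, fun _ => hf⟩
    · exact ⟨0, fun h => (hx h).elim⟩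
  choose f hf using h2'
  refine ⟨fun z => g z.1 + (f z.1 z.2 - f z.1 y₀), fun γ hγ => ?_⟩
  let α : C(I, X) := ⟨fun t => (γ t).1, by fun_prop⟩
  let δ : C(I, Y) := ⟨fun t => (γ t).2, by fun_prop⟩
  have hα (t : I) : α t ∈ S := (hγ t).1
  have hδ (t : I) : δ t ∈ T := (hγ t).2
  let η := (hT (δ 0) (hδ 0)).somePath.toContinuousMap
  have hη := (hT (δ 0) (hδ 0)).somePath_mem
  -- The first square replaces `γ` by a horizontal path at the starting height followed by a
  -- vertical one; the second moves the horizontal path to height `y₀`.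
  have s1 := hc.square ⟨fun z => (α z.1, δ (z.1 * z.2)), by fun_prop⟩ fun z => ⟨hα _, hδ _⟩
  have s2 := hc.square ⟨fun z => (α z.1, η z.2), by fun_prop⟩ fun z => ⟨hα _, hη _⟩
  have f1 := hf (α 1) (hα 1) δ hδ
  have f2 := hf (α 1) (hα 1) η hη
  have f3 := hf (α 0) (hα 0) η hη
  have f4 : c ⟨fun t => (α t, y₀), by fun_prop⟩ = _ := hg α hα
  have f5 := hc.const (α 0, δ 0) ⟨hα 0, hδ 0⟩
  have e0 : η 0 = y₀ := Path.source _
  have e1 : η 1 = δ 0 := Path.target _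
  rw [e0, e1] at f2 f3
  have e2 : c ⟨fun t => (α t, y₀), by fun_prop⟩ + (f (α 1) (δ 0) - f (α 1) y₀) =
      (f (α 0) (δ 0) - f (α 0) y₀) + c ⟨fun t => (α t, δ 0), by fun_prop⟩ := by
    rw [← f2, ← f3]
    convert s2 using 3 <;> ext t <;> simp [e0, e1]
  have e3 : c ⟨fun t => (α t, δ 0), by fun_prop⟩ + (f (α 1) (δ 1) - f (α 1) (δ 0)) = c γ := by
    rw [← f1, ← zero_add (c γ), ← f5]
    convert s1 using 3 <;> ext t <;> simp [α, δ]
  rw [f4] at e2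
  rw [← e3]
  change _ = g (α 1) + (f (α 1) (δ 1) - f (α 1) y₀) - (g (α 0) + (f (α 0) (δ 0) - f (α 0) y₀))
  rw [← sub_eq_zero] at e2 ⊢
  rw [← neg_eq_zero, ← e2]
  abel

end Subdivision
end KleinGluing
end
end

/-! ### Vanishing of the cohomology of spheres in degrees one and two -/

section
open unitInterval
noncomputable section
namespace KleinGluing

section Spheres

variable {X Y : Type} [TopologicalSpace X] [TopologicalSpace Y]
variable {A : Type} [AddCommGroup A]

/-- Pulling back a cocycle along a map that is continuous on a subset. -/
lemma IsCocycleOn.exists_pullback {S : Set X} {T : Set Y} {c : C(I, Y) → A}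
    (hc : IsCocycleOn T c) {φ : X → Y} (hφ : ContinuousOn φ S) (hST : Set.MapsTo φ S T) :
    ∃ d : C(I, X) → A, IsCocycleOn S d ∧
      ∀ (γ : C(I, X)) (δ : C(I, Y)), (∀ t, γ t ∈ S) → (∀ t, δ t = φ (γ t)) → d γ = c δ := by
  classical
  let d (γ : C(I, X)) : A := if h : ∀ t, γ t ∈ S then
    c ⟨fun t => φ (γ t), hφ.comp_continuous γ.continuous h⟩ else 0
  have hd (γ : C(I, X)) (δ : C(I, Y)) (h : ∀ t, γ t ∈ S) (h' : ∀ t, δ t = φ (γ t)) :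
      d γ = c δ := by
    simp only [d, dif_pos h]
    exact congrArg c (ContinuousMap.ext fun t => (h' t).symm)
  refine ⟨d, ⟨fun x hx => ?_, fun H hH => ?_⟩, hd⟩
  · rw [hd _ (.const I (φ x)) (fun _ => hx) fun _ => rfl, hc.const _ (hST hx)]
  · let K : C(I × I, Y) := ⟨fun z => φ (H z), hφ.comp_continuous H.continuous hH⟩
    have := hc.square K fun z => hST (hH z)
    rw [hd _ (K.comp _) (fun _ => hH _) fun _ => rfl, hd _ (K.comp _) (fun _ => hH _) fun _ => rfl,
      hd _ (K.comp _) (fun _ => hH _) fun _ => rfl, hd _ (K.comp _) (fun _ => hH _) fun _ => rfl]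
    exact this

/-- Every cocycle on a sphere of dimension at least two is a coboundary. -/
lemma IsCocycleOn.isTrivialOn_sphere {E : Type} [NormedAddCommGroup E] [InnerProductSpace ℝ E]
    [FiniteDimensional ℝ E] (hE : 2 < Module.finrank ℝ E)
    {c : C(I, Metric.sphere (0 : E) 1) → A} (hc : IsCocycleOn Set.univ c) :
    IsTrivialOn Set.univ c := by
  have : Nontrivial E := Module.nontrivial_of_finrank_pos (R := ℝ) (by omega)
  obtain ⟨v, hv⟩ := exists_norm_eq E zero_le_one
  have hnv : ‖-v‖ = 1 := by rwa [norm_neg]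
  let p : Metric.sphere (0 : E) 1 := ⟨v, by simpa using hv⟩
  -- Stereographic projection identifies the complement of a point with a vector space. Two
  -- antipodal complements then cover the sphere.
  have chart (w : E) (hw : ‖w‖ = 1) : IsTrivialOn {(⟨w, by simpa using hw⟩ : Metric.sphere (0 : E) 1)}ᶜ c := by
    have hcont : Continuous (stereographic hw).symm := by
      rw [← continuousOn_univ, ← stereographic_target hw]
      exact (stereographic hw).continuousOn_symm
    refine .of_section (T := Set.univ) ⟨_, hcont⟩ (stereographic hw) ?_ (Set.mapsTo_univ _ _) ?_ ?_
    · exact (stereographic_source hw) ▸ (stereographic hw).continuousOn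
    · intro x hx
      exact (stereographic hw).left_inv (by rwa [stereographic_source])
    · exact (hc.comp (S := Set.univ) _ fun _ _ => trivial).isTrivialOn_convex convex_univ
  have hp : p ≠ -p := by
    intro h
    have h2 : v = -v := congrArg Subtype.val h
    have h3 : v = 0 := by
      have : (2 : ℝ) • v = 0 := by rw [two_smul]; nth_rw 2 [h2]; exact add_neg_cancel v
      simpa using this
    simp [h3] at hv
  have hu : ({p}ᶜ ∪ {-p}ᶜ : Set (Metric.sphere (0 : E) 1)) = Set.univ := by
    ext x
    simp only [Set.mem_union, Set.mem_compl_iff, Set.mem_singleton_iff, Set.mem_univ, iff_true]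
    by_contra! h
    exact hp (h.1.symm.trans h.2)
  rw [← hu]
  refine (hc.mono (Set.subset_univ _)).isTrivialOn_union isOpen_compl_singleton
    isOpen_compl_singleton ?_ (chart v hv) (chart (-v) hnv)
  have hsym : Continuous (stereographic hv).symm := by
    rw [← continuousOn_univ, ← stereographic_target hv]
    exact (stereographic hv).continuousOn_symm
  -- This is where the dimension matters: the overlap of the charts is a punctured vector space,
  -- path-connected once the dimension is at least two.
  have hrank : 1 < Module.rank ℝ (ℝ ∙ v)ᗮ := by
    have h1 : Module.finrank ℝ (ℝ ∙ v)ᗮ + 1 = Module.finrank ℝ E := by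
      have := Submodule.finrank_add_finrank_orthogonal (ℝ ∙ v)
      rw [finrank_span_singleton (by rintro rfl; simp at hv)] at this
      omega
    rw [← Module.finrank_eq_rank]
    exact_mod_cast (by omega : 1 < Module.finrank ℝ (ℝ ∙ v)ᗮ)
  have hpc := (isPathConnected_compl_singleton_of_one_lt_rank hrank (0 : (ℝ ∙ v)ᗮ)).image hsym
  have himg : (stereographic hv).symm '' {0}ᶜ = ({p}ᶜ ∩ {-p}ᶜ : Set (Metric.sphere (0 : E) 1)) := by
    have hp0 : stereographic hv (-p) = 0 := stereographic_apply_neg p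
    ext x
    constructor
    · rintro ⟨y, hy, rfl⟩
      have h1 : (stereographic hv).symm y ∈ (stereographic hv).source :=
        (stereographic hv).map_target (by simp)
      have h2 : stereographic hv ((stereographic hv).symm y) = y :=
        (stereographic hv).right_inv (by simp)
      refine ⟨by simpa using h1, fun h => hy ?_⟩
      rw [← h2, Set.mem_singleton_iff.1 h, hp0]
      rfl
    · rintro ⟨h1, h2⟩
      have hx : x ∈ (stereographic hv).source := by simpa using h1
      refine ⟨stereographic hv x, fun h => h2 ?_, (stereographic hv).left_inv hx⟩
      refine (stereographic hv).injOn hx (by simpa using hp.symm) ?_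
      rw [Set.mem_singleton_iff.1 h, hp0]
  rw [himg] at hpc
  exact fun x hx y hy => hpc.joinedIn x hx y hy

/-- Every cocycle on a spherical shell of dimension at least three is a coboundary. -/
lemma IsCocycleOn.isTrivialOn_shell {E : Type} [NormedAddCommGroup E] [InnerProductSpace ℝ E]
    [FiniteDimensional ℝ E] (hE : 2 < Module.finrank ℝ E) {r R : ℝ} (hr : 0 ≤ r)
    {c : C(I, E) → A} (hc : IsCocycleOn {x | ‖x‖ ∈ Set.Ioo r R} c) :
    IsTrivialOn {x | ‖x‖ ∈ Set.Ioo r R} c := by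
  by_cases hrR : r < R
  · have hne {x : E} (hx : ‖x‖ ∈ Set.Ioo r R) : ‖x‖ ≠ 0 := (hr.trans_lt hx.1).ne'
    -- Polar coordinates present the shell as a sphere times an interval, to which the product lemma
    -- applies.
    let ψ : C(Metric.sphere (0 : E) 1 × ℝ, E) := ⟨fun z => z.2 • (z.1 : E), by fun_prop⟩
    have hψ : ∀ z ∈ (Set.univ : Set (Metric.sphere (0 : E) 1)) ×ˢ Set.Ioo r R,
        ψ z ∈ {x : E | ‖x‖ ∈ Set.Ioo r R} := by
      rintro ⟨u, t⟩ ⟨-, ht⟩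
      have : ‖t • (u : E)‖ = t := by
        rw [norm_smul, norm_eq_of_mem_sphere, mul_one, Real.norm_of_nonneg (hr.trans ht.1.le)]
      simpa [ψ, this] using ht
    have hcψ := hc.comp ψ hψ
    have hm : (r + R) / 2 ∈ Set.Ioo r R := ⟨by linarith, by linarith⟩
    have htriv := hcψ.isTrivialOn_prod (y₀ := (r + R) / 2)
      (fun y hy => (convex_Ioo r R).isPathConnected ⟨_, hm⟩ |>.joinedIn _ hm _ hy)
      ((hcψ.comp (S := Set.univ) ⟨fun u => (u, (r + R) / 2), by fun_prop⟩
        fun u _ => ⟨trivial, hm⟩).isTrivialOn_sphere hE)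
      fun u _ => (hcψ.comp (S := Set.Ioo r R) ⟨fun t => (u, t), by fun_prop⟩
        fun t ht => ⟨trivial, ht⟩).isTrivialOn_convex (convex_Ioo r R)
    have : Nontrivial E := Module.nontrivial_of_finrank_pos (R := ℝ) (by omega)
    obtain ⟨v, hv⟩ := exists_norm_eq E zero_le_one
    classical
    let φ (x : E) : Metric.sphere (0 : E) 1 × ℝ :=
      ((if h : ‖x‖ = 0 then ⟨v, by simpa using hv⟩ else
        ⟨‖x‖⁻¹ • x, by simp [norm_smul, inv_mul_cancel₀ h]⟩ : Metric.sphere (0 : E) 1), ‖x‖)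
    refine .of_section (T := Set.univ ×ˢ Set.Ioo r R) ψ φ ?_ (fun x hx => ⟨trivial, hx⟩) ?_ htriv
    · refine ContinuousOn.prodMk ?_ continuous_norm.continuousOn
      rw [Topology.IsInducing.subtypeVal.continuousOn_iff]
      refine ContinuousOn.congr (f := fun x : E => ‖x‖⁻¹ • x) ?_ fun x hx => ?_
      · exact (continuous_norm.continuousOn.inv₀ fun x hx => hne hx).smul continuousOn_id
      · simp [hne hx, -norm_eq_zero]
    · intro x hx
      simp [ψ, φ, hne hx, smul_smul, -norm_eq_zero]
  · exact ⟨0, fun γ hγ => (hrR ((hγ 0).1.trans (hγ 0).2)).elim⟩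

/-! ### Splitting a cocycle on an intersection -/

/-- The cocycle `w` on `E ∩ V` is, over `B`, a difference of cocycles on `E` and on `V`. -/
def SplitsOver (E V : Set X) (w : C(I, X) → A) (B : Set X) : Prop :=
  ∃ c d : C(I, X) → A, IsCocycleOn (B ∩ E) c ∧ IsCocycleOn (B ∩ V) d ∧
    ∀ γ : C(I, X), (∀ t, γ t ∈ B ∩ (E ∩ V)) → c γ - d γ = w γ

lemma SplitsOver.mono {E V : Set X} {w : C(I, X) → A} {B C : Set X} (h : SplitsOver E V w C)
    (hBC : B ⊆ C) : SplitsOver E V w B := by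
  obtain ⟨c, d, hc, hd, h⟩ := h
  exact ⟨c, d, hc.mono (Set.inter_subset_inter_left _ hBC),
    hd.mono (Set.inter_subset_inter_left _ hBC), fun γ hγ => h γ fun t => ⟨hBC (hγ t).1, (hγ t).2⟩⟩

/-- Inside one of the two sets, `w` is already defined on the whole trace of the other, which can
absorb all of it. -/
lemma splitsOver_of_subset {E V : Set X} {w : C(I, X) → A} (hw : IsCocycleOn (E ∩ V) w)
    {B : Set X} (hB : B ⊆ E ∨ B ⊆ V) : SplitsOver E V w B := by
  rcases hB with hB | hB
  · exact ⟨0, -w, isCocycleOn_zero _, (hw.mono fun x hx => ⟨hB hx.1, hx.2⟩).neg, fun γ _ => by simp⟩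
  · exact ⟨w, 0, hw.mono fun x hx => ⟨hx.2, hB hx.1⟩, isCocycleOn_zero _, fun γ _ => by simp⟩

/-- This is Mayer–Vietoris one degree up. Two splittings of the same `w` differ over `B ∩ C` by
cocycles on the two sets that agree where both are defined. They glue to a cocycle on `B ∩ C`, and
`htriv` says that this obstruction is a coboundary. -/
lemma SplitsOver.union {E V : Set X} (hE : IsOpen E) (hV : IsOpen V) {w : C(I, X) → A}
    (hw : IsCocycleOn (E ∩ V) w) {B C : Set X} (hB : IsOpen B) (hC : IsOpen C)
    (hBC : B ∩ C ⊆ E ∪ V)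
    (htriv : ∀ c : C(I, X) → A, IsCocycleOn (B ∩ C) c → IsTrivialOn (B ∩ C) c)
    (h1 : SplitsOver E V w B) (h2 : SplitsOver E V w C) : SplitsOver E V w (B ∪ C) := by
  obtain ⟨c₁, d₁, hc₁, hd₁, h₁⟩ := h1
  obtain ⟨c₂, d₂, hc₂, hd₂, h₂⟩ := h2
  have hEd : IsCocycleOn (B ∩ C ∩ E) (c₁ - c₂) :=
    (hc₁.mono fun x hx => ⟨hx.1.1, hx.2⟩).sub (hc₂.mono fun x hx => ⟨hx.1.2, hx.2⟩)
  have hVd : IsCocycleOn (B ∩ C ∩ V) (d₁ - d₂) :=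
    (hd₁.mono fun x hx => ⟨hx.1.1, hx.2⟩).sub (hd₂.mono fun x hx => ⟨hx.1.2, hx.2⟩)
  obtain ⟨e, he, heE, heV⟩ := exists_glue ((hB.inter hC).inter hE) ((hB.inter hC).inter hV) hEd hVd
    fun γ hγ => by
      have e1 := h₁ γ fun t => ⟨(hγ t).1.1.1, (hγ t).1.2, (hγ t).2.2⟩
      have e2 := h₂ γ fun t => ⟨(hγ t).1.1.2, (hγ t).1.2, (hγ t).2.2⟩
      rw [← e2, ← sub_eq_zero] at e1
      rw [← sub_eq_zero, ← e1]
      simp only [Pi.sub_apply]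
      abel
  obtain ⟨g, hg⟩ := htriv e (he.mono fun x hx => (hBC hx).imp (fun h => ⟨hx, h⟩) fun h => ⟨hx, h⟩)
  -- The same coboundary is added to `c₂` and to `d₂`, so their difference is still `w`, and both
  -- now match the first splitting over `B ∩ C`.
  obtain ⟨c, hc, hcB, hcC⟩ := exists_glue (hB.inter hE) (hC.inter hE) hc₁
    (hc₂.add (isCocycleOn_cobdry g _)) fun γ hγ => by
      have e1 := heE γ fun t => ⟨⟨(hγ t).1.1, (hγ t).2.1⟩, (hγ t).1.2⟩
      have e2 := hg γ fun t => ⟨(hγ t).1.1, (hγ t).2.1⟩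
      rw [Pi.add_apply, cobdry, ← e2, e1]
      simp
  obtain ⟨d, hd, hdB, hdC⟩ := exists_glue (hB.inter hV) (hC.inter hV) hd₁
    (hd₂.add (isCocycleOn_cobdry g _)) fun γ hγ => by
      have e1 := heV γ fun t => ⟨⟨(hγ t).1.1, (hγ t).2.1⟩, (hγ t).1.2⟩
      have e2 := hg γ fun t => ⟨(hγ t).1.1, (hγ t).2.1⟩
      rw [Pi.add_apply, cobdry, ← e2, e1]
      simp
  refine ⟨c, d, by rwa [Set.union_inter_distrib_right], by rwa [Set.union_inter_distrib_right],
    fun γ hγ => ?_⟩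
  have hz : IsCocycleOn (B ∩ (E ∩ V) ∪ C ∩ (E ∩ V)) (c - d - w) :=
    ((hc.mono fun x hx => hx.imp (fun h => ⟨h.1, h.2.1⟩) fun h => ⟨h.1, h.2.1⟩).sub
      (hd.mono fun x hx => hx.imp (fun h => ⟨h.1, h.2.2⟩) fun h => ⟨h.1, h.2.2⟩)).sub
      (hw.mono fun x hx => hx.elim And.right And.right)
  have := hz.eq_zero (hB.inter (hE.inter hV)) (hC.inter (hE.inter hV))
    (fun γ hγ => by
      have e1 := h₁ γ hγ
      simp only [Pi.sub_apply]
      rw [hcB γ fun t => ⟨(hγ t).1, (hγ t).2.1⟩, hdB γ fun t => ⟨(hγ t).1, (hγ t).2.2⟩, e1, sub_self])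
    (fun γ hγ => by
      have e1 := h₂ γ hγ
      simp only [Pi.sub_apply]
      rw [hcC γ fun t => ⟨(hγ t).1, (hγ t).2.1⟩, hdC γ fun t => ⟨(hγ t).1, (hγ t).2.2⟩, ← e1]
      simp) γ (by rwa [← Set.union_inter_distrib_right])
  exact sub_eq_zero.1 this

/-- Slabs are added one at a time. Each new one overlaps the union so far in a convex set, where
every cocycle is a coboundary. -/
lemma SplitsOver.of_slabs {F : Type} [AddCommGroup F] [Module ℝ F] [TopologicalSpace F]
    [ContinuousAdd F] [ContinuousSMul ℝ F] [ContinuousNeg F]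
    {E V : Set F} (hE : IsOpen E) (hV : IsOpen V) {w : C(I, F) → A}
    (hw : IsCocycleOn (E ∩ V) w) {C : Set F} (hC : IsOpen C) (hconv : Convex ℝ C)
    (hCEV : C ⊆ E ∪ V) (f : F →L[ℝ] ℝ) {K : ℝ} (hK : ∀ x ∈ C, |f x| < K) {l : ℝ} (hl : 0 < l)
    (h : ∀ a : ℝ, SplitsOver E V w (C ∩ f ⁻¹' Set.Ioo a (a + l))) : SplitsOver E V w C := by
  -- Consecutive slabs of width `l` are shifted by `l / 2`, so that the open slabs overlap.
  have key (n : ℕ) (a : ℝ) : SplitsOver E V w (C ∩ f ⁻¹' Set.Ioo a (a + (1 + n / 2) * l)) := by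
    induction n with
    | zero => simpa using h a
    | succ n ih =>
      have hopen (a b : ℝ) : IsOpen (C ∩ f ⁻¹' Set.Ioo a b) :=
        hC.inter (isOpen_Ioo.preimage f.continuous)
      have hcv (a b : ℝ) : Convex ℝ (C ∩ f ⁻¹' Set.Ioo a b) :=
        hconv.inter ((convex_Ioo a b).linear_preimage f.toLinearMap)
      refine (SplitsOver.union hE hV hw (hopen _ _) (hopen _ _) (fun x hx => hCEV hx.1.1)
        (fun c hc => hc.isTrivialOn_convex ((hcv _ _).inter (hcv _ _))) ih
        (h (a + (n + 1) / 2 * l))).mono ?_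
      rintro x ⟨hx, h1, h2⟩
      push_cast at h2
      rcases lt_or_ge (f x) (a + (1 + n / 2) * l) with h3 | h3
      · exact .inl ⟨hx, h1, h3⟩
      · refine .inr ⟨hx, ?_, ?_⟩ <;> nlinarith
  obtain ⟨n, hn⟩ := exists_nat_gt (4 * K / l)
  refine (key n (-K)).mono fun x hx => ⟨hx, ?_⟩
  have h1 := abs_lt.1 (hK x hx)
  rw [div_lt_iff₀ hl] at hn
  exact ⟨h1.1, by nlinarith⟩

/-- Boxes smaller than a Lebesgue number lie in `E` or in `V` and split for free; the ball is
reassembled from them one coordinate direction at a time. -/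
lemma splitsOver_ball {E V : Set (EuclideanSpace ℝ (Fin 3))} (hE : IsOpen E) (hV : IsOpen V)
    (hEV : E ∪ V = Set.univ) {w : C(I, EuclideanSpace ℝ (Fin 3)) → A}
    (hw : IsCocycleOn (E ∩ V) w) (R : ℝ) : SplitsOver E V w (Metric.ball 0 R) := by
  obtain ⟨δ, hδ, hball⟩ := lebesgue_number_lemma_of_metric
    (s := Metric.closedBall (0 : EuclideanSpace ℝ (Fin 3)) R)
    (c := fun b : Bool => if b then E else V) (isCompact_closedBall _ _)
    (fun b => by cases b <;> simp [hE, hV])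
    (fun z _ => by
      rcases hEV.ge (Set.mem_univ z) with h | h
      · exact Set.mem_iUnion.2 ⟨true, by simpa using h⟩
      · exact Set.mem_iUnion.2 ⟨false, by simpa using h⟩)
  let f (i : Fin 3) : EuclideanSpace ℝ (Fin 3) →L[ℝ] ℝ := EuclideanSpace.proj i
  have hf (i : Fin 3) (x : EuclideanSpace ℝ (Fin 3)) : f i x = x i := rfl
  have hK (i : Fin 3) : ∀ x ∈ Metric.ball (0 : EuclideanSpace ℝ (Fin 3)) R, |f i x| < R :=
    fun x hx => (PiLp.norm_apply_le x i).trans_lt (by simpa using hx)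
  have hopen (i : Fin 3) (a b : ℝ) : IsOpen (f i ⁻¹' Set.Ioo a b) :=
    isOpen_Ioo.preimage (f i).continuous
  have hcv (i : Fin 3) (a b : ℝ) : Convex ℝ (f i ⁻¹' Set.Ioo a b) :=
    (convex_Ioo a b).linear_preimage (f i).toLinearMap
  have hl : 0 < δ / 2 := half_pos hδ
  have hsub {B : Set (EuclideanSpace ℝ (Fin 3))} : B ⊆ E ∪ V := hEV ▸ Set.subset_univ B
  refine .of_slabs hE hV hw Metric.isOpen_ball (convex_ball _ _) hsub (f 0) (hK 0) hl fun a₀ => ?_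
  refine .of_slabs hE hV hw (Metric.isOpen_ball.inter (hopen _ _ _))
    ((convex_ball _ _).inter (hcv _ _ _)) hsub (f 1) (fun x hx => hK 1 x hx.1) hl fun a₁ => ?_
  refine .of_slabs hE hV hw ((Metric.isOpen_ball.inter (hopen _ _ _)).inter (hopen _ _ _))
    (((convex_ball _ _).inter (hcv _ _ _)).inter (hcv _ _ _)) hsub (f 2)
    (fun x hx => hK 2 x hx.1.1) hl fun a₂ => ?_
  apply splitsOver_of_subset hw
  by_cases hne : (Metric.ball 0 R ∩ f 0 ⁻¹' Set.Ioo a₀ (a₀ + δ / 2) ∩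
      f 1 ⁻¹' Set.Ioo a₁ (a₁ + δ / 2) ∩ f 2 ⁻¹' Set.Ioo a₂ (a₂ + δ / 2)).Nonempty
  · obtain ⟨x, hx⟩ := hne
    obtain ⟨b, hb⟩ := hball x (Metric.ball_subset_closedBall hx.1.1.1)
    have hsub : ∀ y ∈ (Metric.ball 0 R ∩ f 0 ⁻¹' Set.Ioo a₀ (a₀ + δ / 2) ∩
        f 1 ⁻¹' Set.Ioo a₁ (a₁ + δ / 2) ∩ f 2 ⁻¹' Set.Ioo a₂ (a₂ + δ / 2)), y ∈ Metric.ball x δ := by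
      intro y hy
      have hd {a s t : ℝ} (hs : s ∈ Set.Ioo a (a + δ / 2)) (ht : t ∈ Set.Ioo a (a + δ / 2)) :
          dist s t ^ 2 ≤ (δ / 2) ^ 2 := by
        rw [Real.dist_eq, sq_abs]
        exact sq_le_sq' (by linarith [hs.1, ht.2]) (by linarith [hs.2, ht.1])
      have h0 := hd hy.1.1.2 hx.1.1.2
      have h1 := hd hy.1.2 hx.1.2
      have h2 := hd hy.2 hx.2
      rw [Metric.mem_ball, EuclideanSpace.dist_eq, Fin.sum_univ_three]
      -- Three coordinate differences of at most `δ / 2` give squared distance at most `3δ² / 4`,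
      -- below `δ²`.
      refine (Real.sqrt_lt' hδ).2 ?_
      have : 0 < δ ^ 2 := by positivity
      have h3 : (δ / 2) ^ 2 = δ ^ 2 / 4 := by ring
      rw [h3] at h0 h1 h2
      change dist (y 0) (x 0) ^ 2 ≤ _ at h0
      change dist (y 1) (x 1) ^ 2 ≤ _ at h1
      change dist (y 2) (x 2) ^ 2 ≤ _ at h2
      linarith
    cases b
    · exact .inr fun y hy => by simpa using hb (hsub y hy)
    · exact .inl fun y hy => by simpa using hb (hsub y hy)
  · exact .inl fun y hy => (hne ⟨y, hy⟩).elim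

/-- The second cohomology of the three-sphere vanishes: a cocycle on the intersection of two open
sets that cover the sphere is a difference of cocycles on the two sets. -/
lemma splitsOver_S3 {E V : Set S3} (hE : IsOpen E) (hV : IsOpen V) (hEV : E ∪ V = Set.univ)
    {p : S3} (hp : p ∈ E) {w : C(I, S3) → A} (hw : IsCocycleOn (E ∩ V) w) :
    SplitsOver E V w Set.univ := by
  have : Fact (Module.finrank ℝ (EuclideanSpace ℝ (Fin 4)) = 3 + 1) := ⟨by simp⟩
  let φ := stereographic' 3 p
  have hsource : φ.source = {p}ᶜ := stereographic'_source p
  have htarget : φ.target = Set.univ := stereographic'_target p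
  have hsym : Continuous φ.symm := by
    rw [← continuousOn_univ, ← htarget]
    exact φ.continuousOn_symm
  let ψ : C(EuclideanSpace ℝ (Fin 3), S3) := ⟨φ.symm, hsym⟩
  have hφψ (x : EuclideanSpace ℝ (Fin 3)) : φ (ψ x) = x := φ.right_inv (by simp [htarget])
  have hψφ {x : S3} (hx : x ≠ p) : ψ (φ x) = x := φ.left_inv (by simpa [hsource] using hx)
  have hψ (x : EuclideanSpace ℝ (Fin 3)) : ψ x ≠ p := by
    have : ψ x ∈ φ.source := φ.map_target (by simp [htarget])
    simpa [hsource] using this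
  have hcont : ContinuousOn φ {p}ᶜ := hsource ▸ φ.continuousOn
  -- Since `p` lies in `E`, the complement of `E` is a compact subset of the chart and fits in a
  -- ball of some radius `r`.
  have hcomp : IsCompact (φ '' Eᶜ) :=
    (hE.isClosed_compl.isCompact).image_of_continuousOn
      (hcont.mono fun x hx h => hx (Set.mem_singleton_iff.1 h ▸ hp))
  obtain ⟨r, hr0, hr⟩ := hcomp.isBounded.subset_closedBall_lt 0 0
  -- The sphere is covered by a ball `S` and the outside `T` of a smaller ball. `T` lies in `E`, so
  -- it splits trivially; `S` splits as a Euclidean ball; the overlap is a shell with trivial first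
  -- cohomology.
  let S : Set S3 := {p}ᶜ ∩ φ ⁻¹' Metric.ball 0 (r + 2)
  let T : Set S3 := (ψ '' Metric.closedBall 0 (r + 1))ᶜ
  have hS : IsOpen S := hcont.isOpen_inter_preimage isOpen_compl_singleton Metric.isOpen_ball
  have hT : IsOpen T :=
    ((isCompact_closedBall _ _).image ψ.continuous).isClosed.isOpen_compl
  have hST : S ∪ T = Set.univ := by
    refine Set.eq_univ_of_forall fun x => or_iff_not_imp_right.2 fun hx => ?_
    obtain ⟨y, hy, rfl⟩ := not_not.1 hx
    refine ⟨hψ y, ?_⟩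
    rw [Set.mem_preimage, hφψ]
    exact Metric.closedBall_subset_ball (by linarith) hy
  have hshell {x : S3} (hx : x ∈ S ∩ T) : ‖φ x‖ ∈ Set.Ioo (r + 1) (r + 2) := by
    refine ⟨?_, by simpa using hx.1.2⟩
    by_contra! h
    exact hx.2 ⟨φ x, by simpa using h, hψφ hx.1.1⟩
  have htriv (c : C(I, S3) → A) (hc : IsCocycleOn (S ∩ T) c) : IsTrivialOn (S ∩ T) c := by
    refine .of_section (T := {x | ‖x‖ ∈ Set.Ioo (r + 1) (r + 2)}) ψ φ
      (hcont.mono fun x hx => hx.1.1) (fun x hx => hshell hx) (fun x hx => hψφ hx.1.1) ?_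
    refine IsCocycleOn.isTrivialOn_shell (by simp) (by linarith) (hc.comp ψ fun x hx => ?_)
    refine ⟨⟨hψ x, by simpa [hφψ] using hx.2⟩, ?_⟩
    rintro ⟨y, hy, hxy⟩
    have : y = x := by rw [← hφψ y, hxy, hφψ]
    subst this
    exact absurd hx.1 (not_lt.2 (by simpa using hy))
  have hball := splitsOver_ball (hE.preimage ψ.continuous) (hV.preimage ψ.continuous)
    (by rw [← Set.preimage_union, hEV, Set.preimage_univ]) (hw.comp ψ fun x hx => hx) (r + 2)
  have hsplitS : SplitsOver E V w S := by
    obtain ⟨c, d, hc, hd, hcd⟩ := hball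
    obtain ⟨c', hc', hcc'⟩ := hc.exists_pullback (S := S ∩ E)
      (hcont.mono fun x hx => hx.1.1) fun x hx => ⟨hx.1.2, by
        rw [Set.mem_preimage, hψφ hx.1.1]; exact hx.2⟩
    obtain ⟨d', hd', hdd'⟩ := hd.exists_pullback (S := S ∩ V)
      (hcont.mono fun x hx => hx.1.1) fun x hx => ⟨hx.1.2, by
        rw [Set.mem_preimage, hψφ hx.1.1]; exact hx.2⟩
    refine ⟨c', d', hc', hd', fun γ hγ => ?_⟩
    let δ : C(I, EuclideanSpace ℝ (Fin 3)) :=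
      ⟨fun t => φ (γ t), hcont.comp_continuous γ.continuous fun t => (hγ t).1.1⟩
    have hδ : ψ.comp δ = γ := ContinuousMap.ext fun t => hψφ (hγ t).1.1
    have hδ' (t : I) : ψ (δ t) = γ t := DFunLike.congr_fun hδ t
    rw [hcc' γ δ (fun t => ⟨(hγ t).1, (hγ t).2.1⟩) fun _ => rfl,
      hdd' γ δ (fun t => ⟨(hγ t).1, (hγ t).2.2⟩) fun _ => rfl, hcd δ fun t => ⟨(hγ t).1.2, ?_, ?_⟩]
    · exact congrArg w hδ
    · rw [Set.mem_preimage, hδ']; exact (hγ t).2.1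
    · rw [Set.mem_preimage, hδ']; exact (hγ t).2.2
  have hsplitT : SplitsOver E V w T := by
    refine splitsOver_of_subset hw (.inl fun x hx => ?_)
    by_contra hxE
    have hxp : x ≠ p := fun h => hxE (h ▸ hp)
    have := hr ⟨x, hxE, rfl⟩
    exact hx ⟨φ x, Metric.closedBall_subset_closedBall (by linarith) this, hψφ hxp⟩
  rw [← hST]
  exact .union hE hV hw hS hT (hEV ▸ Set.subset_univ _) htriv hsplitS hsplitT

end Spheres
end KleinGluing
end
end

/-! ### Lifting and winding numbers: cocycles on the circle -/

section
open unitInterval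
noncomputable section
namespace KleinGluing

section Circle

variable {X Y Z : Type} [TopologicalSpace X] [TopologicalSpace Y] [TopologicalSpace Z]
variable {A : Type} [AddCommGroup A]

lemma exists_square_lift {E : Type} [TopologicalSpace E] {p : E → X} (hp : IsCoveringMap p)
    (hs : Function.Surjective p) (H : C(I × I, X)) : ∃ K : C(I × I, E), ∀ z, p (K z) = H z := by
  obtain ⟨e, he⟩ := hs (H (0, 0))
  let γ : C(I, X) := ⟨fun t => H (0, t), by fun_prop⟩
  refine ⟨hp.liftHomotopy H (hp.liftPath γ e he.symm) fun a => ?_, fun z =>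
    congrFun (hp.liftHomotopy_lifts H _ _) z⟩
  exact (congrFun (hp.liftPath_lifts γ e he.symm) a).symm

lemma exists_path_lift {E : Type} [TopologicalSpace E] {p : E → X} (hp : IsCoveringMap p)
    (hs : Function.Surjective p) (γ : C(I, X)) : ∃ δ : C(I, E), ∀ t, p (δ t) = γ t := by
  obtain ⟨e, he⟩ := hs (γ 0)
  exact ⟨hp.liftPath γ e he.symm, fun t => congrFun (hp.liftPath_lifts γ e he.symm) t⟩

/-- A cocycle that is a coboundary upstairs, of a function that is constant on the fibres, is a
coboundary. -/
lemma isTrivialOn_of_lift {c : C(I, X) → A} (p : C(Y, X))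
    (hp : ∀ γ : C(I, X), ∃ δ : C(I, Y), p.comp δ = γ) {g : Y → A}
    (hg : ∀ δ, c (p.comp δ) = g (δ 1) - g (δ 0)) (hfib : ∀ x y, p x = p y → g x = g y) :
    IsTrivialOn Set.univ c := by
  have hs (x : X) : ∃ y, p y = x := by
    obtain ⟨δ, hδ⟩ := hp (.const I x)
    exact ⟨δ 0, DFunLike.congr_fun hδ 0⟩
  choose s hs using hs
  refine ⟨g ∘ s, fun γ _ => ?_⟩
  obtain ⟨δ, rfl⟩ := hp γ
  rw [hg]
  congr 1 <;> exact hfib _ _ (hs _).symm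

lemma circle_exp_surjective : Function.Surjective Circle.exp := fun z =>
  ⟨Complex.arg z, Circle.exp_arg z⟩

/-- Subtracting the change of principal argument makes the total angle an integral multiple of `2π`
for open paths too. Lifts differ by a constant, so the integer does not depend on the lift. -/
lemma exists_wind (γ : C(I, Circle)) : ∃ n : ℤ, ∀ l : C(I, ℝ), (∀ t, Circle.exp (l t) = γ t) →
    n * (2 * Real.pi) = l 1 - l 0 - (Complex.arg (γ 1) - Complex.arg (γ 0)) := by
  obtain ⟨l, hl⟩ := exists_path_lift Circle.isCoveringMap_exp circle_exp_surjective γ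
  have h0 : Circle.exp (l 0) = Circle.exp (Complex.arg (γ 0)) := by rw [hl, Circle.exp_arg]
  have h1 : Circle.exp (l 1) = Circle.exp (Complex.arg (γ 1)) := by rw [hl, Circle.exp_arg]
  obtain ⟨m, hm⟩ := Circle.exp_eq_exp.1 h0
  obtain ⟨n, hn⟩ := Circle.exp_eq_exp.1 h1
  refine ⟨n - m, fun l' hl' => ?_⟩
  have e1 : l' = Circle.isCoveringMap_exp.liftPath γ (l' 0) (hl' 0).symm :=
    (Circle.isCoveringMap_exp.eq_liftPath_iff' ..).2 ⟨funext hl', rfl⟩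
  have e2 : (⟨fun t => l t + (l' 0 - l 0), by fun_prop⟩ : C(I, ℝ)) =
      Circle.isCoveringMap_exp.liftPath γ (l' 0) (hl' 0).symm := by
    refine (Circle.isCoveringMap_exp.eq_liftPath_iff' ..).2 ⟨funext fun t => ?_, by simp⟩
    simp only [Function.comp, ContinuousMap.coe_mk]
    rw [Circle.exp_add, Circle.exp_sub, hl', hl, hl]
    simp
  have key := DFunLike.congr_fun (e1.trans e2.symm) 1
  simp only [ContinuousMap.coe_mk] at key
  push_cast
  linarith

/-- The winding number of a path in the circle, relative to the principal arguments. -/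
def wind (γ : C(I, Circle)) : ℤ := (exists_wind γ).choose

lemma wind_eq {γ : C(I, Circle)} (l : C(I, ℝ)) (h : ∀ t, Circle.exp (l t) = γ t) :
    wind γ * (2 * Real.pi) = l 1 - l 0 - (Complex.arg (γ 1) - Complex.arg (γ 0)) :=
  (exists_wind γ).choose_spec l h

lemma isCocycleOn_wind : IsCocycleOn Set.univ wind where
  const z _ := by
    have := wind_eq (γ := .const I z) (.const I (Complex.arg z)) fun _ => Circle.exp_arg z
    simpa [Real.pi_ne_zero] using this
  square H _ := by
    obtain ⟨K, hK⟩ := exists_square_lift Circle.isCoveringMap_exp circle_exp_surjective H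
    have h1 := wind_eq (K.comp ⟨fun s => (s, 0), by fun_prop⟩)
      (γ := H.comp ⟨fun s => (s, 0), by fun_prop⟩) fun _ => hK _
    have h2 := wind_eq (K.comp ⟨fun s => (1, s), by fun_prop⟩)
      (γ := H.comp ⟨fun s => (1, s), by fun_prop⟩) fun _ => hK _
    have h3 := wind_eq (K.comp ⟨fun s => (0, s), by fun_prop⟩)
      (γ := H.comp ⟨fun s => (0, s), by fun_prop⟩) fun _ => hK _
    have h4 := wind_eq (K.comp ⟨fun s => (s, 1), by fun_prop⟩)
      (γ := H.comp ⟨fun s => (s, 1), by fun_prop⟩) fun _ => hK _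
    simp only [ContinuousMap.comp_apply, ContinuousMap.coe_mk] at h1 h2 h3 h4
    have hpi : (2 * Real.pi) ≠ 0 := by positivity
    rw [← Int.cast_inj (α := ℝ), ← mul_left_inj' hpi]
    push_cast
    linarith

/-- The loop that runs once around the circle. -/
def loop : C(I, Circle) := ⟨fun t => Circle.exp (2 * Real.pi * t), by fun_prop⟩

lemma loop_zero : loop 0 = 1 := by simp [loop]
lemma loop_one : loop 1 = 1 := by simp [loop]

lemma wind_loop : wind loop = 1 := by
  have := wind_eq (γ := loop) ⟨fun t => 2 * Real.pi * t, by fun_prop⟩ fun _ => rfl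
  rw [loop_zero, loop_one] at this
  simp only [ContinuousMap.coe_mk, Set.Icc.coe_one, Set.Icc.coe_zero] at this
  have hpi : (2 * Real.pi) ≠ 0 := by positivity
  rw [← Int.cast_inj (α := ℝ), ← mul_left_inj' hpi, this]
  push_cast
  ring

/-- A cocycle on the circle that vanishes on the standard loop is a coboundary. -/
lemma isTrivialOn_circle {c : C(I, Circle) → A} (hc : IsCocycleOn Set.univ c)
    (h : c loop = 0) : IsTrivialOn Set.univ c := by
  let p : C(ℝ, Circle) := Circle.exp
  obtain ⟨g, hg⟩ := (hc.comp p (S := Set.univ) fun _ _ => trivial).isTrivialOn_convex convex_univ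
  let seg (x y : ℝ) : C(I, ℝ) := ⟨fun t => x + t * (y - x), by fun_prop⟩
  -- Translation by `2π` changes a primitive on the line by the value on `loop`, which vanishes; the
  -- primitive therefore descends to the circle.
  have hper (x : ℝ) : g (x + 2 * Real.pi) = g x := by
    have h1 := hg (seg 0 x) fun _ => trivial
    have h2 := hg (seg (2 * Real.pi) (x + 2 * Real.pi)) fun _ => trivial
    have h3 := hg (seg 0 (2 * Real.pi)) fun _ => trivial
    have e1 : p.comp (seg (2 * Real.pi) (x + 2 * Real.pi)) = p.comp (seg 0 x) := by
      ext t
      simp only [p, seg, ContinuousMap.comp_apply, ContinuousMap.coe_mk]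
      rw [Circle.exp_add, Circle.exp_two_pi]
      simp
    have e2 : p.comp (seg 0 (2 * Real.pi)) = loop := by
      ext t
      simp only [p, seg, ContinuousMap.comp_apply, ContinuousMap.coe_mk, loop]
      ring_nf
    simp only [e1, e2, h] at h1 h2 h3
    rw [h1] at h2
    simp only [seg, ContinuousMap.coe_mk, Set.Icc.coe_one, Set.Icc.coe_zero] at h2 h3
    ring_nf at h2 h3
    rw [← sub_eq_zero] at h2 h3
    have h4 : g (Real.pi * 2) = g 0 := (sub_eq_zero.1 (by simpa using h3)).symm
    rw [h4, sub_sub_sub_cancel_right, sub_eq_zero] at h2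
    rw [mul_comm 2 Real.pi, ← h2]
  refine isTrivialOn_of_lift p (fun γ => ?_) (fun δ => hg δ fun _ => trivial) fun x y hxy => ?_
  · obtain ⟨δ, hδ⟩ := exists_path_lift Circle.isCoveringMap_exp circle_exp_surjective γ
    exact ⟨δ, ContinuousMap.ext hδ⟩
  · obtain ⟨n, hn⟩ := Circle.exp_eq_exp.1 hxy
    have := (Function.Periodic.int_mul (f := g) (c := 2 * Real.pi) hper n) y
    rw [hn]
    exact this

/-- The degree of a class on the circle. -/
def deg (u : H1 Circle) : ℤ := evalHom isCocycleOn_wind u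

/-- On the circle the pulled-back cocycle is cohomologous to its value on `loop` times the winding
cocycle. This translates homology classes of curves into values on paths. -/
lemma evalHom_map_circle {c : C(I, Y) → A} (hc : IsCocycleOn Set.univ c) (f : C(Circle, Y))
    (u : H1 Circle) : evalHom hc (H1.map f u) = deg u • c (f.comp loop) := by
  rw [evalHom_map]
  have hcf := hc.comp f (S := Set.univ) fun _ _ => trivial
  let ψ : ℤ →+ A := (zmultiplesHom A) (c (f.comp loop))
  have hw := isCocycleOn_wind.map ψ
  have htriv := isTrivialOn_circle (hcf.sub hw) (by simp [ψ, wind_loop])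
  have h := evalHom_eq_zero_of_isTrivialOn (hcf.sub hw) htriv u
  have h2 := evalHom_congr hcf ((hcf.sub hw).add hw) (by simp) u
  rw [h2, evalHom_add (hcf.sub hw) hw, h, zero_add, evalHom_hom isCocycleOn_wind]
  rfl

/-- A closed path has a homology class on which cocycles take their value on the path. -/
lemma exists_loop_class (γ : C(I, Y)) (hγ : γ 0 = γ 1) : ∃ x : H1 Y,
    ∀ {A : Type} [AddCommGroup A] {c : C(I, Y) → A} (hc : IsCocycleOn Set.univ c),
      evalHom hc x = c γ := by
  obtain ⟨e, he, -, p, hp⟩ := exists_universal_cocycle Y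
  refine ⟨e γ, fun {A} _ {c} hc => ?_⟩
  obtain ⟨φ, hφ⟩ := exists_desc hc
  rw [evalHom_eq hc φ hφ, hp, hγ, map_sub, map_add, hφ]
  simp

/-- The class of `loop` has degree one and is a multiple of `u`, so the degree of `u` divides one.
-/
lemma IsFundamentalClass.deg_eq {u : H1 Circle} (hu : IsFundamentalClass u) :
    deg u = 1 ∨ deg u = -1 := by
  obtain ⟨x, hx⟩ := exists_loop_class loop (loop_zero.trans loop_one.symm)
  obtain ⟨n, rfl⟩ := hu x
  have := hx isCocycleOn_wind
  have h2 : evalHom isCocycleOn_wind (n • u) = n • deg u := map_zsmul (evalHom isCocycleOn_wind) n u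
  rw [wind_loop, h2, smul_eq_mul, mul_comm] at this
  exact Int.eq_one_or_neg_one_of_mul_eq_one this

lemma IsFundamentalClass.eq_zero_iff {u : H1 Circle} (hu : IsFundamentalClass u) (a : A) :
    deg u • a = 0 ↔ a = 0 := by
  rcases hu.deg_eq with h | h <;> simp [h]

lemma isCocycle_circle_closed {c : C(I, Circle) → A} (hc : IsCocycleOn Set.univ c)
    (γ : C(I, Circle)) (hγ : γ 0 = γ 1) : c γ = wind γ • c loop := by
  let ψ : ℤ →+ A := (zmultiplesHom A) (c loop)
  obtain ⟨g, hg⟩ := isTrivialOn_circle (hc.sub (isCocycleOn_wind.map ψ)) (by simp [ψ, wind_loop])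
  have := hg γ fun _ => trivial
  rw [hγ, sub_self, Pi.sub_apply, sub_eq_zero] at this
  simpa [ψ] using this

lemma wind_pow (n : ℤ) : wind ((⟨fun z => z ^ n, by fun_prop⟩ : C(Circle, Circle)).comp loop) = n := by
  have := wind_eq (γ := (⟨fun z => z ^ n, by fun_prop⟩ : C(Circle, Circle)).comp loop)
    ⟨fun t => n * (2 * Real.pi * t), by fun_prop⟩ fun _ => Circle.exp_intCast_mul ..
  simp only [ContinuousMap.comp_apply, loop_zero, loop_one, ContinuousMap.coe_mk,
    Set.Icc.coe_one, Set.Icc.coe_zero] at this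
  have hpi : (2 * Real.pi) ≠ 0 := by positivity
  rw [← Int.cast_inj (α := ℝ), ← mul_left_inj' hpi, this]
  ring

/-- The product lemma for a torus. -/
lemma isTrivialOn_prod_circle {c : C(I, X × Circle) → A} (hc : IsCocycleOn Set.univ c)
    (hX : ∀ x y : X, Joined x y) {x₀ : X}
    (h1 : IsTrivialOn Set.univ fun γ => c ⟨fun t => (γ t, 1), by fun_prop⟩)
    (h2 : c ⟨fun t => (x₀, loop t), by fun_prop⟩ = 0) : IsTrivialOn Set.univ c := by
  rw [← Set.univ_prod_univ]
  refine IsCocycleOn.isTrivialOn_prod (y₀ := 1) (by rwa [Set.univ_prod_univ])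
    (fun y _ => (joinedIn_univ).2 (PathConnectedSpace.joined _ _)) h1 fun x _ => ?_
  refine isTrivialOn_circle (hc.comp ⟨fun z => (x, z), by fun_prop⟩ fun _ _ => trivial) ?_
  let η := (hX x₀ x).somePath.toContinuousMap
  have e0 : η 0 = x₀ := Path.source _
  have e1 : η 1 = x := Path.target _
  -- Sliding the circle factor along `η` gives a square with equal vertical sides, so the value on
  -- the loop over `x` is that over `x₀`.
  have h := hc.square ⟨fun z => (η z.2, loop z.1), by fun_prop⟩ fun _ => trivial
  have a1 : (⟨fun z => (η z.2, loop z.1), by fun_prop⟩ : C(I × I, X × Circle)).comp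
      ⟨fun s => (s, 0), by fun_prop⟩ = ⟨fun t => (x₀, loop t), by fun_prop⟩ := by
    ext t : 1; simp [e0]
  have a2 : (⟨fun z => (η z.2, loop z.1), by fun_prop⟩ : C(I × I, X × Circle)).comp
      ⟨fun s => (s, 1), by fun_prop⟩ = (⟨fun z => (x, z), by fun_prop⟩ : C(_, _)).comp loop := by
    ext t : 1; simp [e1]
  have a3 : (⟨fun z => (η z.2, loop z.1), by fun_prop⟩ : C(I × I, X × Circle)).comp
      ⟨fun s => (0, s), by fun_prop⟩ =
      (⟨fun z => (η z.2, loop z.1), by fun_prop⟩ : C(I × I, X × Circle)).comp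
      ⟨fun s => (1, s), by fun_prop⟩ := by
    ext t : 1; simp [loop_zero, loop_one]
  rw [a1, a2, a3, h2, zero_add] at h
  exact left_eq_add.1 h

lemma isTrivialOn_Icc {c : C(I, Set.Icc (-1 : ℝ) 1) → A} (hc : IsCocycleOn Set.univ c) :
    IsTrivialOn Set.univ c := by
  have h : (-1 : ℝ) ≤ 1 := by norm_num
  refine .of_section (T := Set.univ) ⟨Set.projIcc (-1) 1 h, continuous_projIcc⟩ Subtype.val
    continuous_subtype_val.continuousOn (Set.mapsTo_univ _ _) (fun x _ => Set.projIcc_val h x) ?_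
  exact (hc.comp (S := Set.univ) _ fun _ _ => trivial).isTrivialOn_convex convex_univ

end Circle
end KleinGluing
end
end

/-! ### The double cover of `N` -/

section
open unitInterval
noncomputable section
namespace KleinGluing

namespace N

/-- The double cover of `N`. -/
abbrev Cover : Type := Circle × Circle × Set.Icc (-1 : ℝ) 1

lemma flip_flip (x : Cover) : flip (flip x) = x := by
  simp [flip]

lemma flip_ne (x : Cover) : flip x ≠ x := by
  intro h
  have h1 : -x.1 = x.1 := congrArg Prod.fst h
  have h2 : (-(x.1 : ℂ)) = x.1 := congrArg Subtype.val h1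
  rw [neg_eq_self] at h2
  exact x.1.coe_ne_zero h2

lemma continuous_flip : Continuous flip := by
  unfold flip
  refine Continuous.prodMk (by fun_prop) (Continuous.prodMk (by fun_prop) ?_)
  exact Continuous.subtype_mk (by fun_prop) _

lemma mk_flip (x : Cover) : N.mk (flip x) = N.mk x :=
  (Quot.sound (r := fun x y : Cover => y = flip x) rfl).symm

lemma mk_eq_mk {x y : Cover} : N.mk x = N.mk y ↔ x = y ∨ x = flip y := by
  constructor
  · intro h
    let f : N → Set Cover := Quot.lift (fun x => {x, flip x}) fun a b hab => by
      subst hab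
      rw [flip_flip, Set.pair_comm]
    have : f (N.mk x) = f (N.mk y) := congrArg f h
    have hx : x ∈ f (N.mk x) := Set.mem_insert _ _
    rw [this] at hx
    exact hx
  · rintro (rfl | rfl)
    · rfl
    · exact mk_flip _

lemma mk_surjective : Function.Surjective N.mk := Quot.mk_surjective

lemma isQuotientMap_mk : Topology.IsQuotientMap N.mk := isQuotientMap_quot_mk

/-- The action of the deck group of the double cover. -/
@[reducible] def deckAction : MulAction ℤˣ Cover where
  smul g x := if g = 1 then x else flip x
  one_smul x := if_pos rfl
  mul_smul g h x := by
    change (if g * h = 1 then x else flip x) =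
      if g = 1 then (if h = 1 then x else flip x) else flip (if h = 1 then x else flip x)
    rcases Int.units_eq_one_or g with rfl | rfl <;> rcases Int.units_eq_one_or h with rfl | rfl <;>
      simp [flip_flip]

/-- The involution has no fixed points because it negates `z`; on a Hausdorff space a free action of
a group of order two is a covering action. -/
lemma isCoveringMap_mk : IsCoveringMap N.mk := by
  let _ := deckAction
  have hneg (x : Cover) : (-1 : ℤˣ) • x = flip x := if_neg (by decide)
  have hc : ContinuousConstSMul ℤˣ Cover := ⟨fun g => by
    rcases Int.units_eq_one_or g with rfl | rfl
    · exact continuous_id.congr fun x => (one_smul _ x).symm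
    · exact continuous_flip.congr fun x => (hneg x).symm⟩
  have horb {x y : Cover} : N.mk x = N.mk y ↔ x ∈ MulAction.orbit ℤˣ y := by
    refine mk_eq_mk.trans ⟨?_, ?_⟩
    · rintro (rfl | rfl)
      · exact ⟨1, one_smul _ _⟩
      · exact ⟨-1, hneg y⟩
    · rintro ⟨g, rfl⟩
      rcases Int.units_eq_one_or g with rfl | rfl
      · exact .inl (one_smul _ _)
      · exact .inr (hneg y)
  have hdis (x : Cover) : ∃ U ∈ nhds x, ∀ g : ℤˣ, ((g • ·) '' U ∩ U).Nonempty → g = 1 := by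
    obtain ⟨u, v, hu, hv, hxu, hxv, huv⟩ := t2_separation (flip_ne x)
    refine ⟨v ∩ flip ⁻¹' u, (hv.inter (hu.preimage continuous_flip)).mem_nhds ⟨hxv, hxu⟩, ?_⟩
    rintro g ⟨_, ⟨y, hy, rfl⟩, hy'⟩
    rcases Int.units_eq_one_or g with rfl | rfl
    · rfl
    · have h : flip y ∈ v := by rw [← hneg]; exact hy'.1
      exact (Set.disjoint_left.1 huv hy.2 h).elim
  have hq : IsQuotientCoveringMap N.mk ℤˣ :=
    { toIsQuotientMap := isQuotientMap_mk
      toContinuousConstSMul := hc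
      apply_eq_iff_mem_orbit := horb
      disjoint := hdis }
  exact hq.isCoveringMap

lemma exists_lift (γ : C(I, N)) : ∃ δ : C(I, Cover), N.mk.comp δ = γ := by
  obtain ⟨δ, hδ⟩ := exists_path_lift isCoveringMap_mk mk_surjective γ
  exact ⟨δ, ContinuousMap.ext hδ⟩

/-- The map to the circle `[z, w, t] ↦ z²`. -/
def zsq : C(N, Circle) :=
  ⟨Quot.lift (fun x => x.1 ^ (2 : ℤ)) fun a b h => by subst h; ext; simp [flip],
    continuous_quot_lift _ (by fun_prop)⟩

/-- The function `[z, w, t] ↦ Re w`. -/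
def reW : C(N, ℝ) :=
  ⟨Quot.lift (fun x => (x.2.1 : ℂ).re) fun a b h => by subst h; simp [flip],
    continuous_quot_lift _ (by fun_prop)⟩

/-- The function `[z, w, t] ↦ |t|`. -/
def absT : C(N, ℝ) :=
  ⟨Quot.lift (fun x => |(x.2.2 : ℝ)|) fun a b h => by subst h; simp [flip],
    continuous_quot_lift _ (by fun_prop)⟩

/-- The function `[z, w, t] ↦ t z`. -/
def tz : C(N, ℂ) :=
  ⟨Quot.lift (fun x => (x.2.2 : ℝ) * (x.1 : ℂ)) fun a b h => by subst h; simp [flip],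
    continuous_quot_lift _ (by fun_prop)⟩

/-- The function `[z, w, t] ↦ (Im w) z`. -/
def imz : C(N, ℂ) :=
  ⟨Quot.lift (fun x => (x.2.1 : ℂ).im * (x.1 : ℂ)) fun a b h => by subst h; simp [flip],
    continuous_quot_lift _ (by fun_prop)⟩

@[simp] lemma zsq_mk (x : Cover) : zsq (N.mk x) = x.1 ^ (2 : ℤ) := rfl
@[simp] lemma reW_mk (x : Cover) : reW (N.mk x) = (x.2.1 : ℂ).re := rfl
@[simp] lemma absT_mk (x : Cover) : absT (N.mk x) = |(x.2.2 : ℝ)| := rfl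
lemma tz_mk (x : Cover) : tz (N.mk x) = (x.2.2 : ℝ) * (x.1 : ℂ) := rfl
lemma imz_mk (x : Cover) : imz (N.mk x) = (x.2.1 : ℂ).im * (x.1 : ℂ) := rfl

/-- The invariant functions `z²`, `Re w`, `tz` and `(Im w)z` separate points: `z²` fixes `z` up to
sign, the involution adjusts the sign, and then `w` and `t` can be read off. -/
instance : T2Space N := by
  refine T2Space.of_injective_continuous (f := fun x => (zsq x, reW x, tz x, imz x)) ?_
    (by fun_prop)
  have key (x y : Cover) (h1 : x.1 = y.1) (h : (fun x => (zsq x, reW x, tz x, imz x)) (N.mk x) =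
      (fun x => (zsq x, reW x, tz x, imz x)) (N.mk y)) : x = y := by
    simp only [Prod.mk.injEq, tz_mk, imz_mk, reW_mk, h1] at h
    obtain ⟨-, hre, ht, hi⟩ := h
    have hz := y.1.coe_ne_zero
    have ht' := Complex.ofReal_injective (mul_right_cancel₀ hz ht)
    have hi' := Complex.ofReal_injective (mul_right_cancel₀ hz hi)
    exact Prod.ext h1 (Prod.ext (Circle.ext (Complex.ext hre hi')) (Subtype.ext ht'))
  intro a b h
  obtain ⟨x, rfl⟩ := mk_surjective a
  obtain ⟨y, rfl⟩ := mk_surjective b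
  have h1 : x.1 ^ (2 : ℤ) = y.1 ^ (2 : ℤ) := congrArg Prod.fst h
  have h2 : (x.1 : ℂ) ^ 2 = (y.1 : ℂ) ^ 2 := by
    have := congrArg (fun z : Circle => (z : ℂ)) h1
    simpa using this
  rcases sq_eq_sq_iff_eq_or_eq_neg.1 h2 with h3 | h3
  · rw [key x y (Circle.ext h3) h]
  · rw [← mk_flip y] at h ⊢
    rw [key x (flip y) (Circle.ext (by simpa [flip] using h3)) h]

end N

end KleinGluing
end
end

/-! ### Cocycles on `N` and on its boundary torus -/

section
open unitInterval
noncomputable section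
namespace KleinGluing

variable {A : Type} [AddCommGroup A]

/-- A cocycle on a torus that vanishes on both coordinate circles is a coboundary. -/
lemma isTrivialOn_torus {c : C(I, Circle × Circle) → A} (hc : IsCocycleOn Set.univ c)
    (h1 : c ⟨fun t => (loop t, 1), by fun_prop⟩ = 0)
    (h2 : c ⟨fun t => (1, loop t), by fun_prop⟩ = 0) : IsTrivialOn Set.univ c :=
  isTrivialOn_prod_circle hc (PathConnectedSpace.joined) (x₀ := 1)
    (isTrivialOn_circle (hc.comp (S := Set.univ) ⟨fun z => (z, 1), by fun_prop⟩ fun _ _ => trivial)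
      h1) h2

lemma wind_one : wind 1 = 0 := isCocycleOn_wind.const 1 trivial

namespace N

/-- The centre of the interval. -/
abbrev mid : Set.Icc (-1 : ℝ) 1 := ⟨0, by norm_num⟩

/-- The closed path in `N` along the core of an exceptional fibre. -/
def pathA : C(I, N) := N.mk.comp ⟨fun t => (Circle.exp (Real.pi * t), 1, mid), by fun_prop⟩

/-- The closed path in `N` along the fibre of the structure over the Möbius band. -/
def pathB : C(I, N) := N.mk.comp ⟨fun t => (1, loop t, mid), by fun_prop⟩

lemma exp_pi : Circle.exp Real.pi = -1 := by
  ext; simp [Circle.coe_exp]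

lemma pathA_closed : pathA 0 = pathA 1 := by
  simp only [pathA, ContinuousMap.comp_apply, ContinuousMap.coe_mk]
  rw [← mk_flip]
  simp [flip, exp_pi]

/-- At `w = 1`, `t = 0` the involution carries the half circle of `z` from `0` to `π` onto the other
half, so the full circle runs twice along `pathA`. -/
lemma cocycle_double {c : C(I, N) → A} (hc : IsCocycleOn Set.univ c) :
    c (N.mk.comp ⟨fun t => (loop t, 1, mid), by fun_prop⟩) = (2 : ℤ) • c pathA := by
  let p : C(ℝ, N) := N.mk.comp ⟨fun s => (Circle.exp s, 1, mid), by fun_prop⟩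
  obtain ⟨g, hg⟩ := (hc.comp p (S := Set.univ) fun _ _ => trivial).isTrivialOn_convex convex_univ
  let seg (x y : ℝ) : C(I, ℝ) := ⟨fun t => x + t * (y - x), by fun_prop⟩
  have h1 := hg (seg 0 Real.pi) fun _ => trivial
  have h2 := hg (seg Real.pi (2 * Real.pi)) fun _ => trivial
  have h3 := hg (seg 0 (2 * Real.pi)) fun _ => trivial
  have e1 : p.comp (seg 0 Real.pi) = pathA := by
    ext t : 1
    simp [p, seg, pathA, mul_comm]
  have e2 : p.comp (seg Real.pi (2 * Real.pi)) = pathA := by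
    ext t : 1
    simp only [p, seg, pathA, ContinuousMap.comp_apply, ContinuousMap.coe_mk]
    rw [← mk_flip]
    congr 1
    simp only [flip, Circle.exp_add, exp_pi]
    refine Prod.ext ?_ (Prod.ext (by simp) (Subtype.ext (by simp)))
    ext
    simp only [neg_mul, one_mul, neg_neg]
    ring_nf
  have e3 : p.comp (seg 0 (2 * Real.pi)) = N.mk.comp ⟨fun t => (loop t, 1, mid), by fun_prop⟩ := by
    ext t : 1
    simp [p, seg, loop, mul_comm]
  simp only [e1, e2, e3] at h1 h2 h3
  simp only [seg, ContinuousMap.coe_mk, Set.Icc.coe_one, Set.Icc.coe_zero, zero_mul, add_zero,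
    one_mul, add_sub_cancel] at h1 h2 h3
  rw [h3, two_smul]
  nth_rewrite 1 [h1]
  rw [h2]
  abel

lemma joined_cover (x y : Cover) : Joined x y := by
  have h (a b : Set.Icc (-1 : ℝ) 1) : Joined a b := by
    have : (Set.Icc (-1 : ℝ) 1).Nonempty := ⟨0, by norm_num⟩
    have := isPathConnected_iff_pathConnectedSpace.1 ((convex_Icc (-1 : ℝ) 1).isPathConnected this)
    exact PathConnectedSpace.joined _ _
  exact ⟨(PathConnectedSpace.joined x.1 y.1).somePath.prod
    ((PathConnectedSpace.joined x.2.1 y.2.1).somePath.prod (h x.2.2 y.2.2).somePath)⟩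

/-- A cocycle on `N` that vanishes on the two generating loops is a coboundary. -/
lemma isTrivialOn_of_paths {c : C(I, N) → A} (hc : IsCocycleOn Set.univ c) (hA : c pathA = 0)
    (hB : c pathB = 0) : IsTrivialOn Set.univ c := by
  have hcm := hc.comp N.mk (S := Set.univ) fun _ _ => trivial
  let ψ : C((Set.Icc (-1 : ℝ) 1 × Circle) × Circle, Cover) :=
    ⟨fun x => (x.1.2, x.2, x.1.1), by fun_prop⟩
  let ψ' : C(Set.Icc (-1 : ℝ) 1 × Circle, Cover) := ⟨fun x => (x.2, 1, x.1), by fun_prop⟩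
  have hj (a b : Set.Icc (-1 : ℝ) 1) : Joined a b := by
    obtain ⟨γ⟩ := joined_cover (1, 1, a) (1, 1, b)
    exact ⟨γ.map (f := fun x : Cover => x.2.2) (by fun_prop)⟩
  -- The double cover is a torus times an interval. The pulled-back cocycle has value `2 c(pathA) =
  -- 0` on the `z` circle and `c(pathB) = 0` on the `w` circle.
  have htriv : IsTrivialOn Set.univ fun γ => c (N.mk.comp γ) := by
    refine .of_section (T := Set.univ) ψ (fun x : Cover => ((x.2.2, x.1), x.2.1))
      (by fun_prop) (Set.mapsTo_univ _ _) (fun _ _ => rfl) ?_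
    refine isTrivialOn_prod_circle (hcm.comp ψ (S := Set.univ) fun _ _ => trivial)
      (fun x y => ?_) (x₀ := (mid, 1)) ?_ hB
    · exact ⟨(hj x.1 y.1).somePath.prod (PathConnectedSpace.joined x.2 y.2).somePath⟩
    · refine isTrivialOn_prod_circle (hcm.comp ψ' (S := Set.univ) fun _ _ => trivial) hj
        (x₀ := mid) (isTrivialOn_Icc (hcm.comp (S := Set.univ)
          ⟨fun x => (1, 1, x), by fun_prop⟩ fun _ _ => trivial)) ?_
      have := cocycle_double hc
      rw [hA, smul_zero] at this
      exact this
  obtain ⟨g, hg⟩ := htriv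
  refine isTrivialOn_of_lift N.mk exists_lift (fun δ => hg δ fun _ => trivial) ?_
  -- Both `g` and its composite with the involution are primitives, so they differ by a constant.
  -- The lift of `pathA` joins a point to its image, so this constant is `c(pathA) = 0`.
  have hflip (v : Cover) : g (flip v) = g v := by
    obtain ⟨δ⟩ := joined_cover (1, 1, mid) v
    have h1 := hg δ.toContinuousMap fun _ => trivial
    have h2 := hg ((⟨flip, continuous_flip⟩ : C(Cover, Cover)).comp δ.toContinuousMap)
      fun _ => trivial
    have e : N.mk.comp ((⟨flip, continuous_flip⟩ : C(Cover, Cover)).comp δ.toContinuousMap) =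
        N.mk.comp δ.toContinuousMap := ContinuousMap.ext fun t => mk_flip _
    have h3 := hg ⟨fun t => (Circle.exp (Real.pi * t), 1, mid), by fun_prop⟩ fun _ => trivial
    change c pathA = _ at h3
    rw [hA] at h3
    simp only [e] at h2
    simp only [h1, ContinuousMap.comp_apply, ContinuousMap.coe_mk, Path.coe_toContinuousMap,
      Path.source, Path.target, Set.Icc.coe_one, Set.Icc.coe_zero, mul_one, mul_zero,
      Circle.exp_zero, exp_pi] at h2 h3
    have e1 : flip (1, 1, mid) = (-1, 1, mid) := by simp [flip]
    rw [e1, ← sub_eq_zero.1 h3.symm] at h2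
    exact (sub_left_inj.1 h2).symm
  intro x y hxy
  rcases mk_eq_mk.1 hxy with rfl | rfl
  · rfl
  · exact hflip y

/-- A cocycle on the double cover that is invariant under the deck transformation descends. -/
lemma exists_descent {c : C(I, Cover) → A} (hc : IsCocycleOn Set.univ c)
    (hinv : ∀ δ : C(I, Cover), c ((⟨flip, continuous_flip⟩ : C(Cover, Cover)).comp δ) = c δ) :
    ∃ d : C(I, N) → A, IsCocycleOn Set.univ d ∧ ∀ δ, d (N.mk.comp δ) = c δ := by
  choose L hL using exists_lift
  -- Two lifts of one path are equal or exchanged by the involution, so invariance makes the value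
  -- independent of the chosen lift `L`.
  have hval (δ : C(I, Cover)) : c (L (N.mk.comp δ)) = c δ := by
    have h := DFunLike.congr_fun (hL (N.mk.comp δ))
    have e1 := (isCoveringMap_mk.eq_liftPath_iff' (γ := N.mk.comp δ)
      (e := L (N.mk.comp δ) 0) (γ_0 := (h 0).symm)).2 ⟨funext h, rfl⟩
    rcases mk_eq_mk.1 (h 0) with h0 | h0
    · rw [e1]
      congr 1
      exact ((isCoveringMap_mk.eq_liftPath_iff' ..).2 ⟨rfl, h0.symm⟩).symm
    · rw [e1, ← hinv δ]
      congr 1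
      exact ((isCoveringMap_mk.eq_liftPath_iff' (γ := N.mk.comp δ) (Γ := (⟨flip, continuous_flip⟩ :
        C(Cover, Cover)).comp δ) ..).2 ⟨funext fun t => mk_flip _, h0.symm⟩).symm
  refine ⟨fun γ => c (L γ), ⟨fun x _ => ?_, fun H _ => ?_⟩, hval⟩
  · obtain ⟨v, rfl⟩ := mk_surjective x
    exact (hval (.const I v)).trans (hc.const v trivial)
  · obtain ⟨K, hK⟩ := exists_square_lift isCoveringMap_mk mk_surjective H
    obtain rfl : N.mk.comp K = H := ContinuousMap.ext hK
    have := hc.square K fun _ => trivial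
    simp only [← hval (K.comp _)] at this
    exact this

open Classical in
/-- The cocycle that detects the order-two class. -/
lemma exists_cocycle_torsion (β : A) (hβ : (2 : ℤ) • β = 0) :
    ∃ d : C(I, N) → A, IsCocycleOn Set.univ d ∧ d pathA = 0 ∧ d pathB = β := by
  let pw : C(Cover, Circle) := ⟨fun x => x.2.1, by fun_prop⟩
  -- The starting point is `β` times the winding number of `w`. Inversion of `w` reverses its sign,
  -- which `2β = 0` makes invisible, except that the principal argument fails to be odd at `w = -1`.
  -- The function `ε` records this defect.
  let ε (w : Circle) : ℤ := if w = -1 then 1 else 0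
  -- This half-open half circle contains exactly one of `z` and `-z`, so the coboundary of `g`
  -- changes under the involution by exactly the defect.
  let P (z : Circle) : Prop := 0 < (z : ℂ).im ∨ ((z : ℂ).im = 0 ∧ 0 < (z : ℂ).re)
  let g (x : Cover) : A := if P x.1 then ε x.2.1 • β else 0
  let ψ : ℤ →+ A := zmultiplesHom A β
  have hw := (isCocycleOn_wind.comp pw (S := Set.univ) fun _ _ => trivial).map ψ
  have hsgn (a : A) (ha : (2 : ℤ) • a = 0) : -a = a := by
    rw [two_smul] at ha; exact neg_eq_of_add_eq_zero_left ha
  have hε (n : ℤ) : -(n • β) = n • β := hsgn _ (by rw [smul_comm, hβ, smul_zero])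
  have harg (w : Circle) : Complex.arg w + Complex.arg (w⁻¹ : Circle) = ε w * (2 * Real.pi) := by
    rw [Circle.coe_inv, Complex.arg_inv]
    have : Complex.arg (w : ℂ) = Real.pi ↔ w = -1 := by
      constructor
      · intro h; rw [← Circle.exp_arg w, h, exp_pi]
      · rintro rfl; simp
    simp only [this, ε]
    split_ifs with h
    · rw [this.2 h]; push_cast; ring
    · push_cast; ring
  have hεinv (w : Circle) : ε w⁻¹ = ε w := by
    have : w⁻¹ = -1 ↔ w = -1 := by rw [inv_eq_iff_eq_inv]; simp
    simp only [ε, this]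
  have hg (x : Cover) : g (flip x) = g x + ε x.2.1 • β := by
    have hz : P (-x.1) ↔ ¬ P x.1 := by
      simp only [P, Circle.coe_neg, Complex.neg_im, Complex.neg_re]
      have h : ¬ ((x.1 : ℂ).im = 0 ∧ (x.1 : ℂ).re = 0) := fun h =>
        x.1.coe_ne_zero (Complex.ext h.2 h.1)
      grind
    simp only [g, flip, hεinv, hz]
    by_cases h : P x.1
    · rw [if_neg (not_not.2 h), if_pos h]
      nth_rewrite 1 [← hε]
      simp
    · rw [if_pos h, if_neg h, zero_add]
  obtain ⟨d, hd, hdv⟩ := exists_descent (hw.add (isCocycleOn_cobdry g Set.univ)) fun δ => by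
    obtain ⟨l, hl⟩ := exists_path_lift Circle.isCoveringMap_exp circle_exp_surjective (pw.comp δ)
    have h1 := wind_eq (γ := pw.comp δ) l hl
    have h2 := wind_eq (γ := pw.comp ((⟨flip, continuous_flip⟩ : C(Cover, Cover)).comp δ))
      ⟨fun t => -l t, by fun_prop⟩ fun t => by simp [Circle.exp_neg, hl, pw, flip]
    have hwd : wind (pw.comp ((⟨flip, continuous_flip⟩ : C(Cover, Cover)).comp δ)) =
        -wind (pw.comp δ) - (ε (δ 1).2.1 - ε (δ 0).2.1) := by
      have a1 := harg (δ 1).2.1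
      have a0 := harg (δ 0).2.1
      simp only [pw, ContinuousMap.comp_apply, ContinuousMap.coe_mk, flip] at h1 h2
      have hpi : (2 * Real.pi) ≠ 0 := by positivity
      rw [← Int.cast_inj (α := ℝ), ← mul_left_inj' hpi]
      push_cast
      simp only [pw]
      linarith
    simp only [Pi.add_apply, hwd, cobdry, ContinuousMap.comp_apply, ContinuousMap.coe_mk, hg, ψ,
      zmultiplesHom_apply, sub_smul, neg_smul, hε]
    abel
  refine ⟨d, hd, ?_, ?_⟩
  · rw [pathA, hdv]
    have e : pw.comp ⟨fun t : I => (Circle.exp (Real.pi * t), 1, mid), by fun_prop⟩ =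
      .const I 1 := rfl
    have : (-1 : Circle) ≠ 1 := fun h => by
      have := congrArg (fun z : Circle => (z : ℂ).re) h; norm_num at this
    simp [e, wind_one, cobdry, g, ε, this.symm]
  · rw [pathB, hdv]
    have e : pw.comp ⟨fun t : I => (1, loop t, mid), by fun_prop⟩ = loop := rfl
    simp [e, wind_loop, cobdry, loop_zero, loop_one, ψ]

/-- The function `z²` winds once along `pathA` and is constant along `pathB`, so `y` times its
winding number corrects the first value without changing the second. -/
lemma exists_cocycle (y β : A) (hβ : (2 : ℤ) • β = 0) :
    ∃ d : C(I, N) → A, IsCocycleOn Set.univ d ∧ d pathA = y ∧ d pathB = β := by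
  obtain ⟨d, hd, hdA, hdB⟩ := exists_cocycle_torsion β hβ
  have hw := (isCocycleOn_wind.comp zsq (S := Set.univ) fun _ _ => trivial).map (zmultiplesHom A y)
  refine ⟨_, hw.add hd, ?_, ?_⟩
  · have : zsq.comp pathA = loop := by
      ext t : 1
      simp only [pathA, ContinuousMap.comp_apply, ContinuousMap.coe_mk, zsq_mk, loop]
      rw [← Circle.exp_intCast_mul]
      push_cast
      ring_nf
    simp [this, wind_loop, hdA]
  · have : zsq.comp pathB = .const I 1 := by
      ext t : 1
      simp [pathB]
    simp [this, wind_one, hdB]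

/-- This is the Klein bottle relation: transported along `pathA`, the `w` circle returns with
reversed direction. -/
lemma cocycle_pathB {c : C(I, N) → A} (hc : IsCocycleOn Set.univ c) : (2 : ℤ) • c pathB = 0 := by
  have h := hc.square ⟨fun z => N.mk (Circle.exp (Real.pi * z.1), loop z.2, mid), by fun_prop⟩
    fun _ => trivial
  have a1 : (⟨fun z => N.mk (Circle.exp (Real.pi * z.1), loop z.2, mid), by fun_prop⟩ :
      C(I × I, N)).comp ⟨fun s => (s, 0), by fun_prop⟩ =
      (⟨fun z => N.mk (Circle.exp (Real.pi * z.1), loop z.2, mid), by fun_prop⟩ :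
      C(I × I, N)).comp ⟨fun s => (s, 1), by fun_prop⟩ := by
    ext t : 1; simp [loop_zero, loop_one]
  have a2 : (⟨fun z => N.mk (Circle.exp (Real.pi * z.1), loop z.2, mid), by fun_prop⟩ :
      C(I × I, N)).comp ⟨fun t => (0, t), by fun_prop⟩ = pathB := by
    ext t : 1; simp [pathB]
  let b : C(Circle, N) := N.mk.comp ⟨fun w => (1, w, mid), by fun_prop⟩
  let inv : C(Circle, Circle) := ⟨fun z => z ^ (-1 : ℤ), by fun_prop⟩
  have a3 : (⟨fun z => N.mk (Circle.exp (Real.pi * z.1), loop z.2, mid), by fun_prop⟩ :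
      C(I × I, N)).comp ⟨fun t => (1, t), by fun_prop⟩ = b.comp (inv.comp loop) := by
    ext t : 1
    simp only [b, inv, ContinuousMap.comp_apply, ContinuousMap.coe_mk]
    rw [← mk_flip]
    simp [flip, exp_pi]
  have a4 := isCocycle_circle_closed (hc.comp b (S := Set.univ) fun _ _ => trivial)
    (inv.comp loop) (by simp [loop_zero, loop_one])
  rw [wind_pow] at a4
  rw [a1, a2, a3, a4, add_comm, add_left_inj, show b.comp loop = pathB from rfl, neg_smul,
    one_smul, neg_eq_iff_add_eq_zero] at h
  rw [two_smul, h]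

/-- The values of a cocycle on the boundary curves of `N`. -/
lemma cocycle_bdry {c : C(I, N) → A} (hc : IsCocycleOn Set.univ c) :
    c ((⟨Subtype.val, continuous_subtype_val⟩ : C(N.bdry, N)).comp (phi0.comp loop)) = c pathB ∧
    c ((⟨Subtype.val, continuous_subtype_val⟩ : C(N.bdry, N)).comp (phi1.comp loop)) =
      (2 : ℤ) • c pathA := by
  -- A curve on the boundary is pushed through the interval coordinate from `t = 1` to the Klein
  -- bottle at `t = 0`; the two vertical sides of the square cancel because the curve is closed.
  have key (f : C(Circle, Circle × Circle)) :
      c (N.mk.comp ⟨fun t => ((f (loop t)).1, (f (loop t)).2, mid), by fun_prop⟩) =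
      c (N.mk.comp ⟨fun t => ((f (loop t)).1, (f (loop t)).2, ⟨1, by norm_num⟩), by fun_prop⟩) := by
    have hF : ∀ z : I × I, -1 ≤ (z.2 : ℝ) ∧ (z.2 : ℝ) ≤ 1 := fun z =>
      ⟨by linarith [z.2.2.1], z.2.2.2⟩
    have h := hc.square (N.mk.comp ⟨fun z => ((f (loop z.1)).1, (f (loop z.1)).2,
      (⟨z.2, hF z⟩ : Set.Icc (-1 : ℝ) 1)), by fun_prop⟩) fun _ => trivial
    simp only [ContinuousMap.comp_assoc] at h
    have a : (⟨fun z => ((f (loop z.1)).1, (f (loop z.1)).2,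
        (⟨z.2, hF z⟩ : Set.Icc (-1 : ℝ) 1)), by fun_prop⟩ : C(I × I, Cover)).comp
        ⟨fun t => (0, t), by fun_prop⟩ = (⟨fun z => ((f (loop z.1)).1, (f (loop z.1)).2,
        (⟨z.2, hF z⟩ : Set.Icc (-1 : ℝ) 1)), by fun_prop⟩ : C(I × I, Cover)).comp
        ⟨fun t => (1, t), by fun_prop⟩ := by
      ext t : 1; simp [loop_zero, loop_one]
    rw [a, add_comm, add_right_inj] at h
    exact h
  refine ⟨(key ⟨fun w => (1, w), by fun_prop⟩).symm, ?_⟩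
  rw [← cocycle_double hc]
  exact (key ⟨fun w => (w, 1), by fun_prop⟩).symm

lemma param_injective : Function.Injective N.param := by
  intro x y h
  have h1 : N.mk (x.1, x.2, ⟨1, by norm_num⟩) = N.mk (y.1, y.2, ⟨1, by norm_num⟩) :=
    congrArg Subtype.val h
  rcases mk_eq_mk.1 h1 with h2 | h2
  · exact Prod.ext (congrArg (fun v : Cover => v.1) h2) (congrArg (fun v : Cover => v.2.1) h2)
  · have := congrArg (fun v : Cover => (v.2.2 : ℝ)) h2
    norm_num [flip] at this

lemma param_surjective : Function.Surjective N.param := by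
  rintro ⟨_, y, hy, rfl⟩
  rcases eq_or_eq_neg_of_abs_eq hy with h | h
  · exact ⟨(y.1, y.2.1), Subtype.ext (congrArg N.mk (Prod.ext rfl (Prod.ext rfl
      (Subtype.ext h.symm))))⟩
  · refine ⟨((flip y).1, (flip y).2.1), Subtype.ext ?_⟩
    refine Eq.trans ?_ (mk_flip y)
    exact congrArg N.mk (Prod.ext rfl (Prod.ext rfl (Subtype.ext (by simp [flip, h]))))

/-- The boundary of `N` is a torus. -/
def paramHomeo : Circle × Circle ≃ₜ N.bdry :=
  Continuous.homeoOfEquivCompactToT2 (f := Equiv.ofBijective N.param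
    ⟨param_injective, param_surjective⟩) N.param.continuous

/-- A cocycle on `∂N` that vanishes on `φ₀` and `φ₁` is a coboundary. -/
lemma isTrivialOn_bdry {c : C(I, N.bdry) → A} (hc : IsCocycleOn Set.univ c)
    (h0 : c (phi0.comp loop) = 0) (h1 : c (phi1.comp loop) = 0) : IsTrivialOn Set.univ c :=
  .of_section (T := Set.univ) N.param paramHomeo.symm (by fun_prop) (Set.mapsTo_univ _ _)
    (fun x _ => paramHomeo.apply_symm_apply x)
    (isTrivialOn_torus (hc.comp N.param (S := Set.univ) fun _ _ => trivial) h1 h0)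

end N

end KleinGluing
end
end

/-! ### Collars, and the topology of a glued space -/

section
open unitInterval
noncomputable section
namespace KleinGluing

section CollarPair

variable {X Y : Type} [TopologicalSpace X] [TopologicalSpace Y] {A : Type} [AddCommGroup A]

lemma IsTrivialOn.neg {S : Set X} {c : C(I, X) → A} (hc : IsTrivialOn S c) :
    IsTrivialOn S (-c) := by
  obtain ⟨g, hg⟩ := hc
  refine ⟨-g, fun γ hγ => ?_⟩
  simp only [Pi.neg_apply, hg γ hγ]
  abel

lemma IsTrivialOn.congr {S : Set X} {c d : C(I, X) → A} (hc : IsTrivialOn S c)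
    (h : ∀ γ : C(I, X), (∀ t, γ t ∈ S) → d γ = c γ) : IsTrivialOn S d := by
  obtain ⟨g, hg⟩ := hc
  exact ⟨g, fun γ hγ => (h γ hγ).trans (hg γ hγ)⟩

/-- The end of a homotopy. -/
def finish (H : C(X × I, Y)) : C(X, Y) := ⟨fun x => H (x, 1), by fun_prop⟩

/-- A cocycle and its pullback along a deformation of the identity differ by a coboundary. -/
lemma IsCocycleOn.isTrivialOn_finish_sub {S : Set X} {c : C(I, X) → A} (hc : IsCocycleOn S c)
    (H : C(X × I, X)) (h0 : ∀ x, H (x, 0) = x) (hS : ∀ x ∈ S, ∀ t, H (x, t) ∈ S) :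
    IsTrivialOn S fun γ => c ((finish H).comp γ) - c γ := by
  refine ⟨fun x => c ⟨fun t => H (x, t), by fun_prop⟩, fun γ hγ => ?_⟩
  have h := hc.square ⟨fun z => H (γ z.1, z.2), by fun_prop⟩ fun z => hS _ (hγ _) _
  have h1 : (⟨fun z => H (γ z.1, z.2), by fun_prop⟩ : C(I × I, X)).comp
      ⟨fun s => (s, 0), by fun_prop⟩ = γ := ContinuousMap.ext fun t => h0 _
  rw [h1, add_comm] at h
  rw [sub_eq_sub_iff_add_eq_add]
  exact (add_comm _ _).trans h.symm

/-- A decomposition of a space into two pieces, each of which is a deformation retract of an open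
set in the appropriate sense. -/
structure CollarPair (P Q : Set X) where
  /-- the deformation -/
  H : C(X × I, X)
  /-- the open neighbourhood of the first piece -/
  U : Set X
  /-- the open neighbourhood of the second piece -/
  V : Set X
  isOpen_U : IsOpen U
  isOpen_V : IsOpen V
  union : U ∪ V = Set.univ
  subset_U : P ⊆ U
  subset_V : Q ⊆ V
  H_zero : ∀ x, H (x, 0) = x
  H_P : ∀ x ∈ P, ∀ t, H (x, t) ∈ P
  H_Q : ∀ x ∈ Q, ∀ t, H (x, t) ∈ Q
  H_U : ∀ x ∈ U, ∀ t, H (x, t) ∈ U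
  H_V : ∀ x ∈ V, ∀ t, H (x, t) ∈ V
  H_one_U : ∀ x ∈ U, H (x, 1) ∈ P
  H_one_V : ∀ x ∈ V, H (x, 1) ∈ Q

namespace CollarPair

variable {P Q : Set X}

/-- Cocycles on the two pieces that agree on the intersection come from a cocycle on the space. -/
lemma exists_cocycle (D : CollarPair P Q) {c d : C(I, X) → A} (hc : IsCocycleOn P c) (hd : IsCocycleOn Q d)
    (h : ∀ γ : C(I, X), (∀ t, γ t ∈ P ∩ Q) → c γ = d γ) :
    ∃ e : C(I, X) → A, IsCocycleOn Set.univ e ∧ IsTrivialOn P (e - c) ∧ IsTrivialOn Q (e - d) := by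
  -- Pulling back along the end of the deformation extends both cocycles to the open sets. They
  -- agree on `U ∩ V` because the deformation ends there in `P ∩ Q`.
  obtain ⟨e, he, heU, heV⟩ := exists_glue D.isOpen_U D.isOpen_V
    (hc.comp (finish D.H) D.H_one_U) (hd.comp (finish D.H) D.H_one_V)
    fun γ hγ => h _ fun t => ⟨D.H_one_U _ (hγ t).1, D.H_one_V _ (hγ t).2⟩
  rw [D.union] at he
  refine ⟨e, he, (hc.isTrivialOn_finish_sub D.H D.H_zero D.H_P).congr fun γ hγ => ?_,
    (hd.isTrivialOn_finish_sub D.H D.H_zero D.H_Q).congr fun γ hγ => ?_⟩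
  · rw [Pi.sub_apply, heU γ fun t => D.subset_U (hγ t)]
  · rw [Pi.sub_apply, heV γ fun t => D.subset_V (hγ t)]

/-- A cocycle that is a coboundary on each piece is a coboundary. -/
lemma isTrivialOn (D : CollarPair P Q)
    (hPQ : ∀ x ∈ P ∩ Q, ∀ y ∈ P ∩ Q, JoinedIn (P ∩ Q) x y) {c : C(I, X) → A}
    (hc : IsCocycleOn Set.univ c) (hP : IsTrivialOn P c) (hQ : IsTrivialOn Q c) :
    IsTrivialOn Set.univ c := by
  have key {S T : Set X} (hT : IsTrivialOn T c) (hS : ∀ x ∈ S, ∀ t, D.H (x, t) ∈ S)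
      (h1 : ∀ x ∈ S, D.H (x, 1) ∈ T) : IsTrivialOn S c := by
    have h2 := hT.comp (finish D.H) h1
    have h3 := ((hc.mono (Set.subset_univ S)).isTrivialOn_finish_sub D.H D.H_zero hS).neg
    exact (h2.add h3).congr fun γ _ => by simp
  rw [← D.union] at hc ⊢
  -- The track of the deformation joins each point of the open overlap to `P ∩ Q`, so the open
  -- overlap inherits path-connectedness.
  have hj (x) (hx : x ∈ D.U ∩ D.V) : JoinedIn (D.U ∩ D.V) x (D.H (x, 1)) :=
    ⟨⟨⟨fun t => D.H (x, t), by fun_prop⟩, D.H_zero x, rfl⟩,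
      fun t => ⟨D.H_U _ hx.1 _, D.H_V _ hx.2 _⟩⟩
  refine IsCocycleOn.isTrivialOn_union D.isOpen_U D.isOpen_V (fun x hx y hy => ?_)
    hc (key hP D.H_U D.H_one_U) (key hQ D.H_V D.H_one_V)
  refine ((hj x hx).trans ?_).trans (hj y hy).symm
  exact (hPQ _ ⟨D.H_one_U _ hx.1, D.H_one_V _ hx.2⟩ _ ⟨D.H_one_U _ hy.1, D.H_one_V _ hy.2⟩).mono
    (Set.inter_subset_inter D.subset_U D.subset_V)

end CollarPair

/-- A collar of a subspace, as a deformation. -/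
structure BdryCollar (S : Set X) where
  /-- the deformation -/
  H : C(X × I, X)
  /-- the collar -/
  W : Set X
  isOpen_W : IsOpen W
  subset_W : S ⊆ W
  H_zero : ∀ x, H (x, 0) = x
  H_S : ∀ x ∈ S, ∀ t, H (x, t) = x
  H_W : ∀ x ∈ W, ∀ t, H (x, t) ∈ W
  H_one : ∀ x ∈ W, H (x, 1) ∈ S

end CollarPair

namespace Glue

variable {P Q : Type} [TopologicalSpace P] [TopologicalSpace Q] {S : Set P} {T : Set Q}
  (h : T ≃ₜ S)

/-- The first piece of a glued space. -/
def inl : C(P, Glue h) := ⟨fun x => Quot.mk _ (.inl x), continuous_quot_mk.comp continuous_inl⟩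

/-- The second piece of a glued space. -/
def inr : C(Q, Glue h) := ⟨fun x => Quot.mk _ (.inr x), continuous_quot_mk.comp continuous_inr⟩

lemma inl_eq_inr (t : T) : inl h (h t : P) = inr h t := Quot.sound ⟨t, rfl, rfl⟩

lemma inl_eq_inr' (s : S) : inl h s = inr h (h.symm s) := by
  rw [← inl_eq_inr, Homeomorph.apply_symm_apply]

variable {h} in
lemma ind {p : Glue h → Prop} (hl : ∀ x, p (inl h x)) (hr : ∀ x, p (inr h x)) (x : Glue h) : p x := by
  obtain ⟨y | y, rfl⟩ := Quot.exists_rep x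
  · exact hl y
  · exact hr y

/-- Maps out of a glued space. -/
def lift {Z : Type} [TopologicalSpace Z] (f : C(P, Z)) (g : C(Q, Z))
    (hfg : ∀ t : T, f (h t) = g t) : C(Glue h, Z) :=
  ⟨Quot.lift (Sum.elim f g) (by rintro _ _ ⟨t, rfl, rfl⟩; exact hfg t),
    continuous_quot_lift _ (by fun_prop)⟩

/-- Subsets of a glued space. -/
def glueSet (U : Set P) (V : Set Q) (hUV : ∀ t : T, (h t : P) ∈ U ↔ (t : Q) ∈ V) : Set (Glue h) :=
  {x | Quot.lift (Sum.elim (· ∈ U) (· ∈ V))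
    (by rintro _ _ ⟨t, rfl, rfl⟩; exact propext (hUV t)) x}

lemma isOpen_glueSet {U : Set P} {V : Set Q} (hUV : ∀ t : T, (h t : P) ∈ U ↔ (t : Q) ∈ V)
    (hU : IsOpen U) (hV : IsOpen V) : IsOpen (glueSet h U V hUV) := by
  have : Topology.IsQuotientMap (Quot.mk (fun x y : P ⊕ Q => ∃ t : T, x = Sum.inl (h t : P) ∧
    y = Sum.inr (t : Q))) := isQuotientMap_quot_mk
  exact this.isOpen_preimage.1 (isOpen_sum_iff.2 ⟨hU, hV⟩)

/-- The gluing relation is not an equivalence relation, so equality in the quotient is tested with a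
predicate on the two pieces that respects the relation and holds at `x`. -/
lemma exists_eq_of_inl_eq_inr {x : P} {y : Q} (hxy : inl h x = inr h y) :
    ∃ t : T, (h t : P) = x ∧ (t : Q) = y := by
  have : inr h y ∈ {z : Glue h | Quot.lift (Sum.elim (fun z => z = x ∨ ∃ t : T, (h t : P) = x ∧ (h t : P) = z) (fun z => ∃ t : T, (h t : P) = x ∧ (t : Q) = z))
    (by
      rintro _ _ ⟨t, rfl, rfl⟩
      refine propext ⟨?_, ?_⟩
      · rintro (h1 | ⟨t', h1, h2⟩)
        · exact ⟨t, h1, rfl⟩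
        · exact ⟨t, h2.symm.trans h1, rfl⟩
      · rintro ⟨t', h1, h2⟩
        rw [Subtype.ext h2] at h1
        exact .inl h1) z} := by
    rw [← hxy]
    exact .inl rfl
  exact this

lemma inl_injective : Function.Injective (inl h) := by
  intro x y hxy
  classical
  let F : Glue h → Set P := Quot.lift (Sum.elim (fun x => {x})
    (fun y => {x | ∃ t : T, (t : Q) = y ∧ x = h t})) (by
      rintro _ _ ⟨t, rfl, rfl⟩
      ext z
      constructor
      · rintro rfl
        exact ⟨t, rfl, rfl⟩
      · rintro ⟨t', h1, rfl⟩
        rw [Subtype.ext h1]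
        rfl)
  exact Set.singleton_injective (congrArg F hxy)

lemma inr_injective : Function.Injective (inr h) := by
  intro x y hxy
  let F : Glue h → Set Q := Quot.lift (Sum.elim (fun y => {x | ∃ t : T, (h t : P) = y ∧ x = t})
    (fun x => {x})) (by
      rintro _ _ ⟨t, rfl, rfl⟩
      ext z
      constructor
      · rintro ⟨t', h1, rfl⟩
        rw [h.injective (Subtype.ext h1)]
        rfl
      · rintro rfl
        exact ⟨t, rfl, rfl⟩)
  exact Set.singleton_injective (congrArg F hxy)

/-- The image of a closed set meets the other piece in a closed subset of `T`, which is closed there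
because `T` is. -/
lemma isClosedEmbedding_inl (hT : IsClosed T) : Topology.IsClosedEmbedding (inl h) := by
  refine .of_continuous_injective_isClosedMap (inl h).continuous (inl_injective h) fun C hC => ?_
  have : Topology.IsQuotientMap (Quot.mk (fun x y : P ⊕ Q => ∃ t : T, x = Sum.inl (h t : P) ∧
    y = Sum.inr (t : Q))) := isQuotientMap_quot_mk
  refine this.isClosed_preimage.1 (isClosed_sum_iff.2 ⟨?_, ?_⟩)
  · convert hC
    exact Set.preimage_image_eq C (inl_injective h)
  · convert hT.isClosedEmbedding_subtypeVal.isClosedMap _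
      (hC.preimage (continuous_subtype_val.comp h.continuous)) using 1
    ext y
    constructor
    · rintro ⟨x, hx, hxy⟩
      obtain ⟨t, rfl, rfl⟩ := exists_eq_of_inl_eq_inr h hxy
      exact ⟨t, hx, rfl⟩
    · rintro ⟨t, ht, rfl⟩
      exact ⟨_, ht, inl_eq_inr h t⟩

lemma isClosedEmbedding_inr (hS : IsClosed S) : Topology.IsClosedEmbedding (inr h) := by
  refine .of_continuous_injective_isClosedMap (inr h).continuous (inr_injective h) fun C hC => ?_
  have : Topology.IsQuotientMap (Quot.mk (fun x y : P ⊕ Q => ∃ t : T, x = Sum.inl (h t : P) ∧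
    y = Sum.inr (t : Q))) := isQuotientMap_quot_mk
  refine this.isClosed_preimage.1 (isClosed_sum_iff.2 ⟨?_, ?_⟩)
  · convert hS.isClosedEmbedding_subtypeVal.isClosedMap _
      (hC.preimage (continuous_subtype_val.comp h.symm.continuous)) using 1
    ext y
    constructor
    · rintro ⟨x, hx, hxy⟩
      obtain ⟨t, rfl, rfl⟩ := exists_eq_of_inl_eq_inr h hxy.symm
      exact ⟨h t, by simpa using hx, rfl⟩
    · rintro ⟨t, ht, rfl⟩
      exact ⟨_, ht, (inl_eq_inr' h t).symm⟩
  · convert hC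
    exact Set.preimage_image_eq C (inr_injective h)

lemma range_inter_range : Set.range (inl h) ∩ Set.range (inr h) = Set.range fun t : T => inr h t := by
  ext x
  constructor
  · rintro ⟨⟨y, rfl⟩, ⟨z, hz⟩⟩
    obtain ⟨t, rfl, rfl⟩ := exists_eq_of_inl_eq_inr h hz.symm
    exact ⟨t, hz⟩
  · rintro ⟨t, rfl⟩
    exact ⟨⟨_, inl_eq_inr h t⟩, _, rfl⟩

/-- A space glued along collared subspaces is decomposed into the two pieces. -/
def collarPair (DS : BdryCollar S) (DT : BdryCollar T) :
    CollarPair (Set.range (inl h)) (Set.range (inr h)) :=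
  let K : C(Glue h, C(I, Glue h)) := lift h ((inl h).comp DS.H).curry ((inr h).comp DT.H).curry
    fun t => by
      ext s : 1
      simp only [ContinuousMap.curry_apply, ContinuousMap.comp_apply]
      rw [DS.H_S _ (h t).2, DT.H_S _ t.2, inl_eq_inr]
  let U := glueSet h Set.univ DT.W fun t => iff_of_true trivial (DT.subset_W t.2)
  let V := glueSet h DS.W Set.univ fun t => iff_of_true (DS.subset_W (h t).2) trivial
  { H := ⟨fun z => K z.1 z.2, by fun_prop⟩
    U := U
    V := V
    isOpen_U := isOpen_glueSet h _ isOpen_univ DT.isOpen_W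
    isOpen_V := isOpen_glueSet h _ DS.isOpen_W isOpen_univ
    union := Set.eq_univ_of_forall (ind (fun _ => .inl trivial) fun _ => .inr trivial)
    subset_U := by rintro _ ⟨x, rfl⟩; exact trivial
    subset_V := by rintro _ ⟨x, rfl⟩; exact trivial
    H_zero := ind (fun x => congrArg (inl h) (DS.H_zero x)) fun x => congrArg (inr h) (DT.H_zero x)
    H_P := by rintro _ ⟨x, rfl⟩ t; exact ⟨_, rfl⟩
    H_Q := by rintro _ ⟨x, rfl⟩ t; exact ⟨_, rfl⟩
    H_U := ind (fun _ _ _ => trivial) fun x hx t => DT.H_W x hx t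
    H_V := ind (fun x hx t => DS.H_W x hx t) fun _ _ _ => trivial
    H_one_U := ind (fun x _ => ⟨_, rfl⟩) fun x hx =>
      ⟨h ⟨DT.H (x, 1), DT.H_one x hx⟩, inl_eq_inr h ⟨DT.H (x, 1), DT.H_one x hx⟩⟩
    H_one_V := ind (fun x hx => ⟨h.symm ⟨DS.H (x, 1), DS.H_one x hx⟩,
      (inl_eq_inr' h ⟨DS.H (x, 1), DS.H_one x hx⟩).symm⟩) fun x _ => ⟨_, rfl⟩ }

end Glue

end KleinGluing
end
end

/-! ### Cocycles on a glued space, and the collar of `N` -/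

section
open unitInterval
noncomputable section
namespace KleinGluing

section Embedding

variable {X Y : Type} [TopologicalSpace X] [TopologicalSpace Y] {A : Type} [AddCommGroup A]

lemma continuousOn_invFun [Nonempty X] {f : X → Y} (hf : Topology.IsEmbedding f) :
    ContinuousOn (Function.invFun f) (Set.range f) := by
  rw [continuousOn_iff_continuous_domRestrict]
  refine hf.toHomeomorph.symm.continuous.congr ?_
  rintro ⟨_, x, rfl⟩
  rw [Set.domRestrict_apply, Function.leftInverse_invFun hf.injective]
  exact hf.toHomeomorph.symm_apply_apply x

/-- A cocycle on a space gives one on its image under an embedding. -/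
lemma IsCocycleOn.exists_range [Nonempty X] {c : C(I, X) → A} (hc : IsCocycleOn Set.univ c)
    (f : C(X, Y)) (hf : Topology.IsEmbedding f) :
    ∃ d : C(I, Y) → A, IsCocycleOn (Set.range f) d ∧ ∀ γ, d (f.comp γ) = c γ := by
  obtain ⟨d, hd, h⟩ := hc.exists_pullback (continuousOn_invFun hf) (Set.mapsTo_univ _ _)
  exact ⟨d, hd, fun γ => h _ _ (fun t => ⟨γ t, rfl⟩) fun t =>
    (Function.leftInverse_invFun hf.injective _).symm⟩

lemma IsTrivialOn.range [Nonempty X] {c : C(I, Y) → A} (f : C(X, Y)) (hf : Topology.IsEmbedding f)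
    (hc : IsTrivialOn Set.univ fun γ => c (f.comp γ)) : IsTrivialOn (Set.range f) c := by
  refine .of_section f _ (continuousOn_invFun hf) (Set.mapsTo_univ _ _) ?_ hc
  rintro _ ⟨x, rfl⟩
  rw [Function.leftInverse_invFun hf.injective]

end Embedding

namespace Glue

variable {P Q : Type} [TopologicalSpace P] [TopologicalSpace Q] {S : Set P} {T : Set Q}
  (h : T ≃ₜ S) {A : Type} [AddCommGroup A]

/-- Cocycles on the two pieces that are cohomologous on the intersection come from a cocycle on
the glued space. -/
lemma exists_cocycle [Nonempty P] [Nonempty Q] (DS : BdryCollar S) (DT : BdryCollar T)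
    (hS : IsClosed S) (hT : IsClosed T) {c : C(I, P) → A} {d : C(I, Q) → A}
    (hc : IsCocycleOn Set.univ c) (hd : IsCocycleOn Set.univ d)
    (hcd : IsTrivialOn Set.univ fun γ : C(I, T) =>
      c ((⟨fun t => h t, by fun_prop⟩ : C(T, P)).comp γ) -
        d ((⟨Subtype.val, continuous_subtype_val⟩ : C(T, Q)).comp γ)) :
    ∃ e : C(I, Glue h) → A, IsCocycleOn Set.univ e ∧
      IsTrivialOn Set.univ (fun γ => e ((inl h).comp γ) - c γ) ∧
      IsTrivialOn Set.univ (fun γ => e ((inr h).comp γ) - d γ) := by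
  classical
  obtain ⟨g, hg⟩ := hcd
  -- Cohomologous on `T` becomes equal on `T` once the coboundary of `g` is added to `d`. Any
  -- extension of `g` will do, since primitives need not be continuous.
  let g' (y : Q) : A := if hy : y ∈ T then g ⟨y, hy⟩ else 0
  have hg' (t : T) : g' t = g t := dif_pos t.2
  obtain ⟨c', hc', hcc'⟩ := hc.exists_range (inl h) (isClosedEmbedding_inl h hT).isEmbedding
  obtain ⟨d', hd', hdd'⟩ := (hd.add (isCocycleOn_cobdry g' Set.univ)).exists_range (inr h)
    (isClosedEmbedding_inr h hS).isEmbedding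
  obtain ⟨e, he, h1, h2⟩ := (collarPair h DS DT).exists_cocycle hc' hd' fun γ hγ => by
    have hr (t) : γ t ∈ Set.range fun t : T => inr h t := by
      rw [← range_inter_range]; exact hγ t
    have hemb : Topology.IsEmbedding fun t : T => inr h t :=
      (isClosedEmbedding_inr h hS).isEmbedding.comp .subtypeVal
    let δ : C(I, T) := ⟨fun t => hemb.toHomeomorph.symm ⟨γ t, hr t⟩, by fun_prop⟩
    have hδ (t) : inr h (δ t) = γ t := congrArg Subtype.val
      (hemb.toHomeomorph.apply_symm_apply ⟨γ t, hr t⟩)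
    have e1 : γ = (inl h).comp ((⟨fun t => h t, by fun_prop⟩ : C(T, P)).comp δ) :=
      ContinuousMap.ext fun t => (hδ t).symm.trans (inl_eq_inr h (δ t)).symm
    have e2 : γ = (inr h).comp ((⟨Subtype.val, continuous_subtype_val⟩ : C(T, Q)).comp δ) :=
      ContinuousMap.ext fun t => (hδ t).symm
    have h3 := hg δ fun _ => trivial
    have h4 := hcc' ((⟨fun t => h t, by fun_prop⟩ : C(T, P)).comp δ)
    have h5 := hdd' ((⟨Subtype.val, continuous_subtype_val⟩ : C(T, Q)).comp δ)
    rw [← e1] at h4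
    rw [← e2] at h5
    rw [h4, h5, Pi.add_apply]
    simp only [cobdry, ContinuousMap.comp_apply, ContinuousMap.coe_mk, hg']
    rw [← h3]
    exact (add_sub_cancel _ _).symm
  refine ⟨e, he, (h1.comp (S := Set.univ) (inl h) fun x _ => ⟨x, rfl⟩).congr fun γ _ => ?_,
    ((h2.comp (S := Set.univ) (inr h) fun x _ => ⟨x, rfl⟩).add
      (isTrivialOn_cobdry g' _)).congr fun γ _ => ?_⟩
  · rw [Pi.sub_apply, hcc']
  · rw [Pi.add_apply, Pi.sub_apply, hdd', Pi.add_apply]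
    abel

/-- A cocycle on a glued space that is a coboundary on both pieces is a coboundary. -/
lemma isTrivialOn [Nonempty P] [Nonempty Q] (DS : BdryCollar S) (DT : BdryCollar T)
    (hS : IsClosed S) (hT : IsClosed T) (hj : ∀ x y : T, Joined x y) {e : C(I, Glue h) → A}
    (he : IsCocycleOn Set.univ e) (hl : IsTrivialOn Set.univ fun γ => e ((inl h).comp γ))
    (hr : IsTrivialOn Set.univ fun γ => e ((inr h).comp γ)) : IsTrivialOn Set.univ e := by
  refine (collarPair h DS DT).isTrivialOn ?_ he
    (hl.range _ (isClosedEmbedding_inl h hT).isEmbedding)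
    (hr.range _ (isClosedEmbedding_inr h hS).isEmbedding)
  rw [range_inter_range]
  rintro _ ⟨x, rfl⟩ _ ⟨y, rfl⟩
  obtain ⟨γ⟩ := hj x y
  exact ⟨γ.map (f := fun t : T => inr h t) (by fun_prop), fun t => ⟨γ t, rfl⟩⟩

end Glue

/-! ### Collars -/

/-- The collar of the boundary torus of `N`. -/
def N.squeeze (s : I) (t : Set.Icc (-1 : ℝ) 1) : Set.Icc (-1 : ℝ) 1 :=
  ⟨(1 - s) * t + s * max (-1) (min 1 (2 * (t : ℝ))), by
    have h0 := s.2.1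
    have h1 := s.2.2
    obtain ⟨t, ht0, ht1⟩ := t
    have h2 : -1 ≤ max (-1) (min 1 (2 * t)) := le_max_left _ _
    have h3 : max (-1) (min 1 (2 * t)) ≤ 1 := max_le (by norm_num) (min_le_left _ _)
    constructor <;> simp only <;> nlinarith⟩

namespace N

lemma continuous_squeeze : Continuous fun x : I × Set.Icc (-1 : ℝ) 1 => squeeze x.1 x.2 :=
  Continuous.subtype_mk (by fun_prop) _

lemma squeeze_zero (t : Set.Icc (-1 : ℝ) 1) : squeeze 0 t = t := Subtype.ext (by simp [squeeze])

/-- Being odd in `t`, the squeezing commutes with the involution and so descends to `N`. -/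
lemma squeeze_neg (s : I) (t : Set.Icc (-1 : ℝ) 1) :
    ((squeeze s ⟨-t, neg_le_neg t.2.2, neg_le.mp t.2.1⟩ : Set.Icc (-1 : ℝ) 1) : ℝ) =
      -(squeeze s t : ℝ) := by
  have : max (-1) (min 1 (2 * (-(t : ℝ)))) = -max (-1) (min 1 (2 * (t : ℝ))) := by
    grind
  simp only [squeeze, this]
  ring

lemma abs_squeeze (s : I) (t : Set.Icc (-1 : ℝ) 1) :
    |(squeeze s t : ℝ)| = (1 - s) * |(t : ℝ)| + s * min 1 (2 * |(t : ℝ)|) := by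
  have h0 := s.2.1
  have h1 := s.2.2
  simp only [squeeze]
  rcases le_total 0 (t : ℝ) with ht | ht
  · have e : max (-1) (min 1 (2 * (t : ℝ))) = min 1 (2 * (t : ℝ)) := by grind
    rw [e, abs_of_nonneg ht, abs_of_nonneg]
    have := le_min zero_le_one (by positivity : 0 ≤ 2 * (t : ℝ))
    have := sub_nonneg.2 h1
    positivity
  · have e : max (-1) (min 1 (2 * (t : ℝ))) = -min 1 (2 * -(t : ℝ)) := by grind
    rw [e, abs_of_nonpos ht, abs_of_nonpos]
    · ring
    · have h2 := le_min zero_le_one (by linarith : 0 ≤ 2 * -(t : ℝ))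
      nlinarith

/-- The deformation of `N` that squeezes a collar onto the boundary. -/
def deform : C(N × I, N) :=
  let F : C(Cover, C(I, N)) := ContinuousMap.curry
    ⟨fun x => N.mk (x.1.1, x.1.2.1, squeeze x.2 x.1.2.2),
      N.mk.continuous.comp (by
        have := continuous_squeeze.comp
          (show Continuous fun x : Cover × I => (x.2, x.1.2.2) by fun_prop)
        exact Continuous.prodMk (by fun_prop) (Continuous.prodMk (by fun_prop) this))⟩
  let K : C(N, C(I, N)) := ⟨Quot.lift F fun a b h => by
    subst h
    ext s : 1
    simp only [F, ContinuousMap.curry_apply, ContinuousMap.coe_mk]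
    rw [← mk_flip]
    congr 1
    exact Prod.ext rfl (Prod.ext rfl (Subtype.ext (squeeze_neg s a.2.2).symm)),
    continuous_quot_lift _ F.continuous⟩
  ⟨fun z => K z.1 z.2, by fun_prop⟩

lemma deform_mk (x : Cover) (s : I) : deform (N.mk x, s) = N.mk (x.1, x.2.1, squeeze s x.2.2) := rfl

lemma mem_bdry_mk (x : Cover) : N.mk x ∈ N.bdry ↔ |(x.2.2 : ℝ)| = 1 := by
  constructor
  · rintro ⟨y, hy, hxy⟩
    have := congrArg absT hxy
    rwa [absT_mk, absT_mk, hy, eq_comm] at this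
  · exact fun h => ⟨x, h, rfl⟩

/-- The collar of the boundary of `N`. -/
def bdryCollar : BdryCollar N.bdry where
  H := deform
  -- Clamped doubling sends every `t` with `|t| ≥ 1 / 2` to an endpoint.
  W := {x | 1 / 2 < absT x}
  isOpen_W := isOpen_lt continuous_const absT.continuous
  subset_W := by
    rintro _ ⟨y, hy, rfl⟩
    simp only [Set.mem_ofPred_eq, absT_mk, hy]
    norm_num
  H_zero x := by
    obtain ⟨y, rfl⟩ := mk_surjective x
    rw [deform_mk, squeeze_zero]
  H_S x hx s := by
    obtain ⟨y, rfl⟩ := mk_surjective x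
    rw [mem_bdry_mk] at hx
    rw [deform_mk]
    refine congrArg N.mk (Prod.ext rfl (Prod.ext rfl (Subtype.ext ?_)))
    have : max (-1) (min 1 (2 * (y.2.2 : ℝ))) = y.2.2 := by grind
    simp only [squeeze, this]
    ring
  H_W x hx s := by
    obtain ⟨y, rfl⟩ := mk_surjective x
    simp only [Set.mem_ofPred_eq, absT_mk] at hx
    simp only [Set.mem_ofPred_eq, deform_mk, absT_mk, abs_squeeze]
    rw [min_eq_left (by linarith)]
    have h1 : |(y.2.2 : ℝ)| ≤ 1 := abs_le.2 y.2.2.2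
    nlinarith [mul_nonneg s.2.1 (sub_nonneg.2 h1)]
  H_one x hx := by
    obtain ⟨y, rfl⟩ := mk_surjective x
    simp only [Set.mem_ofPred_eq, absT_mk] at hx
    rw [deform_mk, mem_bdry_mk, abs_squeeze, min_eq_left (by linarith)]
    simp

lemma isClosed_bdry : IsClosed N.bdry := by
  have : N.bdry = {x | absT x = 1} := by
    ext x
    obtain ⟨y, rfl⟩ := mk_surjective x
    rw [mem_bdry_mk]
    rfl
  rw [this]
  exact isClosed_eq absT.continuous continuous_const

lemma joined_bdry (x y : N.bdry) : Joined x y := by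
  obtain ⟨x, rfl⟩ := param_surjective x
  obtain ⟨y, rfl⟩ := param_surjective y
  exact ⟨(PathConnectedSpace.joined x y).somePath.map N.param.continuous⟩

end N

end KleinGluing
end
end

section
open unitInterval
noncomputable section
namespace KleinGluing

variable {A : Type} [AddCommGroup A]

/-! ### Radial rescaling -/

/-- A radial scaling factor: `r * radial r` is `1` for `1 / 2 ≤ r ≤ 3 / 2` and `r` for `2 ≤ r`. -/
def radial (r : ℝ) : ℝ := max (min 2 (max r (1 / 4))⁻¹) (min 1 (2 - 2 * (max r (1 / 4))⁻¹))

lemma continuous_radial : Continuous radial := by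
  have : Continuous fun r : ℝ => (max r (1 / 4))⁻¹ :=
    Continuous.inv₀ (by fun_prop) fun r => (lt_of_lt_of_le (by norm_num) (le_max_right r _)).ne'
  unfold radial
  fun_prop

lemma radial_eq_one {r : ℝ} (hr : 2 ≤ r) : radial r = 1 := by
  have h1 : max r (1 / 4) = r := max_eq_left (by linarith)
  have h2 : r⁻¹ ≤ 1 / 2 := by
    rw [inv_le_comm₀ (by linarith) (by norm_num)]; norm_num; exact hr
  have h3 : 0 < r⁻¹ := inv_pos.2 (by linarith)
  rw [radial, h1]
  grind

lemma radial_nonneg (r : ℝ) : 0 ≤ radial r := by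
  have h3 : 0 < (max r (1 / 4))⁻¹ := inv_pos.2 (lt_of_lt_of_le (by norm_num) (le_max_right r _))
  exact le_max_of_le_left (le_min (by norm_num) h3.le)

lemma radial_le {r : ℝ} (h0 : 0 ≤ r) (hr : r ≤ 3 / 2) : radial r * r ≤ 1 := by
  rcases le_total r (1 / 4) with h | h
  · rw [radial, max_eq_right h]
    norm_num
    linarith
  · have hpos : 0 < r := by linarith
    have h1 : r * r⁻¹ = 1 := mul_inv_cancel₀ hpos.ne'
    -- At `r = 3 / 2` the branch `2 - 2 / r` of the maximum meets the branch `1 / r`; up to there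
    -- the latter dominates.
    have h4 : 2 / 3 ≤ r⁻¹ := by
      rw [le_inv_comm₀ (by norm_num) hpos]; norm_num; exact hr
    have h5 : radial r ≤ r⁻¹ := by
      rw [radial, max_eq_left h]
      exact max_le (min_le_right _ _) ((min_le_right _ _).trans (by linarith))
    nlinarith

lemma le_radial {r : ℝ} (hr : 1 / 2 ≤ r) : 1 ≤ radial r * r := by
  have hpos : 0 < r := by linarith
  have h1 : r * r⁻¹ = 1 := mul_inv_cancel₀ hpos.ne'
  have h4 : r⁻¹ ≤ 2 := by
    rw [inv_le_comm₀ hpos (by norm_num)]; norm_num at hr ⊢; exact hr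
  have h5 : r⁻¹ ≤ radial r := by
    rw [radial, max_eq_left (by linarith : 1 / 4 ≤ r), min_eq_right h4]
    exact le_max_left _ _
  nlinarith

/-- The radial deformation of the open solid torus. -/
def radialMap (x : (Circle × ℂ) × I) : Circle × ℂ :=
  (x.1.1, (((1 - x.2) + x.2 * radial ‖x.1.2‖ : ℝ) : ℂ) * x.1.2)

lemma continuous_radialMap : Continuous radialMap := by
  have := continuous_radial
  unfold radialMap
  fun_prop

lemma norm_radialMap (x : (Circle × ℂ) × I) :
    ‖(radialMap x).2‖ = (1 - x.2) * ‖x.1.2‖ + x.2 * (radial ‖x.1.2‖ * ‖x.1.2‖) := by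
  have h0 : 0 ≤ (1 - x.2) + x.2 * radial ‖x.1.2‖ := by
    have := radial_nonneg ‖x.1.2‖
    have := x.2.2.1
    have := sub_nonneg.2 x.2.2.2
    positivity
  rw [radialMap, norm_mul, Complex.norm_real, Real.norm_of_nonneg h0]
  ring

lemma radialMap_zero (y : Circle × ℂ) : radialMap (y, 0) = y := by
  simp [radialMap]

lemma radialMap_of_two_le {y : Circle × ℂ} (hy : 2 ≤ ‖y.2‖) (s : I) : radialMap (y, s) = y := by
  simp [radialMap, radial_eq_one hy]

lemma radialMap_of_eq_one {y : Circle × ℂ} (hy : ‖y.2‖ = 1) (s : I) : radialMap (y, s) = y := by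
  have h1 := radial_le (r := 1) (by norm_num) (by norm_num)
  have h2 := le_radial (r := 1) (by norm_num)
  have : radial 1 = 1 := by linarith
  simp [radialMap, hy, this]

namespace TubularNbhd

variable {J : C(Circle, S3)} (τ : TubularNbhd J)

lemma isCompact_ball (R : ℝ) : IsCompact (τ.toFun '' {y | ‖y.2‖ ≤ R}) := by
  have : {y : Circle × ℂ | ‖y.2‖ ≤ R} = Set.univ ×ˢ Metric.closedBall 0 R := by
    ext y; simp
  rw [this]
  exact (isCompact_univ.prod (isCompact_closedBall 0 R)).image τ.isOpenEmbedding.continuous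

lemma mem_image_iff {p : Circle × ℂ → Prop} (y : Circle × ℂ) :
    τ.toFun y ∈ τ.toFun '' {y | p y} ↔ p y :=
  τ.isOpenEmbedding.injective.mem_set_image

lemma mem_exterior_iff (y : Circle × ℂ) : τ.toFun y ∈ τ.exterior ↔ 1 ≤ ‖y.2‖ := by
  rw [exterior, Set.mem_compl_iff, mem_image_iff, not_lt]

open Classical in
/-- The radial deformation of the sphere. -/
def pushFun (x : S3 × I) : S3 :=
  if x.1 ∈ Set.range τ.toFun then τ.toFun (radialMap (Function.invFun τ.toFun x.1, x.2)) else x.1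

lemma pushFun_apply (y : Circle × ℂ) (s : I) :
    τ.pushFun (τ.toFun y, s) = τ.toFun (radialMap (y, s)) := by
  rw [pushFun, if_pos ⟨y, rfl⟩, Function.leftInverse_invFun τ.isOpenEmbedding.injective]

lemma pushFun_of_notMem {x : S3} (hx : x ∉ τ.toFun '' {y | ‖y.2‖ ≤ 2}) (s : I) :
    τ.pushFun (x, s) = x := by
  by_cases h : x ∈ Set.range τ.toFun
  · obtain ⟨y, rfl⟩ := h
    rw [mem_image_iff, not_le] at hx
    rw [pushFun_apply, radialMap_of_two_le hx.le]
  · exact if_neg h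

/-- On the open solid torus the map is the radial deformation in coordinates. A point outside has a
neighbourhood that misses the compact solid torus of radius two, and there the map is stationary. -/
lemma continuous_pushFun : Continuous τ.pushFun := by
  rw [continuous_iff_continuousAt]
  rintro ⟨x, s⟩
  by_cases h : x ∈ Set.range τ.toFun
  · obtain ⟨y, rfl⟩ := h
    have he : Topology.IsOpenEmbedding (Prod.map τ.toFun (id : I → I)) :=
      τ.isOpenEmbedding.prodMap .id
    have : ContinuousAt (τ.pushFun ∘ Prod.map τ.toFun (id : I → I)) (y, s) := by
      have e : τ.pushFun ∘ Prod.map τ.toFun (id : I → I) = τ.toFun ∘ radialMap :=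
        funext fun z => τ.pushFun_apply z.1 z.2
      rw [e]
      exact (τ.isOpenEmbedding.continuous.comp continuous_radialMap).continuousAt
    exact he.continuousAt_iff.1 this
  · have hx : x ∈ (τ.toFun '' {y | ‖y.2‖ ≤ 2})ᶜ := fun ⟨y, _, hy⟩ => h ⟨y, hy⟩
    have hopen := (τ.isCompact_ball 2).isClosed.isOpen_compl
    refine continuousAt_fst.congr ?_
    filter_upwards [(hopen.preimage continuous_fst).mem_nhds hx] with z hz
    exact (τ.pushFun_of_notMem hz z.2).symm

/-- The radial deformation of the sphere. -/
def push : C(S3 × I, S3) := ⟨τ.pushFun, τ.continuous_pushFun⟩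

lemma push_apply (y : Circle × ℂ) (s : I) : τ.push (τ.toFun y, s) = τ.toFun (radialMap (y, s)) :=
  τ.pushFun_apply y s

lemma push_of_notMem {x : S3} (hx : x ∉ Set.range τ.toFun) (s : I) : τ.push (x, s) = x :=
  τ.pushFun_of_notMem (fun ⟨y, _, hy⟩ => hx ⟨y, hy⟩) s

lemma push_zero (x : S3) : τ.push (x, 0) = x := by
  by_cases hx : x ∈ Set.range τ.toFun
  · obtain ⟨y, rfl⟩ := hx
    rw [push_apply, radialMap_zero]
  · exact τ.push_of_notMem hx 0

lemma push_mem_exterior {x : S3} (hx : x ∈ τ.exterior) (s : I) : τ.push (x, s) ∈ τ.exterior := by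
  by_cases h : x ∈ Set.range τ.toFun
  · obtain ⟨y, rfl⟩ := h
    rw [mem_exterior_iff] at hx
    have := le_radial (r := ‖y.2‖) (by linarith)
    rw [push_apply, mem_exterior_iff, norm_radialMap]
    nlinarith [s.2.1, s.2.2]
  · rwa [τ.push_of_notMem h]

/-- The larger open solid torus. -/
def nbhd : Set S3 := τ.toFun '' {y | ‖y.2‖ < 3 / 2}

lemma isOpen_nbhd : IsOpen τ.nbhd :=
  τ.isOpenEmbedding.isOpenMap _ (isOpen_lt (by fun_prop) continuous_const)

lemma push_mem_nbhd {x : S3} (hx : x ∈ τ.nbhd) (s : I) : τ.push (x, s) ∈ τ.nbhd := by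
  obtain ⟨y, hy, rfl⟩ := hx
  have hy : ‖y.2‖ < 3 / 2 := hy
  have := radial_le (r := ‖y.2‖) (norm_nonneg _) hy.le
  rw [push_apply, nbhd, mem_image_iff, norm_radialMap]
  rcases le_total ‖y.2‖ 1 with h1 | h1 <;> nlinarith [s.2.1, s.2.2]

lemma push_one_mem {x : S3} (hx : x ∈ τ.nbhd) :
    τ.push (x, 1) ∈ τ.toFun '' {y | ‖y.2‖ ≤ 1} := by
  obtain ⟨y, hy, rfl⟩ := hx
  have hy : ‖y.2‖ < 3 / 2 := hy
  have := radial_le (r := ‖y.2‖) (norm_nonneg _) hy.le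
  rw [push_apply, mem_image_iff, norm_radialMap]
  simpa using this

/-- The sphere is the union of the knot exterior and a solid torus. -/
def collarPair : CollarPair τ.exterior (τ.toFun '' {y | ‖y.2‖ ≤ 1}) where
  H := τ.push
  U := (τ.toFun '' {y | ‖y.2‖ ≤ 1 / 2})ᶜ
  V := τ.nbhd
  isOpen_U := (τ.isCompact_ball _).isClosed.isOpen_compl
  isOpen_V := τ.isOpen_nbhd
  union := by
    refine Set.eq_univ_of_forall fun x => ?_
    by_cases h : x ∈ τ.toFun '' {y | ‖y.2‖ ≤ 1 / 2}
    · obtain ⟨y, hy, rfl⟩ := h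
      have hy : ‖y.2‖ ≤ 1 / 2 := hy
      exact .inr ⟨y, show ‖y.2‖ < 3 / 2 by linarith, rfl⟩
    · exact .inl h
  subset_U := by
    rintro x hx ⟨y, hy, rfl⟩
    rw [mem_exterior_iff] at hx
    exact absurd (hx.trans hy) (by norm_num)
  subset_V := Set.image_mono fun y (hy : ‖y.2‖ ≤ 1) =>
    show ‖y.2‖ < 3 / 2 from hy.trans_lt (by norm_num)
  H_zero := τ.push_zero
  H_P x hx s := τ.push_mem_exterior hx s
  H_Q := by
    rintro _ ⟨y, hy, rfl⟩ s
    have hy : ‖y.2‖ ≤ 1 := hy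
    have := radial_le (r := ‖y.2‖) (norm_nonneg _) (by linarith)
    rw [push_apply, mem_image_iff, norm_radialMap]
    nlinarith [s.2.1, s.2.2]
  H_U x hx s := by
    by_cases h : x ∈ Set.range τ.toFun
    · obtain ⟨y, rfl⟩ := h
      rw [Set.mem_compl_iff, mem_image_iff, not_le] at hx
      have := le_radial (r := ‖y.2‖) hx.le
      rw [push_apply, Set.mem_compl_iff, mem_image_iff, not_le, norm_radialMap]
      rcases le_total ‖y.2‖ 1 with h1 | h1 <;> nlinarith [s.2.1, s.2.2]
    · rwa [τ.push_of_notMem h]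
  H_V x hx s := τ.push_mem_nbhd hx s
  H_one_U x hx := by
    by_cases h : x ∈ Set.range τ.toFun
    · obtain ⟨y, rfl⟩ := h
      rw [Set.mem_compl_iff, mem_image_iff, not_le] at hx
      have := le_radial (r := ‖y.2‖) hx.le
      rw [push_apply, mem_exterior_iff, norm_radialMap]
      simpa using this
    · rw [τ.push_of_notMem h]
      rintro ⟨y, -, hy⟩
      exact h ⟨y, hy⟩
  H_one_V x hx := τ.push_one_mem hx

/-- The collar of the boundary of the exterior. -/
def bdryCollar : BdryCollar τ.bdry where
  H := ⟨fun x => ⟨τ.push (x.1, x.2), τ.push_mem_exterior x.1.2 x.2⟩, by fun_prop⟩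
  W := {x | (x : S3) ∈ τ.nbhd}
  isOpen_W := τ.isOpen_nbhd.preimage continuous_subtype_val
  subset_W := by
    rintro x ⟨y, hy, hx⟩
    exact ⟨y, by simp only [Set.mem_ofPred_eq, hy]; norm_num, hx⟩
  H_zero x := Subtype.ext (τ.push_zero x)
  H_S := by
    rintro x ⟨y, hy, hx⟩ s
    refine Subtype.ext ?_
    simp only [ContinuousMap.coe_mk, ← hx, push_apply, radialMap_of_eq_one hy]
  H_W x hx s := τ.push_mem_nbhd hx s
  H_one x hx := by
    obtain ⟨y, hy, hxy⟩ := τ.push_one_mem hx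
    have h2 := τ.push_mem_exterior x.2 1
    rw [← hxy, mem_exterior_iff] at h2
    exact ⟨y, le_antisymm hy h2, hxy⟩

lemma param_injective : Function.Injective τ.param := by
  intro x y h
  have h1 : τ.toFun (x.1, (x.2 : ℂ)) = τ.toFun (y.1, (y.2 : ℂ)) :=
    congrArg (fun z : τ.bdry => ((z : τ.exterior) : S3)) h
  have h2 := τ.isOpenEmbedding.injective h1
  exact Prod.ext (congrArg (fun v : Circle × ℂ => v.1) h2) (Circle.ext (congrArg (fun v : Circle × ℂ => v.2) h2))

lemma param_surjective : Function.Surjective τ.param := by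
  rintro ⟨x, y, hy, hx⟩
  exact ⟨(y.1, ⟨y.2, mem_sphere_zero_iff_norm.2 hy⟩), Subtype.ext (Subtype.ext hx)⟩

/-- The boundary of the exterior is a torus. -/
def paramHomeo : Circle × Circle ≃ₜ τ.bdry :=
  Continuous.homeoOfEquivCompactToT2 (f := Equiv.ofBijective τ.param
    ⟨τ.param_injective, τ.param_surjective⟩) τ.param.continuous

lemma isClosed_bdry : IsClosed τ.bdry := by
  have : τ.bdry = Set.range fun x => (τ.param x : τ.exterior) := by
    ext x
    constructor
    · intro hx
      obtain ⟨y, hy⟩ := τ.param_surjective ⟨x, hx⟩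
      exact ⟨y, congrArg Subtype.val hy⟩
    · rintro ⟨y, rfl⟩
      exact (τ.param y).2
  rw [this]
  exact (isCompact_range (continuous_subtype_val.comp τ.param.continuous)).isClosed

/-- A cocycle on the boundary torus that vanishes on a parallel and on the meridian is a
coboundary. -/
lemma isTrivialOn_bdry (n : ℤ) {c : C(I, τ.bdry) → A} (hc : IsCocycleOn Set.univ c)
    (h0 : c ((τ.parallel n).comp loop) = 0) (h1 : c (τ.meridian.comp loop) = 0) :
    IsTrivialOn Set.univ c := by
  -- A shear of the torus turns the coordinate circles into the `n`-th parallel and the meridian.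
  let ψ : C(Circle × Circle, τ.bdry) := τ.param.comp ⟨fun x => (x.1, x.1 ^ n * x.2), by fun_prop⟩
  have e0 : ψ.comp ⟨fun t => (loop t, 1), by fun_prop⟩ = (τ.parallel n).comp loop := by
    ext t : 1
    simp [ψ, parallel]
  have e1 : ψ.comp ⟨fun t => (1, loop t), by fun_prop⟩ = τ.meridian.comp loop := by
    ext t : 1
    simp [ψ, meridian]
  refine .of_section (T := Set.univ) ψ (fun x => ((τ.paramHomeo.symm x).1,
    ((τ.paramHomeo.symm x).1 ^ n)⁻¹ * (τ.paramHomeo.symm x).2)) (by fun_prop)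
    (Set.mapsTo_univ _ _) (fun x _ => ?_)
    (isTrivialOn_torus (hc.comp ψ (S := Set.univ) fun _ _ => trivial) ?_ ?_)
  · simp only [ψ, ContinuousMap.comp_apply, ContinuousMap.coe_mk, mul_inv_cancel_left]
    exact τ.paramHomeo.apply_symm_apply x
  · rw [e0, h0]
  · rw [e1, h1]

/-- A cocycle on the exterior that vanishes on a parallel and on the meridian is a coboundary. -/
lemma isTrivialOn_exterior (n : ℤ) {c : C(I, τ.exterior) → A} (hc : IsCocycleOn Set.univ c)
    (h0 : c ((τ.incl.comp (τ.parallel n)).comp loop) = 0)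
    (h1 : c ((τ.incl.comp τ.meridian).comp loop) = 0) : IsTrivialOn Set.univ c := by
  classical
  obtain ⟨g, hg⟩ := τ.isTrivialOn_bdry n (hc.comp τ.incl (S := Set.univ) fun _ _ => trivial) h0 h1
  let v : C(τ.exterior, S3) := ⟨Subtype.val, continuous_subtype_val⟩
  have : Nonempty τ.exterior := ⟨τ.param (1, 1)⟩
  obtain ⟨d, hd, hdv⟩ := hc.exists_range v .subtypeVal
  have hrange : Set.range v = τ.exterior := Subtype.range_val
  -- The cocycle is the coboundary of `g` on the boundary torus. Extending `g` by zero lets the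
  -- coboundary extend it over the solid torus, hence to the whole sphere, where every cocycle is
  -- trivial.
  let g' (x : S3) : A := if h : ∃ y : τ.bdry, (y : S3) = x then g h.choose else 0
  have hg' (y : τ.bdry) : g' y = g y := by
    have h : ∃ z : τ.bdry, (z : S3) = y := ⟨y, rfl⟩
    simp only [g']
    rw [dif_pos h]
    exact congrArg g (Subtype.ext (Subtype.ext h.choose_spec))
  rw [hrange] at hd
  obtain ⟨e, he, he1, -⟩ := τ.collarPair.exists_cocycle hd (isCocycleOn_cobdry g' _) fun γ hγ => by
    have hb (t) : (⟨γ t, (hγ t).1⟩ : τ.exterior) ∈ τ.bdry := by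
      obtain ⟨y, hy, hyt⟩ := (hγ t).2
      refine ⟨y, le_antisymm hy ?_, hyt⟩
      rw [← mem_exterior_iff, hyt]
      exact (hγ t).1
    let δ : C(I, τ.bdry) := ⟨fun t => ⟨⟨γ t, (hγ t).1⟩, hb t⟩, by fun_prop⟩
    have e1 : γ = v.comp (τ.incl.comp δ) := rfl
    have h2 := hg δ fun _ => trivial
    have h3 := hdv (τ.incl.comp δ)
    rw [← e1] at h3
    rw [h3]
    refine h2.trans ?_
    rw [← hg', ← hg']
    rfl
  have htriv := IsCocycleOn.isTrivialOn_sphere (by simp) he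
  have h2 := (htriv.mono (Set.subset_univ τ.exterior)).add he1.neg
  refine (h2.comp (S := Set.univ) v fun x _ => x.2).congr fun γ _ => ?_
  simp [hdv]

/-- There is an integral cocycle on the exterior that takes the value one on the meridian. -/
lemma exists_cocycle_meridian : ∃ c : C(I, τ.exterior) → ℤ, IsCocycleOn Set.univ c ∧
    c ((τ.incl.comp τ.meridian).comp loop) = 1 := by
  -- `E` is the complement of the core and `V` the open tubular neighbourhood. On `E ∩ V` the angle
  -- of the disc coordinate has a winding cocycle `w`; its part on `E` in a splitting is the cocycle
  -- sought.
  let E : Set S3 := (τ.toFun '' {y | ‖y.2‖ ≤ 0})ᶜ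
  let V : Set S3 := Set.range τ.toFun
  have hE : IsOpen E := (τ.isCompact_ball 0).isClosed.isOpen_compl
  have hV : IsOpen V := τ.isOpenEmbedding.isOpen_range
  have hEV : E ∪ V = Set.univ := by
    refine Set.eq_univ_of_forall fun x => ?_
    by_cases h : x ∈ V
    · exact .inr h
    · exact .inl fun ⟨y, _, hy⟩ => h ⟨y, hy⟩
  have hmem (y : Circle × ℂ) : τ.toFun y ∈ E ↔ y.2 ≠ 0 := by
    rw [Set.mem_compl_iff, mem_image_iff, norm_le_zero_iff]
  let f (x : S3) : Circle := Circle.exp (Complex.arg (Function.invFun τ.toFun x).2)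
  have hfτ (y : Circle × ℂ) (hy : y.2 ≠ 0) : ((f (τ.toFun y) : Circle) : ℂ) = y.2 / ‖y.2‖ := by
    simp only [f, Function.leftInverse_invFun τ.isOpenEmbedding.injective y]
    rw [eq_div_iff (by simpa using hy), Circle.coe_exp, mul_comm, Complex.norm_mul_exp_arg_mul_I]
  have hf : ContinuousOn f (E ∩ V) := by
    refine Topology.IsInducing.subtypeVal.continuousOn_iff.2 ?_
    have hinv : ContinuousOn (Function.invFun τ.toFun) (E ∩ V) :=
      (continuousOn_invFun τ.isOpenEmbedding.isEmbedding).mono Set.inter_subset_right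
    have hne : ∀ x ∈ E ∩ V, (Function.invFun τ.toFun x).2 ≠ 0 := by
      rintro _ ⟨hx, y, rfl⟩
      rw [Function.leftInverse_invFun τ.isOpenEmbedding.injective]
      exact (hmem y).1 hx
    have hdiv : ContinuousOn (fun x => (Function.invFun τ.toFun x).2 /
        ((‖(Function.invFun τ.toFun x).2‖ : ℝ) : ℂ)) (E ∩ V) := by
      have h2 : ContinuousOn (fun x => (Function.invFun τ.toFun x).2) (E ∩ V) :=
        continuous_snd.comp_continuousOn hinv
      refine h2.div (Complex.continuous_ofReal.comp_continuousOn h2.norm) fun x hx => ?_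
      simpa using hne x hx
    refine hdiv.congr ?_
    rintro _ ⟨hx, y, rfl⟩
    simp only [Function.comp, Function.leftInverse_invFun τ.isOpenEmbedding.injective y]
    exact hfτ y ((hmem y).1 hx)
  obtain ⟨w, hw, hwf⟩ := isCocycleOn_wind.exists_pullback hf (Set.mapsTo_univ _ _)
  have hp : τ.toFun (1, 1) ∈ E := (hmem _).2 one_ne_zero
  obtain ⟨c, d, hc, hd, hcd⟩ := splitsOver_S3 hE hV hEV hp hw
  rw [Set.univ_inter] at hc hd
  let v : C(τ.exterior, S3) := ⟨Subtype.val, continuous_subtype_val⟩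
  have hv : ∀ x ∈ (Set.univ : Set τ.exterior), v x ∈ E := by
    rintro ⟨_, hx⟩ - ⟨y, hy, rfl⟩
    rw [mem_exterior_iff] at hx
    exact absurd (hx.trans hy) (by norm_num)
  refine ⟨_, hc.comp v hv, ?_⟩
  let γ : C(I, S3) := v.comp ((τ.incl.comp τ.meridian).comp loop)
  have hγ (t : I) : γ t = τ.toFun (1, (loop t : ℂ)) := rfl
  have h1 := hcd γ fun t => ⟨trivial, (hmem _).2 (loop t).coe_ne_zero, _, rfl⟩
  have h2 : w γ = 1 := by
    rw [← wind_loop]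
    refine hwf _ _ (fun t => ⟨(hmem _).2 (loop t).coe_ne_zero, _, rfl⟩) fun t => ?_
    rw [hγ]
    ext
    rw [hfτ _ (loop t).coe_ne_zero, Circle.norm_coe, Complex.ofReal_one, div_one]
  -- The meridian lies in a fibre disc contained in `V`, where `d` is a coboundary, so the whole
  -- winding number one is carried by `c`.
  have h3 : d γ = 0 := by
    let j : C(ℂ, S3) := ⟨fun z => τ.toFun (1, z), τ.isOpenEmbedding.continuous.comp (by fun_prop)⟩
    obtain ⟨g, hg⟩ := (hd.comp j (S := Set.univ) fun z _ => ⟨_, rfl⟩).isTrivialOn_convex convex_univ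
    have := hg ⟨fun t => (loop t : ℂ), by fun_prop⟩ fun _ => trivial
    refine Eq.trans this ?_
    change g ((loop 1 : Circle) : ℂ) - g ((loop 0 : Circle) : ℂ) = 0
    rw [loop_zero, loop_one, sub_self]
  rw [h2, h3, sub_zero] at h1
  exact h1

end TubularNbhd

end KleinGluing
end
end

section
open unitInterval
noncomputable section
namespace KleinGluing

/-! ### A presentation -/

/-- `G` is the abelian group generated by `m` and `a` with the relations `2 p m = 0` and
`s m = 2 a`. -/
structure IsPresented (G : Type) [AddCommGroup G] (m a : G) (p s : ℤ) : Prop where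
  gen : ∀ x : G, ∃ i j : ℤ, x = i • m + j • a
  rel_m : (2 * p) • m = 0
  rel_a : s • m = (2 : ℤ) • a
  exists_hom : ∀ (A : Type) [AddCommGroup A] (M a' : A), (2 * p) • M = 0 → s • M = (2 : ℤ) • a' →
    ∃ f : G →+ A, f m = M ∧ f a = a'

namespace IsPresented

variable {G : Type} [AddCommGroup G] {m a : G} {p s : ℤ}

/-- The lower bound comes from the test homomorphism `m ↦ 2`, `a ↦ s` to the integers modulo `4|p|`,
in which `2` has order `2|p|`. For `p = 0` the target is `ℤ` and the order is recorded as zero. -/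
lemma addOrderOf_eq (hG : IsPresented G m a p s) : addOrderOf m = (2 * p).natAbs := by
  refine Nat.dvd_antisymm ?_ ?_
  · rw [← Int.natCast_dvd, addOrderOf_dvd_iff_zsmul_eq_zero]
    exact hG.rel_m
  · have hp : ((2 * (2 * p) : ℤ) : ZMod (2 * (2 * p)).natAbs) = 0 :=
      (ZMod.intCast_zmod_eq_zero_iff_dvd _ _).2 (Int.natAbs_dvd.2 dvd_rfl)
    obtain ⟨f, hf, -⟩ := hG.exists_hom (ZMod (2 * (2 * p)).natAbs) 2 s
      (by rw [zsmul_eq_mul, ← hp]; push_cast; ring) (by simp [mul_comm])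
    have h1 : f ((addOrderOf m : ℤ) • m) = 0 := by
      rw [addOrderOf_dvd_iff_zsmul_eq_zero.1 dvd_rfl, map_zero]
    rw [map_zsmul, hf, zsmul_eq_mul] at h1
    have h2 : (((addOrderOf m : ℤ) * 2 : ℤ) : ZMod (2 * (2 * p)).natAbs) = 0 := by
      rw [← h1]; push_cast; rfl
    rw [ZMod.intCast_zmod_eq_zero_iff_dvd, Int.natAbs_dvd, mul_comm _ (2 : ℤ)] at h2
    have h3 : 2 * p ∣ addOrderOf m := (mul_dvd_mul_iff_left (two_ne_zero (α := ℤ))).1 h2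
    exact Int.natAbs_dvd_natAbs.2 h3

/-- Killing `m` leaves a group of order two generated by `a`, and the kernel of this projection is
the cyclic group generated by `m`. For `p = 0` the group is infinite and both sides are zero. -/
lemma card_eq (hG : IsPresented G m a p s) : Nat.card G = 4 * p.natAbs := by
  obtain ⟨g, hgm, hga⟩ := hG.exists_hom (ZMod 2) 0 1 (by simp)
    (by rw [smul_zero]; rfl)
  have hker : g.ker = AddSubgroup.zmultiples m := by
    ext x
    rw [AddMonoidHom.mem_ker, AddSubgroup.mem_zmultiples_iff]
    constructor
    · intro hx
      obtain ⟨i, j, rfl⟩ := hG.gen x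
      rw [map_add, map_zsmul, map_zsmul, hgm, hga, smul_zero, zero_add, zsmul_one,
        ZMod.intCast_zmod_eq_zero_iff_dvd] at hx
      obtain ⟨k, rfl⟩ := hx
      refine ⟨i + k * s, ?_⟩
      rw [add_smul, mul_smul, hG.rel_a, smul_smul, mul_comm k]
      rfl
    · rintro ⟨k, rfl⟩
      rw [map_zsmul, hgm, smul_zero]
  have hsurj : Function.Surjective g := fun y => by
    obtain ⟨j, rfl⟩ := ZMod.intCast_surjective y
    exact ⟨j • a, by rw [map_zsmul, hga, zsmul_one]⟩
  rw [AddSubgroup.card_eq_card_quotient_mul_card_addSubgroup g.ker,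
    Nat.card_congr (QuotientAddGroup.quotientKerEquivOfSurjective g hsurj).toEquiv, hker,
    Nat.card_zmultiples, hG.addOrderOf_eq, Nat.card_zmod, Int.natAbs_mul]
  ring_nf

/-- A surjection between finite sets of the same size is a bijection, so a surjective homomorphism
is all that must be found. -/
lemma nonempty_equiv (hG : IsPresented G m a p s) {A : Type} [AddCommGroup A] [Finite A]
    (hA : Nat.card A = 4 * p.natAbs) (f : G →+ A) (hf : Function.Surjective f) :
    Nonempty (G ≃+ A) := by
  have hp : Nat.card G ≠ 0 := by rw [hG.card_eq, ← hA]; exact Nat.card_pos.ne'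
  have := Nat.finite_of_card_ne_zero hp
  exact ⟨AddEquiv.ofBijective f (hf.bijective_of_nat_card_le (by rw [hG.card_eq, hA]))⟩

lemma nonempty_equiv_of_even (hG : IsPresented G m a p s) (hp : |p| = 2) (hs : Even s) :
    Nonempty (G ≃+ ZMod 2 × ZMod 4) := by
  obtain ⟨t, rfl⟩ := hs
  have hpn : p.natAbs = 2 := by rw [Int.abs_eq_natAbs] at hp; omega
  -- With `s = 2t` the element `a - t m` has order dividing two, and it is sent to the generator of
  -- the first factor.
  obtain ⟨f, hfm, hfa⟩ := hG.exists_hom (ZMod 2 × ZMod 4) (0, 1) (1, t)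
    (by
      rcases (abs_eq (by norm_num)).1 hp with rfl | rfl <;> decide)
    (by
      refine Prod.ext ?_ ?_
      · rw [Prod.smul_fst, Prod.smul_fst, smul_zero]; rfl
      · rw [Prod.smul_snd, Prod.smul_snd, zsmul_one, zsmul_eq_mul]
        push_cast
        ring)
  refine hG.nonempty_equiv (by rw [Nat.card_prod, Nat.card_zmod, Nat.card_zmod, hpn]) f ?_
  rintro ⟨x, y⟩
  obtain ⟨j, rfl⟩ := ZMod.intCast_surjective x
  obtain ⟨i, rfl⟩ := ZMod.intCast_surjective y
  refine ⟨j • a + (i - j * t) • m, ?_⟩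
  rw [map_add, map_zsmul, map_zsmul, hfm, hfa]
  refine Prod.ext (by simp) (by simp)

lemma nonempty_equiv_of_odd (hG : IsPresented G m a p s) (hp : |p| = 2) (hs : Odd s) :
    Nonempty (G ≃+ ZMod 8) := by
  obtain ⟨t, rfl⟩ := hs
  have hpn : p.natAbs = 2 := by rw [Int.abs_eq_natAbs] at hp; omega
  -- With `s = 2t + 1` the images `m ↦ 2`, `a ↦ s` satisfy the relations, and `a - t m` goes to `1`.
  obtain ⟨f, hfm, hfa⟩ := hG.exists_hom (ZMod 8) 2 (2 * t + 1 : ℤ)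
    (by
      rcases (abs_eq (by norm_num)).1 hp with rfl | rfl <;> decide)
    (by rw [zsmul_eq_mul, zsmul_eq_mul]; push_cast; ring)
  refine hG.nonempty_equiv (by rw [Nat.card_zmod, hpn]) f fun y => ?_
  obtain ⟨k, rfl⟩ := ZMod.intCast_surjective y
  refine ⟨k • a + (-(k * t)) • m, ?_⟩
  rw [map_add, map_zsmul, map_zsmul, hfm, hfa, zsmul_eq_mul, zsmul_eq_mul]
  push_cast
  ring

end IsPresented

/-! ### The homology of the glued manifold -/

section Gluing

variable {J : C(Circle, S3)} {τ : TubularNbhd J} {A : Type} [AddCommGroup A]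

instance : Nonempty N := ⟨N.mk (1, 1, N.mid)⟩

instance : Nonempty τ.exterior := ⟨τ.param (1, 1)⟩

/-- The null-homologous longitude gives zero in every cocycle. -/
lemma TubularNbhd.IsLongitude.cocycle_eq_zero {n : ℤ} (hn : τ.IsLongitude n) {u : H1 Circle}
    (hu : IsFundamentalClass u) {c : C(I, τ.exterior) → A} (hc : IsCocycleOn Set.univ c) :
    c ((τ.incl.comp (τ.parallel n)).comp loop) = 0 := by
  rw [← hu.eq_zero_iff, ← evalHom_map_circle hc, show H1.map _ = 0 from hn, LinearMap.zero_apply,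
    map_zero]

/-- A homological relation between curves holds for the values of cocycles. -/
lemma cocycle_eq_of_homology {T S : Type} [TopologicalSpace T] [TopologicalSpace S] (h : C(T, S))
    {f : C(Circle, T)} {l m : C(Circle, S)} {u : H1 Circle} (hu : IsFundamentalClass u) {q p : ℤ}
    (hrel : H1.map h (H1.map f u) = q • H1.map l u + p • H1.map m u) {c : C(I, S) → A}
    (hc : IsCocycleOn Set.univ c) :
    c (h.comp (f.comp loop)) = q • c (l.comp loop) + p • c (m.comp loop) := by
  have h1 := congrArg (evalHom hc) hrel
  rw [map_add, map_zsmul, map_zsmul, evalHom_map hc h, evalHom_map_circle, evalHom_map_circle,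
    evalHom_map_circle, smul_comm q, smul_comm p, ← smul_add, ← sub_eq_zero, ← smul_sub,
    hu.eq_zero_iff, sub_eq_zero] at h1
  exact h1

lemma IsTrivialOn.eq_of_closed {X : Type} [TopologicalSpace X] {c : C(I, X) → A}
    (hc : IsTrivialOn Set.univ c) (γ : C(I, X)) (hγ : γ 0 = γ 1) : c γ = 0 := by
  obtain ⟨g, hg⟩ := hc
  rw [hg γ fun _ => trivial, hγ, sub_self]

variable (h : N.bdry ≃ₜ τ.bdry)

/-- The meridian as a path in the glued manifold. -/
def pathM : C(I, Glue h) := (Glue.inl h).comp ((τ.incl.comp τ.meridian).comp loop)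

lemma inl_comp_eq_inr_comp (γ : C(I, N.bdry)) :
    (Glue.inl h).comp (τ.incl.comp ((⟨h, h.continuous⟩ : C(N.bdry, τ.bdry)).comp γ)) =
      (Glue.inr h).comp ((⟨Subtype.val, continuous_subtype_val⟩ : C(N.bdry, N)).comp γ) :=
  ContinuousMap.ext fun t => Glue.inl_eq_inr h (γ t)

variable {h} {u : H1 Circle} {n q r p s : ℤ}

/-- The values of cocycles on the glued manifold. -/
lemma cocycle_relations (hu : IsFundamentalClass u) (hn : τ.IsLongitude n)
    (h0 : bdryMap h (H1.map N.phi0 u) = q • H1.map (τ.parallel n) u + p • H1.map τ.meridian u)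
    (h1 : bdryMap h (H1.map N.phi1 u) = r • H1.map (τ.parallel n) u + s • H1.map τ.meridian u)
    {e : C(I, Glue h) → A} (he : IsCocycleOn Set.univ e) :
    e ((Glue.inr h).comp N.pathB) = p • e (pathM h) ∧
      (2 : ℤ) • e ((Glue.inr h).comp N.pathA) = s • e (pathM h) := by
  have hc := he.comp (Glue.inl h) (S := Set.univ) fun _ _ => trivial
  have hd := he.comp (Glue.inr h) (S := Set.univ) fun _ _ => trivial
  have hcb := hc.comp τ.incl (S := Set.univ) fun _ _ => trivial
  have hl := hn.cocycle_eq_zero hu hc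
  have e0 := cocycle_eq_of_homology _ hu h0 hcb
  have e1 := cocycle_eq_of_homology _ hu h1 hcb
  simp only [inl_comp_eq_inr_comp] at e0 e1
  -- The longitude has value zero in the exterior, so `q` and `r` disappear from the relations.
  rw [← ContinuousMap.comp_assoc τ.incl, ← ContinuousMap.comp_assoc τ.incl, hl, smul_zero,
    zero_add] at e0 e1
  obtain ⟨b0, b1⟩ := N.cocycle_bdry hd
  exact ⟨b0.symm.trans e0, b1.symm.trans e1⟩

/-- The value on `pathB` is `p` times that on the meridian, so it vanishes too; then the cocycle is
a coboundary on each piece. -/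
lemma isTrivialOn_glue (hu : IsFundamentalClass u) (hn : τ.IsLongitude n)
    (h0 : bdryMap h (H1.map N.phi0 u) = q • H1.map (τ.parallel n) u + p • H1.map τ.meridian u)
    (h1 : bdryMap h (H1.map N.phi1 u) = r • H1.map (τ.parallel n) u + s • H1.map τ.meridian u)
    {e : C(I, Glue h) → A} (he : IsCocycleOn Set.univ e) (hm : e (pathM h) = 0)
    (ha : e ((Glue.inr h).comp N.pathA) = 0) : IsTrivialOn Set.univ e := by
  have hc := he.comp (Glue.inl h) (S := Set.univ) fun _ _ => trivial
  have hd := he.comp (Glue.inr h) (S := Set.univ) fun _ _ => trivial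
  have hb := (cocycle_relations hu hn h0 h1 he).1
  rw [hm, smul_zero] at hb
  exact Glue.isTrivialOn h τ.bdryCollar N.bdryCollar τ.isClosed_bdry N.isClosed_bdry N.joined_bdry
    he (τ.isTrivialOn_exterior n hc (hn.cocycle_eq_zero hu hc) hm) (N.isTrivialOn_of_paths hd ha hb)

/-- On the exterior take `M` times the meridian cocycle, and on `N` the cocycle with values `a` and
`pM`, which exists since `2pM = 0`. Their values on `φ₀` and `φ₁` agree, so they are cohomologous on
the torus and glue. -/
lemma exists_cocycle_glue (hu : IsFundamentalClass u) (hn : τ.IsLongitude n)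
    (h0 : bdryMap h (H1.map N.phi0 u) = q • H1.map (τ.parallel n) u + p • H1.map τ.meridian u)
    (h1 : bdryMap h (H1.map N.phi1 u) = r • H1.map (τ.parallel n) u + s • H1.map τ.meridian u)
    {M a : A} (hM : (2 * p) • M = 0) (ha : s • M = (2 : ℤ) • a) :
    ∃ e : C(I, Glue h) → A, IsCocycleOn Set.univ e ∧ e (pathM h) = M ∧
      e ((Glue.inr h).comp N.pathA) = a := by
  obtain ⟨c, hc, hcm⟩ : ∃ c : C(I, τ.exterior) → A, IsCocycleOn Set.univ c ∧
      c ((τ.incl.comp τ.meridian).comp loop) = M := by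
    obtain ⟨c, hc, hcm⟩ := τ.exists_cocycle_meridian
    exact ⟨_, hc.map (zmultiplesHom A M), by
      rw [hcm, zmultiplesHom_apply, one_smul]⟩
  obtain ⟨d, hd, hda, hdb⟩ := N.exists_cocycle a (p • M) (by rw [smul_smul, hM])
  have hcb := hc.comp τ.incl (S := Set.univ) fun _ _ => trivial
  have hl := hn.cocycle_eq_zero hu hc
  have e0 := cocycle_eq_of_homology _ hu h0 hcb
  have e1 := cocycle_eq_of_homology _ hu h1 hcb
  change c _ = q • c _ + p • c ((τ.incl.comp τ.meridian).comp loop) at e0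
  change c _ = r • c _ + s • c ((τ.incl.comp τ.meridian).comp loop) at e1
  rw [← ContinuousMap.comp_assoc τ.incl (τ.parallel n), hl, smul_zero, zero_add, hcm] at e0 e1
  obtain ⟨b0, b1⟩ := N.cocycle_bdry hd
  have htriv := N.isTrivialOn_bdry
    ((hc.comp (S := Set.univ) (⟨fun t => h t, by fun_prop⟩ : C(N.bdry, τ.exterior))
      fun _ _ => trivial).sub (hd.comp (S := Set.univ)
        (⟨Subtype.val, continuous_subtype_val⟩ : C(N.bdry, N)) fun _ _ => trivial))
    (by rw [Pi.sub_apply, b0, hdb, sub_eq_zero]; exact e0)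
    (by rw [Pi.sub_apply, b1, hda, sub_eq_zero, ← ha]; exact e1)
  obtain ⟨e, he, hel, her⟩ := Glue.exists_cocycle h τ.bdryCollar N.bdryCollar τ.isClosed_bdry
    N.isClosed_bdry hc hd htriv
  refine ⟨e, he, ?_, ?_⟩
  · rw [← hcm]
    exact sub_eq_zero.1 (hel.eq_of_closed _ (by simp [loop_zero, loop_one]))
  · rw [← hda]
    exact sub_eq_zero.1 (her.eq_of_closed _ N.pathA_closed)

/-- The first homology of the glued manifold. -/
lemma exists_isPresented (hu : IsFundamentalClass u) (hn : τ.IsLongitude n)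
    (h0 : bdryMap h (H1.map N.phi0 u) = q • H1.map (τ.parallel n) u + p • H1.map τ.meridian u)
    (h1 : bdryMap h (H1.map N.phi1 u) = r • H1.map (τ.parallel n) u + s • H1.map τ.meridian u) :
    ∃ m a : H1 (Glue h), IsPresented (H1 (Glue h)) m a p s := by
  obtain ⟨m, hm⟩ := exists_loop_class (pathM h) (by simp [pathM, loop_zero, loop_one])
  obtain ⟨a, ha⟩ := exists_loop_class ((Glue.inr h).comp N.pathA)
    (congrArg (Glue.inr h) N.pathA_closed)
  obtain ⟨e, he, hid, -⟩ := exists_universal_cocycle (Glue h)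
  have hem : e (pathM h) = m := by rw [← hm he, hid]
  have hea : e ((Glue.inr h).comp N.pathA) = a := by rw [← ha he, hid]
  obtain ⟨r1, r2⟩ := cocycle_relations hu hn h0 h1 he
  refine ⟨m, a, ⟨fun x => ?_, ?_, ?_, fun A _ M a' hM ha' => ?_⟩⟩
  · let L := AddSubgroup.closure {m, a}
    let π : H1 (Glue h) →+ H1 (Glue h) ⧸ L := QuotientAddGroup.mk' L
    obtain ⟨c, hc, hcπ⟩ := exists_evalHom_eq π
    have hLm : π m = 0 := (QuotientAddGroup.eq_zero_iff _).2
      (AddSubgroup.subset_closure (Set.mem_insert _ _))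
    have hLa : π a = 0 := (QuotientAddGroup.eq_zero_iff _).2
      (AddSubgroup.subset_closure (Set.mem_insert_of_mem _ rfl))
    have htriv := isTrivialOn_glue hu hn h0 h1 hc (by rw [← hm hc, hcπ, hLm])
      (by rw [← ha hc, hcπ, hLa])
    have hx : π x = 0 := by rw [← hcπ, evalHom_eq_zero_of_isTrivialOn hc htriv]
    obtain ⟨i, j, hij⟩ := AddSubgroup.mem_closure_pair.1 ((QuotientAddGroup.eq_zero_iff x).1 hx)
    exact ⟨i, j, hij.symm⟩
  -- The relations between `m` and `a` are those between the values of the universal cocycle.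
  · rw [mul_smul, ← hem, ← r1]
    exact N.cocycle_pathB (he.comp (Glue.inr h) (S := Set.univ) fun _ _ => trivial)
  · rw [← hem, ← hea, r2]
  · obtain ⟨c, hc, hcm, hca⟩ := exists_cocycle_glue hu hn h0 h1 hM ha'
    exact ⟨evalHom hc, by rw [hm hc, hcm], by rw [ha hc, hca]⟩

end Gluing

end KleinGluing
end
end

theorem mainTheorem9
    (J : C(Circle, KleinGluing.S3)) (τ : KleinGluing.TubularNbhd J)
    (h : KleinGluing.N.bdry ≃ₜ τ.bdry)
    (u : KleinGluing.H1 Circle) (hu : KleinGluing.IsFundamentalClass u)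
    (n : ℤ) (hn : τ.IsLongitude n)
    (q r p s : ℤ)
    (h0 : KleinGluing.bdryMap h (KleinGluing.H1.map KleinGluing.N.phi0 u) =
      q • KleinGluing.H1.map (τ.parallel n) u + p • KleinGluing.H1.map τ.meridian u)
    (h1 : KleinGluing.bdryMap h (KleinGluing.H1.map KleinGluing.N.phi1 u) =
      r • KleinGluing.H1.map (τ.parallel n) u + s • KleinGluing.H1.map τ.meridian u) :
    (Nat.card (KleinGluing.H1 (KleinGluing.Glue h)) = 8 ↔ |p| = 2) ∧
    (|p| = 2 → Even s →
      Nonempty (KleinGluing.H1 (KleinGluing.Glue h) ≃+ ZMod 2 × ZMod 4)) ∧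
    (|p| = 2 → Odd s →
      Nonempty (KleinGluing.H1 (KleinGluing.Glue h) ≃+ ZMod 8)) := by
  obtain ⟨m, a, hG⟩ := KleinGluing.exists_isPresented hu hn h0 h1
  refine ⟨?_, hG.nonempty_equiv_of_even, hG.nonempty_equiv_of_odd⟩
  rw [hG.card_eq, Int.abs_eq_natAbs]
  omega
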